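/- Let $\mathbb F$ be a quadratically closed field of characteristic zero and let $q\in\mathbb F$ be nonzero and not a root of unity. Put $[n]_q=\frac{q^n-q^{-n}}{q-q^{-1}}$ for $n\in\mathbb Z$, $[n]_q^!=[n]_q\cdots[1]_q$ (with $[0]_q^!=1$) and $c(t)=t-t^{-1}$. Fix an arbitrary square root $q^{1/2}$ of $q$ and, for every $n\in\mathbb N$, an arbitrary square root $[n]_q^{1/2}$ of $[n]_q$; square roots of products and quotients of $q$-integers below are the corresponding products and quotients of these. **The $q$-shuffle algebra.** Let $\mathbb V$ be the $\mathbb F$-vector space with basis all words in the letters $x,y$. Put $\langle x,x\rangle=\langle y,y\rangle=2$ and $\langle x,y\rangle=\langle y,x\rangle=-2$. The $q$-shuffle product $\star$ on $\mathbb V$ is the bilinear product for which the empty word is the unit and, for nonempty words $u=u_1\cdots u_r$ and $v=v_1\cdots v_s$, $$u\star v=u_1\big((u_2\cdots u_r)\star v\big)+q^{\langle v_1,u_1\rangle+\cdots+\langle v_1,u_r\rangle}\,v_1\big(u\star(v_2\cdots v_s)\big).$$ It makes $\mathbb V$ an associative algebra. **R-matrices.** For $j\in\frac12\mathbb N^+$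 let $\mathcal E^{(j+\frac12)}$ be the $(4j+2)\times(2j+2)$ matrix and $\mathcal F^{(j+\frac12)}$ the $(2j+2)\times(4j+2)$ matrix whose nonzero entries are, for $1\le a\le 2j+1$, $$\mathcal E_{(a,a)}=\Big(\tfrac{[2j+2-a]_q}{[2j+1]_q}\Big)^{1/2},\qquad \mathcal E_{(a+2j+1,a+1)}=\Big(\tfrac{[a]_q}{[2j+1]_q}\Big)^{1/2},$$ $$\mathcal F_{(a,a)}=\frac{([2j+2-a]_q[2j+1]_q)^{1/2}}{[2j+2-a]_q+[a-1]_q},\qquad \mathcal F_{(a+1,a+2j+1)}=\frac{([a]_q[2j+1]_q)^{1/2}}{[2j+1-a]_q+[a]_q}.$$ Let $$R^{(\frac12,\frac12)}(t)=\begin{pmatrix}c(qt)&0&0&0\\0&c(t)&c(q)&0\\0&c(q)&c(t)&0\\0&0&0&c(qt)\end{pmatrix},$$ and, for $j_1,j_2\in\frac12\mathbb N^+$, define the $(2j_1+1)(2j_2+1)\times(2j_1+1)(2j_2+1)$ matrix $R^{(j_1,j_2)}(t)$ recursively by $$R^{(\frac12,j_2+\frac12)}(t)=\mathcal F^{(j_2+\frac12)}_{23}R^{(\frac12,j_2)}_{13}(q^{-\frac12}t)R^{(\frac12,\frac12)}_{12}(q^{j_2}t)\mathcal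 E^{(j_2+\frac12)}_{23},$$ $$R^{(j_1+\frac12,j_2)}(t)=\mathcal F^{(j_1+\frac12)}_{12}R^{(\frac12,j_2)}_{13}(q^{-j_1}t)R^{(j_1,j_2)}_{23}(q^{\frac12}t)\mathcal E^{(j_1+\frac12)}_{12},$$ where the lower indices name the tensor factors on which a matrix acts, and tensor products of matrices are Kronecker products. Let $$\widehat R^{(j_1,j_2)}=q^{2\,\mathrm{diag}(j_1,j_1-1,\ldots,-j_1)\otimes\mathrm{diag}(j_2,j_2-1,\ldots,-j_2)}.$$ **K-matrices.** Put $\overline x=1$, $\overline y=-1$. A word $a_1\cdots a_k$ is Catalan if $\overline a_1+\cdots+\overline a_i\ge0$ for all $i$ and $\overline a_1+\cdots+\overline a_k=0$; let $\mathrm{Cat}_n$ be the set of Catalan words of length $2n$. For $m\in\mathbb Z$ let $\Delta^{(m)}(t)=\sum_{n\ge0}\Delta^{(m)}_nt^n$, where $$\Delta^{(m)}_n=\sum_{a_1\cdots a_{2n}\in\mathrm{Cat}_n}\ \prod_{i=1}^{2n}\big[\overline a_1+\cdots+\overline a_{i-1}+m(\overline a_i+1)/2\big]_q\ a_1\cdots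 a_{2n}.$$ For a word $w$, let $x^{-1}w$ be $w$ with its first letter removed if that letter is $x$, and $0$ otherwise; let $wy^{-1}$ be $w$ with its last letter removed if that letter is $y$, and $0$ otherwise. Extend both operations linearly, and coefficientwise to series. For $j\in\frac12\mathbb N^+$ let $K^{(j)}(t)$ be the $(2j+1)\times(2j+1)$ matrix with entries $$K^{(j)}_{(a,b)}(t)=\varphi(a,b,j)\,t^{a-b-2j}\,x^{1-b}\Delta^{(-2j)}(-t^2)\,y^{a-2j-1},$$ $$\varphi(a,b,j)=q^{\rho(a,b,j)}\big([2j]_q^!\big)^{-1}\left(\frac{[a-1]_q^!\,[2j+1-b]_q^!}{[b-1]_q^!\,[2j+1-a]_q^!}\right)^{1/2},$$ $$\rho(a,b,j)=(a^2+b^2+6j^2+4ab-6aj-6bj-6a-6b+13j+6)/2.$$ **Theorem.** Let $s,t$ be indeterminates that commute with each other and with $\mathbb V$. Then for all $j_1,j_2\in\frac12\mathbb N^+$, $$R^{(j_1,j_2)}(t/s)\star K^{(j_1)}_1(s)\star\widehat R^{(j_1,j_2)}\star K^{(j_2)}_2(t)=K^{(j_2)}_2(t)\star\widehat R^{(j_1,j_2)}\star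 K^{(j_1)}_1(s)\star R^{(j_1,j_2)}(t/s),$$ where $K_1^{(j_1)}=K^{(j_1)}\otimes\mathbb I$, $K_2^{(j_2)}=\mathbb I\otimes K^{(j_2)}$, and matrices whose entries are formal Laurent series in $s,t$ over $\mathbb V$ are multiplied using the product $\star$ on coefficients. -/

import Mathlib

open scoped Kronecker

noncomputable section

namespace FreidelMaillet

/-! ### The `q`-shuffle algebra -/

/-- The two letters `x`, `y`. -/
inductive Letter
  | x
  | y
  deriving DecidableEq

instance : Fintype Letter := ⟨{.x, .y}, fun a => by cases a <;> decide⟩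

/-- The sign of a letter: `x` has sign `1` and `y` has sign `-1`. -/
def Letter.sgn : Letter → ℤ
  | .x => 1
  | .y => -1

/-- The form `⟨x,x⟩ = ⟨y,y⟩ = 2`, `⟨x,y⟩ = ⟨y,x⟩ = -2`. -/
def Letter.form (a b : Letter) : ℤ := if a = b then 2 else -2

/-- `⟨a, w₁⟩ + ⋯ + ⟨a, wₙ⟩` for a letter `a` and a word `w = w₁⋯wₙ`. -/
def Letter.formWord (a : Letter) (w : List Letter) : ℤ := (w.map (Letter.form a)).sum

variable {F : Type*} [Field F]

/-- The vector space with basis the words in `x`, `y`.  The parameter `q` only serves to attach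
the `q`-shuffle product to this space. -/
def QShuffle (_q : Fˣ) : Type _ := List Letter →₀ F

namespace QShuffle

variable {q : Fˣ}

instance : AddCommGroup (QShuffle q) := inferInstanceAs (AddCommGroup (List Letter →₀ F))

instance : Module F (QShuffle q) := inferInstanceAs (Module F (List Letter →₀ F))

/-- The standard basis vector attached to a word. -/
def word (q : Fˣ) (w : List Letter) : QShuffle q := (Finsupp.single w 1 : List Letter →₀ F)

/-- The linear map with prescribed values on words. -/
def lift {M : Type*} [AddCommGroup M] [Module F M] (f : List Letter → M) : QShuffle q →ₗ[F] M :=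
  (Finsupp.linearCombination F f : (List Letter →₀ F) →ₗ[F] M)

theorem lift_word {M : Type*} [AddCommGroup M] [Module F M] (f : List Letter → M)
    (w : List Letter) : lift f (word q w) = f w :=
  (Finsupp.linearCombination_single F 1 w).trans (one_smul F _)

theorem hom_ext {M : Type*} [AddCommGroup M] [Module F M] {f g : QShuffle q →ₗ[F] M}
    (h : ∀ w, f (word q w) = g (word q w)) : f = g := by
  refine Finsupp.lhom_ext' (M := F) (N := M) (φ := f) (ψ := g) fun w => ?_
  ext
  exact h w

/-- Concatenation with a letter on the left. -/
def consL (a : Letter) : QShuffle q →ₗ[F] QShuffle q := lift fun w => word q (a :: w)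

theorem consL_word (a : Letter) (w : List Letter) :
    consL a (word q w) = word q (a :: w) := lift_word _ _

/-- The `q`-shuffle product of two words. -/
def starWord (q : Fˣ) : List Letter → List Letter → QShuffle q
  | [], v => word q v
  | u, [] => word q u
  | a :: u, b :: v =>
      consL a (starWord q u (b :: v)) +
        ((q ^ b.formWord (a :: u) : Fˣ) : F) • consL b (starWord q (a :: u) v)
  termination_by u v => u.length + v.length

/-- The `q`-shuffle product, extended bilinearly. -/
def star : QShuffle q →ₗ[F] QShuffle q →ₗ[F] QShuffle q :=
  lift fun u => lift fun v => starWord q u v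

theorem star_word (u v : List Letter) : star (word q u) (word q v) = starWord q u v := by
  simp [star, lift_word]

theorem starWord_nil_left (v : List Letter) : starWord q [] v = word q v := by
  rw [starWord]

theorem starWord_nil_right (u : List Letter) : starWord q u [] = word q u := by
  cases u <;> simp [starWord]

theorem starWord_cons (a b : Letter) (u v : List Letter) :
    starWord q (a :: u) (b :: v) = consL a (starWord q u (b :: v)) +
      ((q ^ b.formWord (a :: u) : Fˣ) : F) • consL b (starWord q (a :: u) v) := by
  rw [starWord]

theorem star_one (X : QShuffle q) : star X (word q []) = X := by
  have : star.flip (word q []) = LinearMap.id := hom_ext fun w => by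
    simp [star_word, starWord_nil_right]
  exact LinearMap.congr_fun this X

theorem one_star (X : QShuffle q) : star (word q []) X = X := by
  have : star (word q []) = LinearMap.id := hom_ext fun w => by
    simp [star_word, starWord_nil_left]
  exact LinearMap.congr_fun this X

/-- The map multiplying a word `w` by `q ^ ⟨c, w⟩`. -/
def twist (c : Letter) : QShuffle q →ₗ[F] QShuffle q :=
  lift fun w => ((q ^ c.formWord w : Fˣ) : F) • word q w

theorem twist_word (c : Letter) (w : List Letter) :
    twist c (word q w) = ((q ^ c.formWord w : Fˣ) : F) • word q w := lift_word _ _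

theorem twist_consL (c a : Letter) (X : QShuffle q) :
    twist c (consL a X) = ((q ^ c.form a : Fˣ) : F) • consL a (twist c X) := by
  have : (twist c) ∘ₗ (consL a) =
      ((q ^ c.form a : Fˣ) : F) • ((consL a) ∘ₗ (twist c) : QShuffle q →ₗ[F] QShuffle q) :=
    hom_ext fun w => by
      simp [consL_word, twist_word, Letter.formWord, zpow_add, smul_smul]
  exact LinearMap.congr_fun this X

theorem twist_starWord (c : Letter) : ∀ u v : List Letter, twist c (starWord q u v) =
    ((q ^ (c.formWord u + c.formWord v) : Fˣ) : F) • starWord q u v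
  | [], v => by simp [starWord_nil_left, twist_word, Letter.formWord]
  | a :: u, [] => by simp [starWord_nil_right, twist_word, Letter.formWord]
  | a :: u, b :: v => by
      rw [starWord_cons, map_add, map_smul, twist_consL, twist_consL,
        twist_starWord c u (b :: v), twist_starWord c (a :: u) v]
      simp only [map_smul, smul_add, smul_smul]
      congr 2
      · simp only [Letter.formWord, List.map_cons, List.sum_cons, zpow_add, Units.val_mul]
        ring
      · simp only [Letter.formWord, List.map_cons, List.sum_cons, zpow_add, Units.val_mul]
        ring
  termination_by u v => u.length + v.length

theorem star_consL_left (a c : Letter) (X : QShuffle q) (w : List Letter) :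
    star (consL a X) (word q (c :: w)) =
      consL a (star X (word q (c :: w))) + consL c (star (twist c (consL a X)) (word q w)) := by
  have : (star.flip (word q (c :: w))) ∘ₗ (consL a) =
      (consL a) ∘ₗ (star.flip (word q (c :: w))) +
        (consL c) ∘ₗ (star.flip (word q w)) ∘ₗ (twist c) ∘ₗ (consL a) :=
    hom_ext fun u => by
      simp [consL_word, twist_word, star_word, starWord_cons]
  exact LinearMap.congr_fun this X

theorem star_consL_right (a c : Letter) (u : List Letter) (X : QShuffle q) :
    star (word q (a :: u)) (consL c X) =
      consL a (star (word q u) (consL c X)) +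
        ((q ^ c.formWord (a :: u) : Fˣ) : F) • consL c (star (word q (a :: u)) X) := by
  have : (star (word q (a :: u))) ∘ₗ (consL c) =
      (consL a) ∘ₗ (star (word q u)) ∘ₗ (consL c) +
        ((q ^ c.formWord (a :: u) : Fˣ) : F) • ((consL c) ∘ₗ (star (word q (a :: u)))) :=
    hom_ext fun v => by
      simp [consL_word, star_word, starWord_cons]
  exact LinearMap.congr_fun this X

theorem star_assoc_word : ∀ u v w : List Letter,
    star (starWord q u v) (word q w) = star (word q u) (starWord q v w)
  | [], v, w => by rw [starWord_nil_left, one_star, star_word]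
  | a :: u, [], w => by rw [starWord_nil_right, starWord_nil_left]
  | a :: u, b :: v, [] => by rw [starWord_nil_right, star_one, star_word]
  | a :: u, b :: v, c :: w => by
      have h1 := star_assoc_word u (b :: v) (c :: w)
      have h2 := star_assoc_word (a :: u) v (c :: w)
      have h3 := star_assoc_word (a :: u) (b :: v) w
      have ht := twist_starWord (q := q) c (a :: u) (b :: v)
      have key : star (starWord q (a :: u) (b :: v)) (word q (c :: w)) =
          consL a (star (starWord q u (b :: v)) (word q (c :: w))) +
          ((q ^ b.formWord (a :: u) : Fˣ) : F) •
            consL b (star (starWord q (a :: u) v) (word q (c :: w))) +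
          consL c (star (twist c (starWord q (a :: u) (b :: v))) (word q w)) := by
        rw [starWord_cons]
        simp only [map_add, map_smul, LinearMap.add_apply, LinearMap.smul_apply,
          star_consL_left, smul_add]
        abel
      rw [key, ht, h1, h2]
      simp only [map_smul, LinearMap.smul_apply, h3]
      rw [starWord_cons b c v w]
      simp only [map_add, map_smul, star_consL_right, smul_add, smul_smul]
      have e : ((q ^ (c.formWord (a :: u) + c.formWord (b :: v)) : Fˣ) : F) =
          ((q ^ c.formWord (b :: v) : Fˣ) : F) * ((q ^ c.formWord (a :: u) : Fˣ) : F) := by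
        rw [zpow_add, Units.val_mul, mul_comm]
      rw [e]
      abel
  termination_by u v w => u.length + v.length + w.length

theorem star_assoc (X Y Z : QShuffle q) : star (star X Y) Z = star X (star Y Z) := by
  have h1 : ∀ (v w : List Letter) (X : QShuffle q),
      star (star X (word q v)) (word q w) = star X (star (word q v) (word q w)) := by
    intro v w X
    have : (star.flip (word q w)) ∘ₗ (star.flip (word q v)) = star.flip (starWord q v w) :=
      hom_ext fun u => by simp [star_word, star_assoc_word]
    rw [star_word]
    exact LinearMap.congr_fun this X
  have h2 : ∀ (w : List Letter) (X Y : QShuffle q),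
      star (star X Y) (word q w) = star X (star Y (word q w)) := by
    intro w X Y
    have : (star.flip (word q w)) ∘ₗ (star X) = (star X) ∘ₗ (star.flip (word q w)) :=
      hom_ext fun v => by simp [h1]
    exact LinearMap.congr_fun this Y
  have : star (star X Y) = (star X) ∘ₗ (star Y) := hom_ext fun w => by simp [h2]
  exact LinearMap.congr_fun this Z

/-- The `q`-shuffle algebra: the product is the `q`-shuffle product and the unit is the
trivial word. -/
instance : Ring (QShuffle q) :=
  { (inferInstance : AddCommGroup (QShuffle q)) with
    mul := fun X Y => star X Y
    one := word q []
    mul_assoc := star_assoc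
    one_mul := one_star
    mul_one := star_one
    left_distrib := fun X Y Z => map_add (star X) Y Z
    right_distrib := fun X Y Z => LinearMap.map_add₂ star X Y Z
    zero_mul := fun X => LinearMap.map_zero₂ star X
    mul_zero := fun X => map_zero (star X) }

instance : Algebra F (QShuffle q) :=
  Algebra.ofModule (fun c X Y => LinearMap.map_smul₂ star c X Y)
    (fun c X Y => map_smul (star X) c Y)

/-- The operator `w ↦ a⁻¹ w`: it removes the first letter of a word if that letter is `a`, and
kills all other words. -/
def delLeft (a : Letter) : QShuffle q →ₗ[F] QShuffle q :=
  lift fun w => match w with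
    | [] => 0
    | b :: w' => if b = a then word q w' else 0

/-- The operator `w ↦ w a⁻¹`: it removes the last letter of a word if that letter is `a`, and
kills all other words. -/
def delRight (a : Letter) : QShuffle q →ₗ[F] QShuffle q :=
  lift fun w => if w.getLast? = some a then word q w.dropLast else 0

end QShuffle

/-! ### `q`-integers and Catalan words -/

/-- `[n]_q = (qⁿ - q⁻ⁿ) / (q - q⁻¹)`. -/
def qInt (q : Fˣ) (n : ℤ) : F :=
  (((q ^ n : Fˣ) : F) - ((q ^ (-n) : Fˣ) : F)) / ((q : F) - ((q⁻¹ : Fˣ) : F))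

/-- `[n]_q! = [n]_q [n-1]_q ⋯ [1]_q`. -/
def qFactorial (q : Fˣ) (n : ℕ) : F := ∏ i ∈ Finset.range n, qInt q (i + 1)

/-- The sum of the signs of the letters of a word. -/
def height (w : List Letter) : ℤ := (w.map Letter.sgn).sum

/-- A word is Catalan if all its prefixes have nonnegative height and its height is `0`. -/
def IsCatalan (w : List Letter) : Prop :=
  (∀ i ≤ w.length, 0 ≤ height (w.take i)) ∧ height w = 0

open Classical in
/-- The Catalan words of length `2n`. -/
def catalanWords (n : ℕ) : Finset (List Letter) :=
  ((Finset.univ : Finset (Fin (2 * n) → Letter)).image List.ofFn).filter IsCatalan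

/-- The coefficient `∏ᵢ [ā₁ + ⋯ + āᵢ₋₁ + m (āᵢ + 1) / 2]_q` of a word `a₁a₂⋯`, where `ā` is the
sign of the letter `a`. The division by `2` is exact. -/
def deltaCoeff (q : Fˣ) (m : ℤ) (w : List Letter) : F :=
  ∏ i : Fin w.length, qInt q (height (w.take i) + m * ((w.get i).sgn + 1) / 2)

/-- `Δₙ⁽ᵐ⁾`. -/
def delta (q : Fˣ) (m : ℤ) (n : ℕ) : QShuffle q :=
  ∑ w ∈ catalanWords n, deltaCoeff q m w • QShuffle.word q w

/-- The power series `Δ⁽ᵐ⁾(-t²) = ∑ₙ (-1)ⁿ Δₙ⁽ᵐ⁾ t²ⁿ` in `t`. -/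
def deltaNegSq (q : Fˣ) (m : ℤ) : PowerSeries (QShuffle q) :=
  PowerSeries.mk fun k => if k % 2 = 0 then (-1 : F) ^ (k / 2) • delta q m (k / 2) else 0

/-- `x⁻ᵏ f y⁻ˡ`, for a power series `f` with coefficients in the `q`-shuffle algebra. -/
def delXY {q : Fˣ} (k l : ℕ) (f : PowerSeries (QShuffle q)) : PowerSeries (QShuffle q) :=
  PowerSeries.mk fun n =>
    (QShuffle.delLeft Letter.x)^[k] ((QShuffle.delRight Letter.y)^[l] (PowerSeries.coeff n f))

/-! ### The matrices

A spin `j ∈ {1/2, 1, 3/2, …}` is represented by the positive integer `J = 2j`. Rows and columns of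
a matrix of size `2j + 1` are numbered by `Fin (J + 1)`, starting with `0`; tensor products of
spaces are indexed by products of index types, in lexicographic order.

The scalar `p` is the chosen square root of `q`, and `r n` is the chosen square root of
`[n]_q`; square roots of products and quotients of `q`-integers are the corresponding products and
quotients of the `r n`. -/

/-- The matrix `ℰ⁽ʲ⁺¹ᐟ²⁾` for `j = J / 2`. -/
def fusE (r : ℕ → F) (J : ℕ) : Matrix (Fin 2 × Fin (J + 1)) (Fin (J + 2)) F :=
  Matrix.of fun ia b =>
    if ia.1 = 0 then
      if (b : ℕ) = ia.2 then r (J + 1 - ia.2) / r (J + 1) else 0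
    else
      if (b : ℕ) = ia.2 + 1 then r (ia.2 + 1) / r (J + 1) else 0

/-- The matrix `ℱ⁽ʲ⁺¹ᐟ²⁾` for `j = J / 2`. -/
def fusF (q : Fˣ) (r : ℕ → F) (J : ℕ) : Matrix (Fin (J + 2)) (Fin 2 × Fin (J + 1)) F :=
  Matrix.of fun b ia =>
    if ia.1 = 0 then
      if (b : ℕ) = ia.2 then
        r (J + 1 - ia.2) * r (J + 1) / (qInt q (J + 1 - (ia.2 : ℕ)) + qInt q (ia.2 : ℕ))
      else 0
    else
      if (b : ℕ) = ia.2 + 1 then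
        r (ia.2 + 1) * r (J + 1) / (qInt q (J - (ia.2 : ℕ)) + qInt q ((ia.2 : ℕ) + 1))
      else 0

section Legs

variable {A X Y Z W X' Y' Z' : Type*} [Zero A]

/-- `M₁₂ = M ⊗ 1`. -/
def leg₁₂ [DecidableEq Z] (M : Matrix (X × Y) (X' × Y') A) :
    Matrix (X × Y × Z) (X' × Y' × Z) A :=
  Matrix.of fun i i' => if i.2.2 = i'.2.2 then M (i.1, i.2.1) (i'.1, i'.2.1) else 0

/-- `M₁₃`, acting on the first and third tensor factors. -/
def leg₁₃ [DecidableEq Y] (M : Matrix (X × Z) (X' × Z') A) :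
    Matrix (X × Y × Z) (X' × Y × Z') A :=
  Matrix.of fun i i' => if i.2.1 = i'.2.1 then M (i.1, i.2.2) (i'.1, i'.2.2) else 0

/-- `M₂₃ = 1 ⊗ M`. -/
def leg₂₃ [DecidableEq X] (M : Matrix (Y × Z) (Y' × Z') A) :
    Matrix (X × Y × Z) (X × Y' × Z') A :=
  Matrix.of fun i i' => if i.1 = i'.1 then M i.2 i'.2 else 0

/-- `M₁₂ = M ⊗ 1` for a matrix `M` which fuses the first two tensor factors. -/
def fuse₁₂ [DecidableEq Z] (M : Matrix W (X × Y) A) : Matrix (W × Z) (X × Y × Z) A :=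
  Matrix.of fun i i' => if i.2 = i'.2.2 then M i.1 (i'.1, i'.2.1) else 0

/-- `M₁₂ = M ⊗ 1` for a matrix `M` which splits the first tensor factor. -/
def split₁₂ [DecidableEq Z] (M : Matrix (X × Y) W A) : Matrix (X × Y × Z) (W × Z) A :=
  Matrix.of fun i i' => if i.2.2 = i'.2 then M (i.1, i.2.1) i'.1 else 0

/-- `M₂₃ = 1 ⊗ M` for a matrix `M` which fuses the last two tensor factors. -/
def fuse₂₃ [DecidableEq X] (M : Matrix W (Y × Z) A) : Matrix (X × W) (X × Y × Z) A :=
  Matrix.of fun i i' => if i.1 = i'.1 then M i.2 i'.2 else 0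

/-- `M₂₃ = 1 ⊗ M` for a matrix `M` which splits the last tensor factor. -/
def split₂₃ [DecidableEq X] (M : Matrix (Y × Z) W A) : Matrix (X × Y × Z) (X × W) A :=
  Matrix.of fun i i' => if i.1 = i'.1 then M i.2 i'.2 else 0

end Legs

section RMatrix

variable {A : Type*} [Ring A] [Algebra F A]

/-- The product of a rectangular, two square, and a rectangular matrix. -/
def sandwich {M N : Type*} [Fintype N] (f : Matrix M N A) (a b : Matrix N N A)
    (e : Matrix N M A) : Matrix M M A :=
  f * a * b * e

/-- A unit of `F`, viewed as a unit of an `F`-algebra. -/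
def toUnit (A : Type*) [Ring A] [Algebra F A] (u : Fˣ) : Aˣ :=
  Units.map (algebraMap F A : F →* A) u

/-- `c(z) = z - z⁻¹`. -/
def cfun (z : Aˣ) : A := (z : A) - ((z⁻¹ : Aˣ) : A)

/-- The matrix `R⁽¹ᐟ²,¹ᐟ²⁾(z)`. -/
def RHalfHalf (q : Fˣ) (z : Aˣ) : Matrix (Fin 2 × Fin 2) (Fin 2 × Fin 2) A :=
  Matrix.reindex finProdFinEquiv.symm finProdFinEquiv.symm
    !![cfun (toUnit A q * z), 0, 0, 0;
       0, cfun z, cfun (toUnit A q), 0;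
       0, cfun (toUnit A q), cfun z, 0;
       0, 0, 0, cfun (toUnit A q * z)]

/-- The matrix `R⁽¹ᐟ²,ʲ⁾(z)` for `j = n / 2`, by recursion on `n ≥ 1` from `n = 1`. The value at
`n = 0` is a placeholder. The argument `z` is an invertible element of an
arbitrary `F`-algebra `A`; for an indeterminate `z` this is the usual formal matrix. -/
def RHalf (q p : Fˣ) (r : ℕ → F) :
    (n : ℕ) → Aˣ → Matrix (Fin 2 × Fin (n + 1)) (Fin 2 × Fin (n + 1)) A
  | 0, _ => 1
  | 1, z => RHalfHalf q z
  | n + 2, z =>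
      sandwich (fuse₂₃ ((fusF q r (n + 1)).map (algebraMap F A)))
        (leg₁₃ (RHalf q p r (n + 1) (toUnit A p⁻¹ * z)))
        (leg₁₂ (RHalfHalf q (toUnit A (p ^ (n + 1)) * z)))
        (split₂₃ ((fusE r (n + 1)).map (algebraMap F A)))

/-- The fused R-matrix `R⁽ʲ¹,ʲ²⁾(z)` for `j₁ = m / 2` and `j₂ = n / 2`, by recursion on `m ≥ 1` from
`m = 1`. The value at `m = 0` is a placeholder. -/
def RMat (q p : Fˣ) (r : ℕ → F) :
    (m n : ℕ) → Aˣ → Matrix (Fin (m + 1) × Fin (n + 1)) (Fin (m + 1) × Fin (n + 1)) A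
  | 0, _, _ => 1
  | 1, n, z => RHalf q p r n z
  | m + 2, n, z =>
      sandwich (fuse₁₂ ((fusF q r (m + 1)).map (algebraMap F A)))
        (leg₁₃ (RHalf q p r n (toUnit A (p⁻¹ ^ (m + 1)) * z)))
        (leg₂₃ (RMat q p r (m + 1) n (toUnit A p * z)))
        (split₁₂ ((fusE r (m + 1)).map (algebraMap F A)))

end RMatrix

/-- The diagonal matrix `R̂⁽ʲ¹,ʲ²⁾` for `j₁ = J₁ / 2` and `j₂ = J₂ / 2`. The entry at `(a, b)` is
`q ^ (2 (j₁ - a) (j₂ - b))`, a power of `p = q ^ (1/2)`. -/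
def RHat (p : Fˣ) (J₁ J₂ : ℕ) :
    Matrix (Fin (J₁ + 1) × Fin (J₂ + 1)) (Fin (J₁ + 1) × Fin (J₂ + 1)) F :=
  Matrix.diagonal fun ab =>
    ((p ^ (((J₁ : ℤ) - 2 * (ab.1 : ℕ)) * ((J₂ : ℤ) - 2 * (ab.2 : ℕ))) : Fˣ) : F)

/-- Twice the exponent `ρ(a, b, j)` for `j = J / 2`, where `a` and `b` start with `1`:
`2ρ = a² + b² + 6j² + 4ab - 6aj - 6bj - 6a - 6b + 13j + 6`. The division by `2` is exact. -/
def twoRho (a b J : ℤ) : ℤ :=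
  a ^ 2 + b ^ 2 + 4 * a * b - 3 * a * J - 3 * b * J - 6 * a - 6 * b + 6 + J * (3 * J + 13) / 2

/-- The chosen square root of `[n]_q!`. -/
def sqrtFactorial (r : ℕ → F) (n : ℕ) : F := ∏ i ∈ Finset.range n, r (i + 1)

/-- The scalar `φ(a+1, b+1, j)` for `j = J / 2` (here `a` and `b` start with `0`). -/
def phi (q p : Fˣ) (r : ℕ → F) (J a b : ℕ) : F :=
  ((p ^ twoRho (a + 1) (b + 1) J : Fˣ) : F) * (qFactorial q J)⁻¹ *
    (sqrtFactorial r a * sqrtFactorial r (J - b) /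
      (sqrtFactorial r b * sqrtFactorial r (J - a)))

/-- The K-matrix `K⁽ʲ⁾(t)` for `j = J / 2`, with entries formal Laurent series in `t` over the
`q`-shuffle algebra. Entry `(a, b)`, starting with `0`, is
`φ(a+1, b+1, j) t^(a-b-2j) x^(-b) Δ⁽⁻²ʲ⁾(-t²) y^(a-2j)`. -/
def KMat (q p : Fˣ) (r : ℕ → F) (J : ℕ) :
    Matrix (Fin (J + 1)) (Fin (J + 1)) (LaurentSeries (QShuffle q)) :=
  Matrix.of fun a b =>
    phi q p r J a b •
      (HahnSeries.single ((a : ℤ) - (b : ℤ) - (J : ℤ)) (1 : QShuffle q) *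
        HahnSeries.ofPowerSeries ℤ (QShuffle q) (delXY b (J - a) (deltaNegSq q (-(J : ℤ)))))

/-! ### Two-variable Laurent series -/

section TwoVariables

variable (B : Type*) [Ring B]

/-- The indeterminate of the ring of formal Laurent series, as a unit. -/
def lsVar : (LaurentSeries B)ˣ where
  val := HahnSeries.single 1 1
  inv := HahnSeries.single (-1) 1
  val_inv := by simp
  inv_val := by simp

/-- The ring `B((s))((t))` of iterated formal Laurent series in central indeterminates
`s`, `t`. -/
abbrev Laurent₂ : Type _ := LaurentSeries (LaurentSeries B)

/-- The indeterminate `s` of `B((s))((t))`. -/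
def sVar : (Laurent₂ B)ˣ :=
  Units.map (HahnSeries.C : LaurentSeries B →+* Laurent₂ B).toMonoidHom (lsVar B)

/-- The indeterminate `t` of `B((s))((t))`. -/
def tVar : (Laurent₂ B)ˣ := lsVar (LaurentSeries B)

variable {B}

/-- A one-variable Laurent series `f`, written in the variable `s`, as an element of
`B((s))((t))`. -/
def inS (f : LaurentSeries B) : Laurent₂ B := HahnSeries.C f

/-- A one-variable Laurent series `f`, written in the variable `t`, as an element of
`B((s))((t))`. -/
def inT (f : LaurentSeries B) : Laurent₂ B :=
  HahnSeries.map f (HahnSeries.C : B →+* LaurentSeries B)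

end TwoVariables

end FreidelMaillet

end

open FreidelMaillet

/-! Write L = K₁(s) R̂ K₂(t), N = K₂(t) R̂ K₁(s) and X = R L - N R with R = R(t/s). The words
occurring in X are stripped of their letters from the left. Deletion of a first letter a is a
twisted derivation of the shuffle product: a⁻¹(u ⋆ v) = (a⁻¹u) ⋆ v + q^⟨a,u⟩ u ⋆ (a⁻¹v)
(`QShuffle.delLeft_mul`). On K⁽ʲ⁾(t), deleting x is right multiplication by t times the raising
operator of the spin j representation of quantum sl₂, and deleting y by t times the lowering
operator, up to powers of q that depend on the row and the column (`delLeft_KMat_x`,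
`delLeft_KMat_y`). In the products, the twist and R̂ supply the missing group-like factors: a⁻¹L = Θ
L A Λ and a⁻¹N = Θ N B Λ, where A and B are opposite coproducts of the same operator with spectral
parameters s and t, and Θ, Λ are diagonal and depend on the total weight only.

The R-matrix satisfies B R = R A and preserves the total weight, hence a⁻¹X = Θ X A Λ. Each row of X
is therefore closed under left deletions, with letter-free coefficients, and X vanishes once its
constant terms do (`eq_zero_of_coeffOp₂`). The constant terms of L and N are one and the same
matrix, a function of the total weight times the reflection of both bases, and R commutes with both
factors.

The facts about R come from fusion. Over a field, R⁽¹ᐟ²,ⁿᐟ²⁾ is a scalar multiple of an explicit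
L-operator (`RHalf_apply`). Fusion of the first space is treated for an abstract L-operator: its
exchange relations say that a product of L-operators preserves the image of ℰ (`fusedOp_rows`), and
then weight conservation, intertwining of the raising operator and flip symmetry follow by induction
(`fusedOp_weight`, `fusedOp_raise`, `fusedOp_flip`). The flip turns the raising relation into the
lowering one. The identities reach noncommutative coefficient rings because the entries of R are
Laurent polynomials in the argument (`RMat_map`, `exists_map_tUnit`). -/

noncomputable section

namespace FreidelMaillet

/-! ### The q-integers and their square roots -/

variable {F : Type*} [Field F]

/-- `q` is not a root of unity, `p` is a square root of `q` and `r n` is one of `[n]_q`. -/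
structure IsRootData (q p : Fˣ) (r : ℕ → F) : Prop where
  pow_ne_one : ∀ n : ℕ, 0 < n → q ^ n ≠ 1
  sq_eq : p ^ 2 = q
  sq_root : ∀ n : ℕ, r n ^ 2 = qInt q n

theorem qInt_zero (q : Fˣ) : qInt q 0 = 0 := by simp [qInt]

theorem qInt_neg (q : Fˣ) (n : ℤ) : qInt q (-n) = -qInt q n := by
  simp only [qInt, neg_neg]
  rw [← neg_div, neg_sub]

namespace IsRootData

variable {q p : Fˣ} {r : ℕ → F} (h : IsRootData q p r)
include h

theorem zpow_ne_one {n : ℤ} (hn : n ≠ 0) : q ^ n ≠ 1 := by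
  obtain ⟨k, rfl | rfl⟩ := n.eq_nat_or_neg
  · rw [zpow_natCast]
    exact h.pow_ne_one k (by omega)
  · rw [zpow_neg, zpow_natCast, ne_eq, inv_eq_one]
    exact h.pow_ne_one k (by omega)

theorem zpow_sub_ne_zero {n : ℤ} (hn : n ≠ 0) :
    ((q ^ n : Fˣ) : F) - ((q ^ (-n) : Fˣ) : F) ≠ 0 := by
  rw [sub_ne_zero, ne_eq, Units.val_inj]
  intro e
  refine h.zpow_ne_one (n := n + n) (by omega) ?_
  rw [zpow_add]
  nth_rewrite 2 [e]
  rw [← zpow_add, add_neg_cancel, zpow_zero]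

theorem sub_inv_ne_zero : (q : F) - ((q⁻¹ : Fˣ) : F) ≠ 0 := by
  simpa using h.zpow_sub_ne_zero one_ne_zero

theorem qInt_ne_zero {n : ℤ} (hn : n ≠ 0) : qInt q n ≠ 0 :=
  div_ne_zero (h.zpow_sub_ne_zero hn) h.sub_inv_ne_zero

theorem qInt_one : qInt q 1 = 1 := by
  have := h.sub_inv_ne_zero
  simp only [qInt, zpow_one, zpow_neg]
  exact div_self this

theorem root_zero : r 0 = 0 := by
  have := h.sq_root 0
  simpa [qInt_zero] using this

theorem root_ne_zero {n : ℕ} (hn : n ≠ 0) : r n ≠ 0 := by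
  intro e
  have := h.sq_root n
  rw [e] at this
  exact h.qInt_ne_zero (n := n) (by exact_mod_cast hn) (by rw [← this]; ring)

theorem root_mul_self (n : ℕ) : r n * r n = qInt q n := by rw [← h.sq_root, sq]

theorem root_one_mul_self : r 1 * r 1 = 1 := by
  rw [h.root_mul_self, Nat.cast_one, h.qInt_one]

theorem qInt_eq (n : ℤ) :
    qInt q n = ((p : F) ^ (2 * n) - (p : F) ^ (-(2 * n))) / ((p : F) ^ 2 - (p : F)⁻¹ ^ 2) := by
  have e : (q : F) = (p : F) ^ 2 := by rw [← h.sq_eq]; simp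
  simp only [qInt, Units.val_zpow_eq_zpow_val, Units.val_inv_eq_inv_val, e]
  rw [← zpow_natCast, ← zpow_mul, ← zpow_mul, inv_pow, ← zpow_natCast]
  simp

theorem sq_sub_ne_zero : (p : F) ^ 2 - (p : F)⁻¹ ^ 2 ≠ 0 := by
  have e : (q : F) = (p : F) ^ 2 := by rw [← h.sq_eq]; simp
  have := h.sub_inv_ne_zero
  rwa [Units.val_inv_eq_inv_val, e, ← inv_pow] at this

/-- These sums are the denominators of ℱ. Up to nonzero factors, the sum is (q^a + q^b)(q^(a+b) -
1). The second factor is nonzero because q is not a root of unity; if the first vanished, then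
q^(2a-2b) = 1, so a = b and 2q^a = 0, which characteristic zero excludes. -/
theorem qInt_add_ne_zero [CharZero F] {a b : ℕ} (hab : 0 < a + b) :
    qInt q a + qInt q b ≠ 0 := by
  have hq0 : (q : F) ≠ 0 := q.ne_zero
  rw [qInt, qInt, ← add_div]
  refine div_ne_zero ?_ h.sub_inv_ne_zero
  simp only [zpow_neg, zpow_natCast, Units.val_inv_eq_inv_val, Units.val_pow_eq_pow_val]
  have hf : (q : F) ^ a - ((q : F) ^ a)⁻¹ + ((q : F) ^ b - ((q : F) ^ b)⁻¹) =
      ((q : F) ^ a + (q : F) ^ b) * ((q : F) ^ (a + b) - 1) / (q : F) ^ (a + b) := by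
    rw [pow_add]
    field_simp
    ring
  rw [hf]
  have h1 : (q : F) ^ (a + b) - 1 ≠ 0 := by
    rw [sub_ne_zero]
    have := h.pow_ne_one _ hab
    exact fun e => this (Units.ext (by simpa using e))
  refine div_ne_zero (mul_ne_zero ?_ h1) (pow_ne_zero _ hq0)
  intro e
  have e2 : (q : F) ^ a = -(q : F) ^ b := eq_neg_of_add_eq_zero_left e
  have e3 : q ^ (2 * (a : ℤ) - 2 * b) = 1 := by
    rw [zpow_sub, mul_inv_eq_one]
    ext
    simp only [Units.val_zpow_eq_zpow_val, mul_comm (2 : ℤ), zpow_mul, zpow_natCast,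
      Units.val_pow_eq_pow_val]
    rw [e2]
    exact Even.neg_zpow (even_two : Even (2 : ℤ)) _
  have e4 : 2 * (a : ℤ) - 2 * b = 0 := by
    by_contra hne
    exact h.zpow_ne_one hne e3
  have : a = b := by omega
  subst this
  have : (2 : F) * (q : F) ^ a = 0 := by rw [two_mul]; exact e
  simp [hq0] at this

end IsRootData

/-! ### Sums over `Fin` of sparse terms -/

theorem sum_fin_ite_eq {B : Type*} [AddCommMonoid B] {n : ℕ} (m : ℕ) (g : ℕ → B) :
    ∑ k : Fin n, (if (k : ℕ) = m then g k else 0) = if m < n then g m else 0 := by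
  rw [Fin.sum_univ_eq_sum_range (fun k => if k = m then g k else 0) n]
  simp [Finset.sum_ite_eq']

theorem sum_fin_ite_eq' {B : Type*} [AddCommMonoid B] {n : ℕ} (m : ℕ) (g : ℕ → B) :
    ∑ k : Fin n, (if m = (k : ℕ) then g k else 0) = if m < n then g m else 0 := by
  simp_rw [eq_comm (a := m)]
  exact sum_fin_ite_eq m g

theorem sum_fin_ite_succ {B : Type*} [AddCommMonoid B] {n : ℕ} (m : ℕ) (g : ℕ → B) :
    ∑ k : Fin n, (if m = (k : ℕ) + 1 then g k else 0) =
      if 0 < m ∧ m ≤ n then g (m - 1) else 0 := by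
  obtain _ | m := m
  · simp
  · simp only [Nat.add_right_cancel_iff, Nat.add_sub_cancel]
    rw [sum_fin_ite_eq' m g]
    congr 1
    simp only [eq_iff_iff]
    omega

/-! ### The fusion matrices ℰ and ℱ -/

section FusionMatrices

/-- The entry of `ℰ` in row `(α, i)` and column `b`. -/
def fusECoeff (r : ℕ → F) (J : ℕ) (α : Fin 2) (i b : ℕ) : F :=
  if α = 0 then if b = i then r (J + 1 - i) / r (J + 1) else 0
  else if b = i + 1 then r (i + 1) / r (J + 1) else 0

theorem fusE_apply (r : ℕ → F) (J : ℕ) (α : Fin 2) (i : Fin (J + 1)) (b : Fin (J + 2)) :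
    fusE r J (α, i) b = fusECoeff r J α i b := rfl

/-- The only nonzero entry of the row `(α, i)` of `ℰ`. -/
def fusERow (r : ℕ → F) (J : ℕ) (α : Fin 2) (i : ℕ) : F :=
  if α = 0 then r (J + 1 - i) / r (J + 1) else r (i + 1) / r (J + 1)

theorem fusECoeff_eq (r : ℕ → F) (J : ℕ) (α : Fin 2) (i b : ℕ) :
    fusECoeff r J α i b = if b = i + α then fusERow r J α i else 0 := by
  fin_cases α <;> simp [fusECoeff, fusERow]

theorem sum_fusE_mul {A : Type*} [Ring A] [Algebra F A] (r : ℕ → F) (J : ℕ) (α : Fin 2)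
    (i : Fin (J + 1)) (g : Fin (J + 2) → A) :
    ∑ b, algebraMap F A (fusE r J (α, i) b) * g b =
      algebraMap F A (fusERow r J α i) * g ⟨i + α, by omega⟩ := by
  rw [Finset.sum_eq_single ⟨i + α, by omega⟩]
  · simp [fusE_apply, fusECoeff_eq]
  · intro b _ hb
    have : (b : ℕ) ≠ i + α := fun e => hb (Fin.ext e)
    simp [fusE_apply, fusECoeff_eq, this]
  · simp

variable {q p : Fˣ} {r : ℕ → F} (h : IsRootData q p r)
include h

/-- Row b of ℱ meets only the columns (0, b) and (1, b - 1). At the two ends of the range one of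
them does not exist, but its coefficient would be `r 0 = 0`; so a single formula with truncated
subtraction covers all rows. -/
theorem sum_fusF_mul {A : Type*} [Ring A] [Algebra F A] (J : ℕ) (b : ℕ) (hb : b < J + 2)
    (g : Fin 2 → ℕ → A) :
    ∑ α, ∑ i : Fin (J + 1), algebraMap F A (fusF q r J ⟨b, hb⟩ (α, i)) * g α i =
      algebraMap F A (r (J + 1) / (qInt q (J + 1 - b : ℤ) + qInt q b)) *
        (algebraMap F A (r (J + 1 - b)) * g 0 b + algebraMap F A (r b) * g 1 (b - 1)) := by
  have h0 := h.root_zero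
  rw [Fin.sum_univ_two]
  simp only [fusF, Matrix.of_apply, if_true, one_ne_zero, if_false]
  simp only [apply_ite (algebraMap F A), map_zero, ite_mul, zero_mul]
  rw [sum_fin_ite_eq' b (fun i => algebraMap F A (r (J + 1 - i) * r (J + 1) /
      (qInt q (J + 1 - (i : ℕ)) + qInt q (i : ℕ))) * g 0 i),
    sum_fin_ite_succ b (fun i => algebraMap F A (r (i + 1) * r (J + 1) /
      (qInt q (J - (i : ℕ)) + qInt q ((i : ℕ) + 1))) * g 1 i), mul_add]
  congr 1
  · split_ifs with h1
    · rw [← mul_assoc, ← map_mul]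
      congr 2
      ring
    · have : J + 1 - b = 0 := by omega
      simp [this, h0]
  · obtain _ | b := b
    · simp [h0]
    · rw [if_pos (by omega), ← mul_assoc, ← map_mul]
      congr 2
      push_cast
      rw [add_sub_add_right_eq_sub]
      ring

/-- The denominators in ℱ are chosen for this: row b against column b gives the squares [J+1-b] and
[b] of the two roots, divided by their sum. -/
theorem fusF_mul_fusE [CharZero F] (J : ℕ) : fusF q r J * fusE r J = 1 := by
  ext ⟨b, hb⟩ ⟨b', hb'⟩
  rw [Matrix.mul_apply, Fintype.sum_prod_type]
  have := sum_fusF_mul h (A := F) J b hb (fun α i => fusECoeff r J α i b')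
  simp only [Algebra.algebraMap_self, RingHom.id_apply] at this
  simp only [fusE_apply, this]
  have hJ := h.root_ne_zero (n := J + 1) (by omega)
  have hD := h.qInt_add_ne_zero (a := J + 1 - b) (b := b) (by omega)
  rw [Nat.cast_sub (by omega)] at hD
  push_cast at hD
  simp only [fusECoeff, if_true, one_ne_zero, if_false, Matrix.one_apply, Fin.mk.injEq]
  have e1 := h.sq_root (J + 1 - b)
  rw [Nat.cast_sub (by omega)] at e1
  push_cast at e1
  have e2 := h.sq_root b
  obtain _ | b := b
  · simp only [h.root_zero, zero_mul, add_zero]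
    simp only [Nat.cast_zero, qInt_zero, add_zero] at *
    by_cases e : b' = 0
    · subst e
      simp only [if_true]
      rw [← e1]
      have : r (J + 1 - 0) ≠ 0 := by simpa using hJ
      field_simp
    · simp [e, Ne.symm e]
  · simp only [Nat.add_sub_cancel]
    by_cases e : b' = b + 1
    · subst e
      simp only [if_true]
      rw [← e1, ← e2] at hD ⊢
      field_simp
    · simp [e, Ne.symm e]

end FusionMatrices

section Maps

variable {X Y Z W X' Y' Z' : Type*} {A : Type*} [Ring A] [Algebra F A]

theorem fuse₂₃_mul_split₂₃ [Fintype X] [DecidableEq X] [Fintype Y] [Fintype Z] [DecidableEq W]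
    {f : Matrix W (Y × Z) A} {e : Matrix (Y × Z) W A} (hfe : f * e = 1) :
    fuse₂₃ (X := X) f * split₂₃ (X := X) e = 1 := by
  ext ⟨x, w⟩ ⟨x', w'⟩
  have := congrFun (congrFun hfe w) w'
  rw [Matrix.mul_apply] at this
  simp only [Matrix.mul_apply, Fintype.sum_prod_type (α₁ := X), fuse₂₃, split₂₃, Matrix.of_apply,
    ite_mul, zero_mul, mul_ite, mul_zero, Matrix.one_apply, Prod.mk.injEq]
  by_cases hx : x = x'
  · subst hx
    simp [this, Matrix.one_apply]
  · simp [hx]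

end Maps

/-! ### R-matrices with first spin one half as explicit L-operators -/

section HalfSpin

variable {A : Type*} [Field A] [Algebra F A]

/-- `z - z⁻¹` in a field. -/
def cval (z : A) : A := z - z⁻¹

/-- The entries of the L-operator to which `R⁽¹ᐟ²,ⁿᐟ²⁾(z)` is proportional. -/
def lEntry (q p : Fˣ) (r : ℕ → F) (n : ℕ) (z : A) (α β : Fin 2) (i k : ℕ) : A :=
  if α = 0 then
    if β = 0 then
      if i = k then cval ((algebraMap F A p) ^ ((n : ℤ) + 1 - 2 * k) * z) else 0
    else
      if i = k + 1 then cval (algebraMap F A q) * algebraMap F A (r (k + 1) * r (n - k)) else 0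
  else
    if β = 0 then
      if i + 1 = k then cval (algebraMap F A q) * algebraMap F A (r (i + 1) * r (n - i)) else 0
    else
      if i = k then cval ((algebraMap F A p) ^ (1 - (n : ℤ) + 2 * k) * z) else 0

/-- The scalar by which `R⁽¹ᐟ²,ⁿᐟ²⁾(z)` differs from the L-operator. -/
def halfFactor (p : Fˣ) : ℕ → A → A
  | 0, _ => 1
  | 1, _ => 1
  | n + 2, z => halfFactor p (n + 1) ((algebraMap F A p)⁻¹ * z) *
      cval ((algebraMap F A p) ^ (n + 1) * z)

variable {q p : Fˣ} {r : ℕ → F} (h : IsRootData q p r)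
include h

theorem RHalfHalf_apply (z : Aˣ) (x y : Fin 2 × Fin 2) :
    RHalfHalf q z x y = lEntry q p r 1 (z : A) x.1 y.1 x.2 y.2 := by
  obtain ⟨a, b⟩ := x
  obtain ⟨c, d⟩ := y
  have e : (q : F) = (p : F) ^ 2 := by rw [← h.sq_eq]; simp
  have e1 : algebraMap F A (r 1) * algebraMap F A (r 1) = 1 := by
    rw [← map_mul, h.root_one_mul_self, map_one]
  fin_cases a <;> fin_cases b <;> fin_cases c <;> fin_cases d <;>
    simp [RHalfHalf, lEntry, finProdFinEquiv, cfun, cval, toUnit, e, e1, Matrix.submatrix,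
      Fin.divNat]

theorem sum_lEntry_zero (n : ℕ) (z : A) (i : ℕ) (hi : i < n + 1) (g : Fin 2 → ℕ → A) :
    ∑ β, ∑ k : Fin (n + 1), lEntry q p r n z 0 β i k * g β k =
      cval ((algebraMap F A p) ^ ((n : ℤ) + 1 - 2 * i) * z) * g 0 i +
      cval (algebraMap F A q) * algebraMap F A (r i * r (n + 1 - i)) * g 1 (i - 1) := by
  rw [Fin.sum_univ_two]
  simp only [lEntry, if_true, one_ne_zero, if_false, ite_mul, zero_mul]
  rw [sum_fin_ite_eq' i (fun k => cval ((algebraMap F A p) ^ ((n : ℤ) + 1 - 2 * k) * z) * g 0 k),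
    sum_fin_ite_succ i (fun k => cval (algebraMap F A q) *
      algebraMap F A (r (k + 1) * r (n - k)) * g 1 k), if_pos hi]
  obtain _ | i := i
  · simp [h.root_zero]
  · rw [if_pos (by omega), Nat.add_sub_cancel, Nat.add_sub_add_right]

theorem sum_lEntry_one (n : ℕ) (z : A) (i : ℕ) (hi : i < n + 1) (g : Fin 2 → ℕ → A) :
    ∑ β, ∑ k : Fin (n + 1), lEntry q p r n z 1 β i k * g β k =
      cval (algebraMap F A q) * algebraMap F A (r (i + 1) * r (n - i)) * g 0 (i + 1) +
      cval ((algebraMap F A p) ^ (1 - (n : ℤ) + 2 * i) * z) * g 1 i := by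
  rw [Fin.sum_univ_two]
  simp only [lEntry, if_true, one_ne_zero, if_false, ite_mul, zero_mul]
  rw [sum_fin_ite_eq' i (fun k => cval ((algebraMap F A p) ^ (1 - (n : ℤ) + 2 * k) * z) * g 1 k),
    sum_fin_ite_eq' (i + 1) (fun k => cval (algebraMap F A q) *
      algebraMap F A (r (i + 1) * r (n - i)) * g 0 k), if_pos hi]
  by_cases e : i = n
  · subst e
    simp [h.root_zero]
  · rw [if_pos (by omega)]

/-- The factor c(q) clears the denominator of [k]. This turns identities between q-integers into
Laurent polynomial identities in p. -/
theorem cval_mul_root (k : ℕ) :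
    cval (algebraMap F A q) * (algebraMap F A (r k) * algebraMap F A (r k)) =
      ((algebraMap F A p) ^ k) ^ 2 - (((algebraMap F A p) ^ k)⁻¹) ^ 2 := by
  have e : (q : F) = (p : F) ^ 2 := by rw [← h.sq_eq]; simp
  have e2 := h.sq_sub_ne_zero
  rw [← map_mul, h.root_mul_self, h.qInt_eq, cval, e, ← map_inv₀, ← map_sub, ← map_mul,
    ← inv_pow, mul_div_cancel₀ _ e2, map_sub]
  congr 1
  · rw [map_zpow₀, mul_comm, zpow_mul]
    norm_cast
  · rw [map_zpow₀, zpow_neg, mul_comm 2, zpow_mul]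
    simp

/-- With x = pⁿz and u = pⁱ this is the three-term relation c(xu⁻²)c(qx) + c(q)c(u²) = c(x)c(qxu⁻²).
It serves the diagonal entries in the fusion step and `root_mul_cval_add` the off-diagonal ones;
both extract the factor c(pⁿz) that `halfFactor` collects. -/
theorem cval_mul_cval_add (n i : ℕ) (z : A) (hz : z ≠ 0) :
    cval ((algebraMap F A p) ^ ((n : ℤ) + 1 - 2 * i) * ((algebraMap F A p)⁻¹ * z)) *
        cval ((algebraMap F A p) ^ 2 * ((algebraMap F A p) ^ n * z)) +
      cval (algebraMap F A q) *
        (cval (algebraMap F A q) * (algebraMap F A (r i) * algebraMap F A (r i))) =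
    cval ((algebraMap F A p) ^ n * z) *
      cval ((algebraMap F A p) ^ ((n : ℤ) + 1 + 1 - 2 * i) * z) := by
  have e : (q : F) = (p : F) ^ 2 := by rw [← h.sq_eq]; simp
  have hP : (algebraMap F A p) ≠ 0 := by simp
  rw [cval_mul_root h, e, map_pow, zpow_sub₀ hP, zpow_sub₀ hP, mul_comm (2 : ℤ), zpow_mul]
  simp only [zpow_add₀ hP, zpow_one, zpow_natCast]
  have hv := pow_ne_zero n hP
  have hu := pow_ne_zero i hP
  generalize (algebraMap F A p) ^ n = v at *
  generalize (algebraMap F A p) ^ i = u at *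
  generalize (algebraMap F A p) = P at *
  simp only [cval, zpow_ofNat]
  field_simp
  ring

theorem root_mul_cval_add (n i : ℕ) (z : A) (hz : z ≠ 0) :
    cval (algebraMap F A q) * (algebraMap F A (r i) * algebraMap F A (r i)) *
        cval ((algebraMap F A p) ^ 2 * ((algebraMap F A p) ^ n * z)) +
      cval (algebraMap F A q) *
        cval ((algebraMap F A p) ^ ((n : ℤ) + 1 - 2 * i) * ((algebraMap F A p)⁻¹ * z)) =
    cval (algebraMap F A q) * (algebraMap F A (r (i + 1)) * algebraMap F A (r (i + 1))) *
      cval ((algebraMap F A p) ^ n * z) := by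
  have e : (q : F) = (p : F) ^ 2 := by rw [← h.sq_eq]; simp
  have hP : (algebraMap F A p) ≠ 0 := by simp
  have hv := pow_ne_zero n hP
  have hu := pow_ne_zero i hP
  rw [cval_mul_root h, cval_mul_root h, e, map_pow, zpow_sub₀ hP, mul_comm (2 : ℤ), zpow_mul,
    zpow_natCast, zpow_add₀ hP, zpow_natCast, pow_succ _ i]
  generalize (algebraMap F A p) ^ n = v at *
  generalize (algebraMap F A p) ^ i = u at *
  generalize (algebraMap F A p) = P at *
  simp only [cval, zpow_ofNat]
  field_simp
  ring

/-- The right side is an entry of c(pⁿz) ℰ₂₃ times the L-operator of the next spin, since row (β, i)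
of ℰ has its only nonzero entry in column i + β. So the product of the two smaller operators
preserves the image of ℰ. Rows of the L-operators have at most two entries, which leaves at most two
terms on the left, and these combine by one of the three-term relations. -/
theorem leg₁₃_mul_leg₁₂_mul_split₂₃ (n : ℕ) (z : A) (hz : z ≠ 0)
    (L : Matrix (Fin 2 × Fin (n + 1)) (Fin 2 × Fin (n + 1)) A)
    (R : Matrix (Fin 2 × Fin 2) (Fin 2 × Fin 2) A)
    (hL : ∀ x y, L x y = lEntry q p r n ((algebraMap F A p)⁻¹ * z) x.1 y.1 x.2 y.2)
    (hR : ∀ x y, R x y = lEntry q p r 1 ((algebraMap F A p) ^ n * z) x.1 y.1 x.2 y.2)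
    (x : Fin 2 × Fin 2 × Fin (n + 1)) (y : Fin 2 × Fin (n + 2)) :
    (leg₁₃ (Y := Fin 2) L * (leg₁₂ (Z := Fin (n + 1)) R *
      split₂₃ (X := Fin 2) ((fusE r n).map (algebraMap F A)))) x y =
      cval ((algebraMap F A p) ^ n * z) * (algebraMap F A (fusERow r n x.2.1 x.2.2) *
        lEntry q p r (n + 1) z x.1 y.1 (x.2.2 + x.2.1) y.2) := by
  obtain ⟨α, β, i⟩ := x
  obtain ⟨α', b⟩ := y
  have e0 : ∀ (γ : Fin 2) (k : Fin (n + 1)),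
      (leg₁₂ (Z := Fin (n + 1)) R *
        split₂₃ (X := Fin 2) ((fusE r n).map (algebraMap F A))) (γ, β, k) (α', b) =
      ∑ δ, lEntry q p r 1 ((algebraMap F A p) ^ n * z) γ α' β (δ : Fin 2) *
        algebraMap F A (fusECoeff r n δ k b) := by
    intro γ k
    rw [Matrix.mul_apply]
    simp only [leg₁₂, split₂₃, Matrix.of_apply, Fintype.sum_prod_type, Matrix.map_apply, hR,
      fusE_apply, mul_ite, mul_zero, ite_mul, zero_mul]
    simp
  have e1 : (leg₁₃ (Y := Fin 2) L * (leg₁₂ (Z := Fin (n + 1)) R *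
      split₂₃ (X := Fin 2) ((fusE r n).map (algebraMap F A)))) (α, β, i) (α', b) =
      ∑ γ, ∑ k : Fin (n + 1), lEntry q p r n ((algebraMap F A p)⁻¹ * z) α γ i k *
        (∑ δ, lEntry q p r 1 ((algebraMap F A p) ^ n * z) γ α' β (δ : Fin 2) *
        algebraMap F A (fusECoeff r n δ k b)) := by
    rw [Matrix.mul_apply]
    simp only [Fintype.sum_prod_type]
    refine Finset.sum_congr rfl fun γ _ => ?_
    rw [Finset.sum_comm]
    refine Finset.sum_congr rfl fun k _ => ?_
    simp only [leg₁₃, Matrix.of_apply, hL, ite_mul, zero_mul, Finset.sum_ite_eq,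
      Finset.mem_univ, if_true]
    rw [← e0, leg₁₂]
  rw [e1]
  clear e0 e1 hL hR L R
  have hP : (algebraMap F A p) ≠ 0 := by simp
  have hr0 : algebraMap F A (r 0) = 0 := by rw [h.root_zero, map_zero]
  have hr1 : algebraMap F A (r 1) * algebraMap F A (r 1) = 1 := by
    rw [← map_mul, h.root_one_mul_self, map_one]
  have hshift : ∀ a : ℤ, (algebraMap F A p) ^ a * ((algebraMap F A p)⁻¹ * z) =
      (algebraMap F A p) ^ (a - 1) * z := fun a => by
    rw [zpow_sub₀ hP, zpow_one, div_eq_mul_inv, mul_assoc]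
  obtain ⟨i, hi⟩ := i
  obtain ⟨b, hb⟩ := b
  fin_cases α
  · have := sum_lEntry_zero h n ((algebraMap F A p)⁻¹ * z) i hi (fun γ k =>
      (∑ δ, lEntry q p r 1 ((algebraMap F A p) ^ n * z) γ α' β (δ : Fin 2) *
        algebraMap F A (fusECoeff r n δ k b)))
    simp only [Fin.zero_eta, this]
    clear this
    simp only [Fin.sum_univ_two]
    have k1 := cval_mul_cval_add h n i z hz
    have k2 := root_mul_cval_add h n i z hz
    -- The index i = 0 is separated because the column i - 1 would be truncated there.
    obtain _ | i := i
    · have e3 : (algebraMap F A p) ^ ((n : ℤ) + 1) * ((algebraMap F A p)⁻¹ * z) =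
          (algebraMap F A p) ^ n * z := by rw [hshift, add_sub_cancel_right, zpow_natCast]
      have e4 : (algebraMap F A p) ^ 2 * ((algebraMap F A p) ^ n * z) =
          (algebraMap F A p) ^ ((n : ℤ) + 1 + 1) * z := by
        rw [zpow_add₀ hP, zpow_add₀ hP, zpow_natCast, zpow_one]
        ring
      clear k1 k2
      fin_cases β <;> fin_cases α' <;>
        simp [lEntry, fusECoeff, fusERow, hr0, hr1, apply_ite (algebraMap F A), e3, e4]
      · rcases eq_or_ne b 0 with rfl | hb
        · simp
          left
          ring
        · simp [hb, hb.symm]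
      · rcases eq_or_ne b 1 with rfl | hb
        · simp only [if_true]
          rw [show (n : ℤ) + 1 + 1 - 2 * (1 : ℕ) = n by push_cast; ring, zpow_natCast]
          ring
        · simp [hb, hb.symm]
      · rcases eq_or_ne b 0 with rfl | hb
        · simp only [if_true, zero_add, Nat.sub_zero]
          linear_combination -cval ((algebraMap F A p) ^ n * z) * cval (algebraMap F A q) *
            algebraMap F A (r (n + 1)) / algebraMap F A (r (n + 1)) * hr1
        · simp [hb]
    · fin_cases β <;> fin_cases α' <;>
        simp [lEntry, fusECoeff, fusERow, hr1, apply_ite (algebraMap F A)] at k1 k2 ⊢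
      · rcases eq_or_ne b (i + 1) with rfl | hb
        · simp
          linear_combination algebraMap F A (r (n - i)) / algebraMap F A (r (n + 1)) * k1
        · simp [hb, hb.symm]
      · rcases eq_or_ne b i with rfl | hb
        · simp only [if_true]
          ring
        · simp [hb, hb.symm]
      · rcases eq_or_ne b (i + 1 + 1) with rfl | hb
        · simp only [if_true]
          rw [hshift]
          push_cast
          ring_nf
        · simp [hb, hb.symm]
      · rcases eq_or_ne b (i + 1) with rfl | hb
        · simp
          linear_combination algebraMap F A (r (n - i)) / algebraMap F A (r (n + 1)) * k2
        · simp [hb, hb.symm]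
  · have := sum_lEntry_one h n ((algebraMap F A p)⁻¹ * z) i hi (fun γ k =>
      (∑ δ, lEntry q p r 1 ((algebraMap F A p) ^ n * z) γ α' β (δ : Fin 2) *
        algebraMap F A (fusECoeff r n δ k b)))
    simp only [Fin.mk_one, this]
    clear this
    simp only [Fin.sum_univ_two]
    -- The second row of the L-operator is the first one read from the other end, so the three-term
    -- relations are used with n - i in place of i.
    have e3 : (1 : ℤ) - n + 2 * i = n + 1 - 2 * (n - i : ℕ) := by
      rw [Nat.cast_sub (by omega)]
      ring
    have k1 := cval_mul_cval_add h n (n - i) z hz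
    have k2 := root_mul_cval_add h n (n - i) z hz
    rw [← e3] at k1 k2
    rw [show (n : ℤ) + 1 + 1 - 2 * (n - i : ℕ) = -n + 2 * (i + 1 : ℕ) by push_cast; linarith]
      at k1
    rw [show n - i + 1 = n + 1 - i by omega] at k2
    fin_cases β <;> fin_cases α' <;>
      simp [lEntry, fusECoeff, fusERow, hr1, apply_ite (algebraMap F A)] at k1 k2 ⊢
    · rcases eq_or_ne b (i + 1) with rfl | hb
      · simp
        linear_combination algebraMap F A (r (i + 1)) / algebraMap F A (r (n + 1)) * k2
      · simp [hb, hb.symm]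
    · rcases eq_or_ne b i with rfl | hb
      · simp only [if_true]
        rw [hshift]
        ring_nf
      · simp [hb, hb.symm]
    · rcases eq_or_ne b (i + 1 + 1) with rfl | hb
      · simp only [if_true]
        ring
      · simp [hb, hb.symm]
    · rcases eq_or_ne b (i + 1) with rfl | hb
      · simp
        linear_combination algebraMap F A (r (i + 1)) / algebraMap F A (r (n + 1)) * k1
      · simp [hb, hb.symm]

/-- Since the fused product maps through ℰ₂₃, multiplication by ℱ₂₃ on the left cancels ℰ₂₃ and
leaves the L-operator of the next spin. -/
theorem RHalf_apply [CharZero F] (n : ℕ) (z : Aˣ)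
    (x y : Fin 2 × Fin (n + 2)) :
    RHalf q p r (n + 1) z x y =
      halfFactor p (n + 1) (z : A) * lEntry q p r (n + 1) (z : A) x.1 y.1 x.2 y.2 := by
  induction n generalizing z with
  | zero =>
    rw [RHalf, RHalfHalf_apply h, halfFactor, one_mul]
  | succ n ih =>
    have hz := z.ne_zero
    have hP : (algebraMap F A p) ≠ 0 := by simp
    let N : Matrix (Fin 2 × Fin (n + 3)) (Fin 2 × Fin (n + 3)) A :=
      Matrix.of fun x y => halfFactor p (n + 2) (z : A) *
        lEntry q p r (n + 2) (z : A) x.1 y.1 x.2 y.2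
    let L : Matrix (Fin 2 × Fin (n + 2)) (Fin 2 × Fin (n + 2)) A :=
      Matrix.of fun x y => lEntry q p r (n + 1) ((algebraMap F A p)⁻¹ * z) x.1 y.1 x.2 y.2
    have hL : RHalf q p r (n + 1) (toUnit A p⁻¹ * z) =
        halfFactor p (n + 1) ((algebraMap F A p)⁻¹ * z) • L := by
      ext x y
      rw [ih]
      simp [L, toUnit]
    have hleg : ∀ (c : A), leg₁₃ (Y := Fin 2) (c • L) = c • leg₁₃ L := by
      intro c
      ext x y
      simp [leg₁₃]
    have key : leg₁₃ (Y := Fin 2) (RHalf q p r (n + 1) (toUnit A p⁻¹ * z)) *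
        (leg₁₂ (Z := Fin (n + 2)) (RHalfHalf q (toUnit A (p ^ (n + 1)) * z)) *
        split₂₃ (X := Fin 2) ((fusE r (n + 1)).map (algebraMap F A))) =
        split₂₃ (X := Fin 2) ((fusE r (n + 1)).map (algebraMap F A)) * N := by
      rw [hL, hleg, Matrix.smul_mul]
      ext x y
      rw [Matrix.smul_apply, leg₁₃_mul_leg₁₂_mul_split₂₃ h (n + 1) (z : A) hz L _ (fun _ _ => rfl)
        (fun x y => by rw [RHalfHalf_apply h]; simp [toUnit])]
      obtain ⟨α, β, i⟩ := x
      obtain ⟨α', b⟩ := y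
      rw [Matrix.mul_apply, Fintype.sum_prod_type, Finset.sum_eq_single α]
      · simp only [split₂₃, Matrix.of_apply, if_true, Matrix.map_apply]
        rw [sum_fusE_mul]
        simp only [N, Matrix.of_apply, halfFactor, smul_eq_mul]
        ring
      · intro γ _ hγ
        simp [split₂₃, hγ.symm]
      · simp
    have := fuse₂₃_mul_split₂₃ (X := Fin 2) (f := (fusF q r (n + 1)).map (algebraMap F A))
      (e := (fusE r (n + 1)).map (algebraMap F A)) (by
        rw [← Matrix.map_mul, fusF_mul_fusE h, Matrix.map_one _ (map_zero _) (map_one _)])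
    rw [RHalf, sandwich, Matrix.mul_assoc, Matrix.mul_assoc, key, ← Matrix.mul_assoc, this,
      Matrix.one_mul]
    rfl

end HalfSpin

/-! ### Fusion of an abstract L-operator -/

section Fused

variable {A O : Type*} [Field A] [Ring O] [Algebra A O]

/-- The relations between the entries of an L-operator, a weight operator `k` with inverse `k'`
and a raising operator `e`, from which the properties of its fusions follow. -/
structure IsLOperator (P : A) (k k' e : O) (L : A → Fin 2 → Fin 2 → O) : Prop where
  k_mul : k * k' = 1
  k'_mul : k' * k = 1
  weight_zero_zero : ∀ z, k * L z 0 0 = L z 0 0 * k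
  weight_zero_one : ∀ z, P ^ 2 • (k * L z 0 1) = L z 0 1 * k
  weight_one_zero : ∀ z, k * L z 1 0 = P ^ 2 • (L z 1 0 * k)
  weight_one_one : ∀ z, k * L z 1 1 = L z 1 1 * k
  exchange_zero : ∀ z, z ≠ 0 → L z 0 0 * L (P ^ 2 * z) 1 0 = L z 1 0 * L (P ^ 2 * z) 0 0
  exchange_one : ∀ z, z ≠ 0 → L z 0 1 * L (P ^ 2 * z) 1 1 = L z 1 1 * L (P ^ 2 * z) 0 1
  exchange_add : ∀ z, z ≠ 0 → L z 0 0 * L (P ^ 2 * z) 1 1 + L z 0 1 * L (P ^ 2 * z) 1 0 =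
    L z 1 0 * L (P ^ 2 * z) 0 1 + L z 1 1 * L (P ^ 2 * z) 0 0
  raise_zero_zero : ∀ z, z ≠ 0 →
    (z / P) • (e * L z 0 0) = L z 0 1 * k' + (z * P) • (L z 0 0 * e)
  raise_zero_one : ∀ z, z ≠ 0 → e * L z 0 1 = L z 0 1 * e
  raise_one_zero : ∀ z, z ≠ 0 →
    k * L z 0 0 + (z * P) • (e * L z 1 0) = L z 1 1 * k' + (z * P) • (L z 1 0 * e)
  raise_one_one : ∀ z, z ≠ 0 →
    k * L z 0 1 + (z * P) • (e * L z 1 1) = (z / P) • (L z 1 1 * e)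

/-- The properties of the square roots `ρ n` of the `q`-integers, with `P ^ 2 = q`, that the
fusion procedure uses. -/
structure IsFusionRoot (P : A) (ρ : ℕ → A) : Prop where
  base_ne_zero : P ≠ 0
  zero : ρ 0 = 0
  ne_zero : ∀ n, ρ (n + 1) ≠ 0
  sq_add_ne_zero : ∀ a b, 0 < a + b → ρ a ^ 2 + ρ b ^ 2 ≠ 0
  succ : ∀ n, ρ (n + 1) ^ 2 = (P ^ n) ^ 2 + ρ n ^ 2 / P ^ 2

/-- The row `a ≤ m` of the fused operator, up to a scalar, from the row `a` for spin `m / 2`. -/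
def fusedUpper (ρ : ℕ → A) (L : Fin 2 → Fin 2 → O) (S : ℕ → ℕ → O) (m a b : ℕ) : O :=
  ρ (m + 1 - b) • (L 0 0 * S a b) + ρ b • (L 0 1 * S a (b - 1))

/-- The row `a + 1` of the fused operator, up to a scalar, from the row `a` for spin `m / 2`. -/
def fusedLower (ρ : ℕ → A) (L : Fin 2 → Fin 2 → O) (S : ℕ → ℕ → O) (m a b : ℕ) : O :=
  ρ (m + 1 - b) • (L 1 0 * S a b) + ρ b • (L 1 1 * S a (b - 1))

/-- The entries of the fusion of `m` copies of an L-operator. -/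
def fusedOp (P : A) (ρ : ℕ → A) (L : A → Fin 2 → Fin 2 → O) : ℕ → A → ℕ → ℕ → O
  | 0, _, a, b => if a = 0 ∧ b = 0 then 1 else 0
  | m + 1, z, a, b =>
      (ρ (m + 1 - a) ^ 2 + ρ a ^ 2)⁻¹ •
        (ρ (m + 1 - a) • fusedUpper ρ (L (z / P ^ m)) (fusedOp P ρ L m (P * z)) m a b +
          ρ a • fusedLower ρ (L (z / P ^ m)) (fusedOp P ρ L m (P * z)) m (a - 1) b)

variable {P : A} {ρ : ℕ → A} {k k' e : O} {L : A → Fin 2 → Fin 2 → O}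

/-- Each entry L z c d shifts the weight by a power of P determined by c - d, and these shifts add
up along a product of L-operators. -/
theorem fusedOp_weight (hL : IsLOperator P k k' e L) (hρ : IsFusionRoot P ρ) (m : ℕ) (z : A)
    (a b : ℕ) : (P ^ b) ^ 2 • (k * fusedOp P ρ L m z a b) =
      (P ^ a) ^ 2 • (fusedOp P ρ L m z a b * k) := by
  induction m generalizing z a b with
  | zero =>
    simp only [fusedOp]
    split_ifs with h
    · simp [h.1, h.2]
    · simp
  | succ m ih =>
    have hP := hρ.base_ne_zero
    have key : ∀ (c d : Fin 2) (a b : ℕ),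
        (P ^ (b + d)) ^ 2 • (k * (L (z / P ^ m) c d * fusedOp P ρ L m (P * z) a b)) =
        (P ^ (a + c)) ^ 2 • ((L (z / P ^ m) c d * fusedOp P ρ L m (P * z) a b) * k) := by
      intro c d a b
      have h1 : (P ^ (d : ℕ)) ^ 2 • (k * L (z / P ^ m) c d) =
          (P ^ (c : ℕ)) ^ 2 • (L (z / P ^ m) c d * k) := by
        fin_cases c <;> fin_cases d
        · simpa using hL.weight_zero_zero _
        · simpa using hL.weight_zero_one _
        · simpa using hL.weight_one_zero _
        · simpa using congrArg (fun x => P ^ 2 • x) (hL.weight_one_one (z / P ^ m))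
      rw [pow_add, pow_add, mul_pow, mul_smul, ← mul_assoc, ← smul_mul_assoc, h1, smul_mul_assoc,
        smul_comm, mul_assoc, ← mul_smul_comm, ih, mul_smul_comm, smul_smul, ← mul_assoc]
      congr 1
      ring
    have upper : (P ^ b) ^ 2 • (k * fusedUpper ρ (L (z / P ^ m)) (fusedOp P ρ L m (P * z)) m a b) =
        (P ^ a) ^ 2 • (fusedUpper ρ (L (z / P ^ m)) (fusedOp P ρ L m (P * z)) m a b * k) := by
      obtain _ | b := b
      · have := key 0 0 a 0
        simp only [fusedUpper, hρ.zero, zero_smul, add_zero, mul_smul_comm, smul_mul_assoc]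
        rw [smul_comm, smul_comm _ (ρ _)]
        exact congrArg _ this
      · have h1 := key 0 0 a (b + 1)
        have h2 := key 0 1 a b
        simp only [fusedUpper, mul_add, add_mul, mul_smul_comm, smul_mul_assoc, smul_add,
          Nat.add_sub_cancel]
        rw [smul_comm, smul_comm _ (ρ (b + 1)), smul_comm _ (ρ (m + 1 - (b + 1))),
          smul_comm _ (ρ (b + 1))]
        exact congrArg₂ _ (congrArg _ h1) (congrArg _ h2)
    have lower : ∀ a', a = a' + 1 →
        (P ^ b) ^ 2 • (k * fusedLower ρ (L (z / P ^ m)) (fusedOp P ρ L m (P * z)) m a' b) =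
        (P ^ a) ^ 2 • (fusedLower ρ (L (z / P ^ m)) (fusedOp P ρ L m (P * z)) m a' b * k) := by
      rintro a rfl
      obtain _ | b := b
      · have := key 1 0 a 0
        simp only [fusedLower, hρ.zero, zero_smul, add_zero, mul_smul_comm, smul_mul_assoc]
        rw [smul_comm, smul_comm _ (ρ _)]
        exact congrArg _ this
      · have h1 := key 1 0 a (b + 1)
        have h2 := key 1 1 a b
        simp only [fusedLower, mul_add, add_mul, mul_smul_comm, smul_mul_assoc, smul_add,
          Nat.add_sub_cancel]
        rw [smul_comm, smul_comm _ (ρ (b + 1)), smul_comm _ (ρ (m + 1 - (b + 1))),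
          smul_comm _ (ρ (b + 1))]
        exact congrArg₂ _ (congrArg _ h1) (congrArg _ h2)
    rw [fusedOp, mul_smul_comm, smul_mul_assoc, smul_comm, smul_comm _ (_)⁻¹]
    congr 1
    rw [mul_add, add_mul, smul_add, smul_add, mul_smul_comm, mul_smul_comm, smul_mul_assoc,
      smul_mul_assoc, smul_comm, upper, smul_comm, add_right_inj]
    obtain _ | a := a
    · simp [hρ.zero]
    · rw [Nat.add_sub_cancel, smul_comm, lower a rfl, smul_comm]

/-- The two expressions for a row of a fused operator are compatible. -/
theorem fused_compat (hL : IsLOperator P k k' e L) (hρ : IsFusionRoot P ρ) (m : ℕ) (z : A)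
    (hz : z ≠ 0) (S : ℕ → ℕ → O) (S' : ℕ → ℕ → O)
    (hU : ∀ a b, ρ (m + 1 - a) • S a b = fusedUpper ρ (L (P ^ 2 * z)) S' m a b)
    (hV : ∀ a b, ρ (a + 1) • S (a + 1) b = fusedLower ρ (L (P ^ 2 * z)) S' m a b)
    (a b : ℕ) : ρ (a + 1) • fusedUpper ρ (L z) S (m + 1) (a + 1) b =
      ρ (m + 1 - a) • fusedLower ρ (L z) S (m + 1) a b := by
  have q1 := hL.exchange_zero z hz
  have q2 := hL.exchange_one z hz
  have q3 := eq_sub_of_add_eq (hL.exchange_add z hz)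
  simp only [fusedUpper, fusedLower, smul_add]
  -- The outer scalars are moved onto S, where the two hypotheses replace it by L-operators at P²z.
  -- Both sides then consist of products of L at z with L at P²z, which the exchange relations
  -- match.
  rw [smul_comm, smul_comm _ (ρ b), smul_comm _ (ρ (m + 1 + 1 - b)), smul_comm _ (ρ b),
    ← mul_smul_comm (ρ (a + 1)), ← mul_smul_comm (ρ (a + 1)), ← mul_smul_comm (ρ (m + 1 - a)),
    ← mul_smul_comm (ρ (m + 1 - a)), hV, hV, hU, hU]
  simp only [fusedUpper, fusedLower, mul_add, mul_smul_comm, ← mul_assoc]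
  obtain _ | b := b
  · simp [hρ.zero, q1]
  · rw [q1, q2, q3]
    simp only [Nat.add_sub_cancel, Nat.add_sub_add_right, add_mul, sub_mul]
    module

/-- By definition a row of the fused operator is a weighted mean of its upper and its lower
expression. Compatibility makes the two proportional, and then each of them alone determines the
row. -/
theorem fusedOp_rows_of_compat (hρ : IsFusionRoot P ρ) (m : ℕ) (z : A)
    (compat : ∀ a b, ρ (a + 1) •
      fusedUpper ρ (L (z / P ^ m)) (fusedOp P ρ L m (P * z)) m (a + 1) b =
      ρ (m - a) • fusedLower ρ (L (z / P ^ m)) (fusedOp P ρ L m (P * z)) m a b) :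
    (∀ a b, ρ (m + 1 - a) • fusedOp P ρ L (m + 1) z a b =
      fusedUpper ρ (L (z / P ^ m)) (fusedOp P ρ L m (P * z)) m a b) ∧
    ∀ a b, ρ (a + 1) • fusedOp P ρ L (m + 1) z (a + 1) b =
      fusedLower ρ (L (z / P ^ m)) (fusedOp P ρ L m (P * z)) m a b := by
  have hD : ∀ a, ρ (m + 1 - a) ^ 2 + ρ a ^ 2 ≠ 0 := fun a => hρ.sq_add_ne_zero _ _ (by omega)
  constructor
  · intro a b
    rw [fusedOp, smul_comm, smul_add, smul_smul, smul_smul, inv_smul_eq_iff₀ (hD a), add_smul, sq,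
      sq, add_right_inj]
    obtain _ | a := a
    · simp [hρ.zero]
    · rw [Nat.add_sub_cancel, Nat.add_sub_add_right, mul_comm, mul_smul, ← compat, smul_smul]
  · intro a b
    rw [fusedOp, smul_comm, smul_add, smul_smul, smul_smul, inv_smul_eq_iff₀ (hD (a + 1)),
      add_smul, sq, sq, Nat.add_sub_cancel, add_left_inj, Nat.add_sub_add_right, mul_comm,
      mul_smul, compat, smul_smul]

/-- The two formulas together say that a product of L-operators preserves the image of ℰ, so that
projecting with ℱ loses nothing. The exchange relations apply because the arguments of consecutive
factors differ by P². -/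
theorem fusedOp_rows (hL : IsLOperator P k k' e L) (hρ : IsFusionRoot P ρ) (m : ℕ) (z : A)
    (hz : z ≠ 0) :
    (∀ a b, ρ (m + 1 - a) • fusedOp P ρ L (m + 1) z a b =
      fusedUpper ρ (L (z / P ^ m)) (fusedOp P ρ L m (P * z)) m a b) ∧
    ∀ a b, ρ (a + 1) • fusedOp P ρ L (m + 1) z (a + 1) b =
      fusedLower ρ (L (z / P ^ m)) (fusedOp P ρ L m (P * z)) m a b := by
  have hP := hρ.base_ne_zero
  induction m generalizing z with
  | zero =>
    refine fusedOp_rows_of_compat hρ 0 z fun a b => ?_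
    simp [fusedUpper, fusedOp, hρ.zero]
  | succ m ih =>
    refine fusedOp_rows_of_compat hρ (m + 1) z fun a b => ?_
    have h1 := ih (P * z) (mul_ne_zero hP hz)
    have e1 : P * z / P ^ m = P ^ 2 * (z / P ^ (m + 1)) := by
      rw [pow_succ]
      field_simp
      ring
    rw [e1] at h1
    exact fused_compat hL hρ m _ (div_ne_zero hz (pow_ne_zero _ hP)) _ _ h1.1 h1.2 a b

/-- The fused operator intertwines the coproduct of the raising operator with its opposite. -/
theorem fusedOp_raise (hL : IsLOperator P k k' e L) (hρ : IsFusionRoot P ρ) (m : ℕ) (z : A)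
    (hz : z ≠ 0) (a b : ℕ) :
    (ρ a * ρ (m + 1 - a)) • (k * fusedOp P ρ L m z (a - 1) b) +
      (z * (P ^ a) ^ 2 / P ^ m) • (e * fusedOp P ρ L m z a b) =
    (ρ (b + 1) * ρ (m - b)) • (fusedOp P ρ L m z a (b + 1) * k') +
      (z * P ^ m / (P ^ b) ^ 2) • (fusedOp P ρ L m z a b * e) := by
  have hP := hρ.base_ne_zero
  induction m generalizing z a b with
  | zero =>
    obtain _ | a := a
    · obtain _ | b := b
      · simp [fusedOp, hρ.zero]
      · simp [fusedOp, hρ.zero]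
    · simp [fusedOp, hρ.zero]
  | succ m ih =>
    obtain ⟨hU, hV⟩ := fusedOp_rows hL hρ m z hz
    have hS := ih (P * z) (mul_ne_zero hP hz)
    have hW := fusedOp_weight hL hρ m (P * z)
    generalize fusedOp P ρ L m (P * z) = S at *
    have hw : z / P ^ m ≠ 0 := div_ne_zero hz (pow_ne_zero _ hP)
    have w00 := hL.weight_zero_zero (z / P ^ m)
    have w01 := hL.weight_zero_one (z / P ^ m)
    have w10 := hL.weight_one_zero (z / P ^ m)
    have w11 := hL.weight_one_one (z / P ^ m)
    have r00 := hL.raise_zero_zero (z / P ^ m) hw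
    have r01 := hL.raise_zero_one (z / P ^ m) hw
    have r10 := hL.raise_one_zero (z / P ^ m) hw
    have r11 := hL.raise_one_one (z / P ^ m) hw
    have hW' : ∀ a, (P ^ b) ^ 2 • (S a b * k') = (P ^ a) ^ 2 • (k' * S a b) := fun a => by
      have := congrArg (fun x => k' * x * k') (hW a b)
      simp only [mul_smul_comm, smul_mul_assoc, mul_assoc, hL.k_mul, mul_one] at this
      rwa [← mul_assoc k' k, hL.k'_mul, one_mul] at this
    -- The induction hypothesis in column b - 1. The extra factor `ρ b` makes it vacuous for b = 0,
    -- where that column does not exist.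
    have hprev : ∀ a, ρ b • ((ρ a * ρ (m + 1 - a)) • (k * S (a - 1) (b - 1)) +
          (P * z * (P ^ a) ^ 2 / P ^ m) • (e * S a (b - 1))) =
        ρ b • ((ρ b * ρ (m + 1 - b)) • (S a b * k') +
          (P * z * P ^ m * P ^ 2 / (P ^ b) ^ 2) • (S a (b - 1) * e)) := fun a => by
      obtain _ | b := b
      · simp [hρ.zero]
      · simp only [Nat.add_sub_cancel, Nat.add_sub_add_right]
        have e1 : P * z * P ^ m * P ^ 2 / (P ^ (b + 1)) ^ 2 = P * z * P ^ m / (P ^ b) ^ 2 := by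
          have := pow_ne_zero b hP
          rw [pow_succ]
          field_simp
          ring
        rw [hS a b, e1]
    have hPm := pow_ne_zero m hP
    have hPb := pow_ne_zero b hP
    have hPa := pow_ne_zero a hP
    clear w00 w01 hW
    obtain _ | a := a
    -- In row 0 the term with k has coefficient `ρ 0 = 0`. Multiplication by `ρ (m + 1)` replaces
    -- the row by its upper expression.
    · refine smul_right_injective _ (hρ.ne_zero m) ?_
      have u0 := hU 0 b
      have u1 := hU 0 (b + 1)
      rw [Nat.sub_zero] at u0 u1
      have x0 : ρ (m + 1) • (e * fusedOp P ρ L (m + 1) z 0 b) =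
          e * fusedUpper ρ (L (z / P ^ m)) S m 0 b := by
        rw [← mul_smul_comm, u0]
      have x1 : ρ (m + 1) • (fusedOp P ρ L (m + 1) z 0 (b + 1) * k') =
          fusedUpper ρ (L (z / P ^ m)) S m 0 (b + 1) * k' := by
        rw [← smul_mul_assoc, u1]
      have x2 : ρ (m + 1) • (fusedOp P ρ L (m + 1) z 0 b * e) =
          fusedUpper ρ (L (z / P ^ m)) S m 0 b * e := by
        rw [← smul_mul_assoc, u0]
      have g : ρ (m + 1) • ((z * (P ^ 0) ^ 2 / P ^ (m + 1)) • (e * fusedOp P ρ L (m + 1) z 0 b)) =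
          ρ (m + 1) • ((ρ (b + 1) * ρ (m + 1 - b)) • (fusedOp P ρ L (m + 1) z 0 (b + 1) * k') +
          (z * P ^ (m + 1) / (P ^ b) ^ 2) • (fusedOp P ρ L (m + 1) z 0 b * e)) := by
        rw [smul_add, smul_comm (ρ (m + 1)) (z * (P ^ 0) ^ 2 / P ^ (m + 1)),
          smul_comm (ρ (m + 1)) (ρ (b + 1) * ρ (m + 1 - b)),
          smul_comm (ρ (m + 1)) (z * P ^ (m + 1) / (P ^ b) ^ 2), x0, x1, x2]
        have c1 := congrArg (fun x => x * S 0 b) r00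
        have c2 := congrArg (fun x => x * S 0 (b - 1)) r01
        have c3 := congrArg (fun x => L (z / P ^ m) 0 0 * x) (hS 0 b)
        have c4 := congrArg (fun x => L (z / P ^ m) 0 1 * x) (hprev 0)
        have c5 := congrArg (fun x => L (z / P ^ m) 0 1 * x) (hW' 0)
        have c6 := congrArg (fun x => x • (L (z / P ^ m) 0 1 * (S 0 b * k'))) (hρ.succ b)
        simp only [fusedUpper, mul_add, add_mul, smul_add, mul_smul_comm, smul_mul_assoc,
          mul_assoc, Nat.add_sub_cancel, Nat.add_sub_add_right, hρ.zero, zero_mul, zero_smul,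
          zero_add, pow_zero, one_pow, one_smul] at c1 c2 c3 c4 c5 c6 ⊢
        -- The ingredients are the raising relations of L (c1, c2), the induction hypothesis in
        -- columns b and b - 1 (c3, c4), weight conservation (c5) and the recursion for `ρ (b + 1) ^
        -- 2` (c6).
        linear_combination (norm := skip) ρ (m + 1 - b) • c1 + (z / P ^ (m + 1) * ρ b) • c2 +
          ρ (m + 1 - b) • c3 + (1 / P ^ 2 : A) • c4 - ρ (m + 1 - b) • c5 - ρ (m + 1 - b) • c6
        match_scalars <;> field_simp <;> ring
      simpa [hρ.zero] using g
    -- In the later rows `ρ (a + 1)` is a nonzero factor that gives access to the lower expression.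
    · refine smul_right_injective _ (hρ.ne_zero a) ?_
      have hUV : ρ a ^ 2 • fusedUpper ρ (L (z / P ^ m)) S m a b =
          (ρ a * ρ (m + 1 - a)) • fusedLower ρ (L (z / P ^ m)) S m (a - 1) b := by
        obtain _ | a := a
        · simp [hρ.zero]
        · rw [← hU, Nat.add_sub_cancel, ← hV, smul_smul, smul_smul]
          congr 1
          ring
      have x0 : ρ (m + 1 - a) • (k * fusedOp P ρ L (m + 1) z a b) =
          k * fusedUpper ρ (L (z / P ^ m)) S m a b := by
        rw [← mul_smul_comm, hU]
      have x1 : ρ (a + 1) • (e * fusedOp P ρ L (m + 1) z (a + 1) b) =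
          e * fusedLower ρ (L (z / P ^ m)) S m a b := by
        rw [← mul_smul_comm, hV]
      have x2 : ρ (a + 1) • (fusedOp P ρ L (m + 1) z (a + 1) (b + 1) * k') =
          fusedLower ρ (L (z / P ^ m)) S m a (b + 1) * k' := by
        rw [← smul_mul_assoc, hV]
      have x3 : ρ (a + 1) • (fusedOp P ρ L (m + 1) z (a + 1) b * e) =
          fusedLower ρ (L (z / P ^ m)) S m a b * e := by
        rw [← smul_mul_assoc, hV]
      -- The scalar `ρ (a + 1) ^ 2` is split by its recursion. The part (P^a)² meets the raising
      -- relations of L; the part with `ρ a ^ 2` is rewritten as a lower expression of the preceding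
      -- row, as the induction hypothesis requires.
      have x4 : ρ (a + 1) ^ 2 • (k * fusedUpper ρ (L (z / P ^ m)) S m a b) =
          (P ^ a) ^ 2 • (k * fusedUpper ρ (L (z / P ^ m)) S m a b) +
          (1 / P ^ 2) • ((ρ a * ρ (m + 1 - a)) •
            (k * fusedLower ρ (L (z / P ^ m)) S m (a - 1) b)) := by
        rw [← mul_smul_comm (ρ a * _), ← hUV, hρ.succ, add_smul, mul_smul_comm, smul_smul]
        congr 2
        ring
      have e0 : ρ (a + 1) • ((ρ (a + 1) * ρ (m + 1 + 1 - (a + 1))) •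
          (k * fusedOp P ρ L (m + 1) z (a + 1 - 1) b)) =
          ρ (a + 1) ^ 2 • (ρ (m + 1 - a) • (k * fusedOp P ρ L (m + 1) z a b)) := by
        rw [Nat.add_sub_add_right, Nat.add_sub_cancel, smul_smul, smul_smul]
        congr 1
        ring
      show ρ (a + 1) • _ = ρ (a + 1) • _
      rw [smul_add, e0, x0, x4, smul_comm (ρ (a + 1)) (z * (P ^ (a + 1)) ^ 2 / P ^ (m + 1)), x1,
        smul_add, smul_comm (ρ (a + 1)) (ρ (b + 1) * ρ (m + 1 - b)), x2,
        smul_comm (ρ (a + 1)) (z * P ^ (m + 1) / (P ^ b) ^ 2), x3]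
      clear e0 x0 x1 x2 x3 x4 hUV hU hV r00 r01
      have c1 := congrArg (fun x => x * S (a - 1) b) w10
      have c2 := congrArg (fun x => x * S (a - 1) (b - 1)) w11
      have c3 := congrArg (fun x => L (z / P ^ m) 1 0 * x) (hS a b)
      have c4 := congrArg (fun x => L (z / P ^ m) 1 1 * x) (hprev a)
      have c5 := congrArg (fun x => L (z / P ^ m) 1 1 * x) (hW' a)
      have c6 := congrArg (fun x => x • (L (z / P ^ m) 1 1 * (S a b * k'))) (hρ.succ b)
      have c7 := congrArg (fun x => x * S a b) r10
      have c8 := congrArg (fun x => x * S a (b - 1)) r11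
      have hPa := pow_ne_zero a hP
      simp only [fusedUpper, fusedLower, mul_add, add_mul, smul_add, mul_smul_comm, smul_mul_assoc,
        mul_assoc, Nat.add_sub_cancel, Nat.add_sub_add_right] at c1 c2 c3 c4 c5 c6 c7 c8 ⊢
      linear_combination (norm := skip)
        (ρ a * ρ (m + 1 - a) * ρ (m + 1 - b) / P ^ 2) • c1 +
        (ρ a * ρ (m + 1 - a) * ρ b / P ^ 2) • c2 +
        ρ (m + 1 - b) • c3 + (1 / P ^ 2 : A) • c4 - ρ (m + 1 - b) • c5 - ρ (m + 1 - b) • c6 +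
        ((P ^ a) ^ 2 * ρ (m + 1 - b)) • c7 + ((P ^ a) ^ 2 * ρ b) • c8
      match_scalars <;> field_simp <;> ring

/-- An automorphism exchanging the two basis vectors of the auxiliary space of the L-operator
reverses the basis of the fused auxiliary space. -/
theorem fusedOp_flip (hρ : IsFusionRoot P ρ) (σ : O →ₐ[A] O)
    (hσ : ∀ z α β, σ (L z α β) = L z α.rev β.rev) (m : ℕ) (z : A) {a b : ℕ}
    (ha : a ≤ m) (hb : b ≤ m) :
    σ (fusedOp P ρ L m z a b) = fusedOp P ρ L m z (m - a) (m - b) := by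
  induction m generalizing z a b with
  | zero =>
    obtain rfl : a = 0 := by omega
    obtain rfl : b = 0 := by omega
    simp [fusedOp]
  | succ m ih =>
    have r0 : (0 : Fin 2).rev = 1 := rfl
    have r1 : (1 : Fin 2).rev = 0 := rfl
    have e1 : m + 1 - (m + 1 - b) = b := by omega
    have e2 : m + 1 - (m + 1 - a) = a := by omega
    have upper : ∀ a, a ≤ m → σ (fusedUpper ρ (L (z / P ^ m)) (fusedOp P ρ L m (P * z)) m a b) =
        fusedLower ρ (L (z / P ^ m)) (fusedOp P ρ L m (P * z)) m (m - a) (m + 1 - b) := by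
      intro a ha
      simp only [fusedUpper, fusedLower, map_add, map_smul, map_mul, hσ, r0, r1, e1]
      rw [add_comm]
      congr 1
      · obtain _ | b := b
        · simp [hρ.zero]
        · rw [Nat.add_sub_cancel, ih _ ha (by omega), Nat.add_sub_add_right]
      · rcases hb.lt_or_eq with h | rfl
        · rw [ih _ ha (by omega), show m + 1 - b - 1 = m - b by omega]
        · simp [hρ.zero]
    have lower : ∀ a, a ≤ m → σ (fusedLower ρ (L (z / P ^ m)) (fusedOp P ρ L m (P * z)) m a b) =
        fusedUpper ρ (L (z / P ^ m)) (fusedOp P ρ L m (P * z)) m (m - a) (m + 1 - b) := by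
      intro a ha
      simp only [fusedUpper, fusedLower, map_add, map_smul, map_mul, hσ, r0, r1, e1]
      rw [add_comm]
      congr 1
      · obtain _ | b := b
        · simp [hρ.zero]
        · rw [Nat.add_sub_cancel, ih _ ha (by omega), Nat.add_sub_add_right]
      · rcases hb.lt_or_eq with h | rfl
        · rw [ih _ ha (by omega), show m + 1 - b - 1 = m - b by omega]
        · simp [hρ.zero]
    simp only [fusedOp, map_add, map_smul, e2]
    -- The substitution a ↦ m + 1 - a exchanges the upper and the lower summand and leaves the
    -- normalising sum unchanged.
    rw [add_comm (ρ (m + 1 - a) ^ 2), add_comm (ρ (m + 1 - a) • _)]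
    congr 2
    · obtain _ | a := a
      · simp [hρ.zero]
      · rw [Nat.add_sub_cancel, lower a (by omega), Nat.add_sub_add_right]
    · rcases ha.lt_or_eq with h | rfl
      · rw [upper a (by omega), show m + 1 - a - 1 = m - a by omega]
      · simp [hρ.zero]

/-- Every relation is homogeneous in the values of L, with the same arguments in all its terms. So
the normalisation of the R-matrix is immaterial. -/
theorem IsLOperator.smul (hL : IsLOperator P k k' e L) (f : A → A) :
    IsLOperator P k k' e fun z α β => f z • L z α β where
  k_mul := hL.k_mul
  k'_mul := hL.k'_mul
  weight_zero_zero z := by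
    rw [mul_smul_comm, smul_mul_assoc, hL.weight_zero_zero]
  weight_zero_one z := by
    rw [mul_smul_comm, smul_mul_assoc, ← hL.weight_zero_one, smul_comm]
  weight_one_zero z := by
    rw [mul_smul_comm, smul_mul_assoc, hL.weight_one_zero, smul_comm]
  weight_one_one z := by
    rw [mul_smul_comm, smul_mul_assoc, hL.weight_one_one]
  exchange_zero z hz := by
    simp only [smul_mul_smul_comm, hL.exchange_zero z hz]
  exchange_one z hz := by
    simp only [smul_mul_smul_comm, hL.exchange_one z hz]
  exchange_add z hz := by
    simp only [smul_mul_smul_comm, ← smul_add, hL.exchange_add z hz]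
  raise_zero_zero z hz := by
    rw [mul_smul_comm, smul_comm, hL.raise_zero_zero z hz, smul_add, smul_mul_assoc,
      smul_mul_assoc, smul_comm (f z)]
  raise_zero_one z hz := by
    rw [mul_smul_comm, hL.raise_zero_one z hz, smul_mul_assoc]
  raise_one_zero z hz := by
    rw [mul_smul_comm, mul_smul_comm, smul_comm _ (f z), ← smul_add, hL.raise_one_zero z hz,
      smul_add, smul_mul_assoc, smul_mul_assoc, smul_comm (f z)]
  raise_one_one z hz := by
    rw [mul_smul_comm, mul_smul_comm, smul_comm _ (f z), ← smul_add, hL.raise_one_one z hz,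
      smul_mul_assoc, smul_comm (f z)]

end Fused

/-! ### The explicit L-operator satisfies the abstract relations -/

section LOperator

variable {A : Type*} [Field A] [Algebra F A]

/-- The operator `q ^ H` for spin `n / 2`, where `q = p ^ 2`, or its inverse for `p⁻¹`. -/
def weightOp (P : A) (n : ℕ) : Matrix (Fin (n + 1)) (Fin (n + 1)) A :=
  Matrix.diagonal fun i => P ^ n / (P ^ (i : ℕ)) ^ 2

/-- The raising operator, in the basis numbered by `0, …, n`, for spin `n / 2`. -/
def raiseOp (ρ : ℕ → A) (n : ℕ) : Matrix (Fin (n + 1)) (Fin (n + 1)) A :=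
  Matrix.of fun i k => if (i : ℕ) = k + 1 then ρ (k + 1) * ρ (n - k) else 0

/-- The lowering operator for spin `n / 2`. -/
def lowerOp (ρ : ℕ → A) (n : ℕ) : Matrix (Fin (n + 1)) (Fin (n + 1)) A :=
  Matrix.of fun i k => if (i : ℕ) + 1 = k then ρ (i + 1) * ρ (n - i) else 0

theorem raiseOp_mul_lowerOp {ρ : ℕ → A} (h0 : ρ 0 = 0) (n : ℕ) :
    raiseOp ρ n * lowerOp ρ n =
      Matrix.diagonal fun i : Fin (n + 1) => ρ i ^ 2 * ρ (n + 1 - i) ^ 2 := by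
  ext ⟨i, hi⟩ ⟨k, hk⟩
  rw [Matrix.mul_apply]
  simp only [raiseOp, lowerOp, Matrix.of_apply, ite_mul, zero_mul]
  rw [sum_fin_ite_succ i (fun j => ρ (j + 1) * ρ (n - j) * if j + 1 = k then
    ρ (j + 1) * ρ (n - j) else 0), Matrix.diagonal_apply]
  obtain _ | i := i
  · simp [h0]
  · rw [if_pos (by omega)]
    simp only [Nat.add_sub_cancel, Nat.add_sub_add_right, Fin.mk.injEq, mul_ite, mul_zero]
    congr 1
    ring

theorem lowerOp_mul_raiseOp {ρ : ℕ → A} (h0 : ρ 0 = 0) (n : ℕ) :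
    lowerOp ρ n * raiseOp ρ n =
      Matrix.diagonal fun i : Fin (n + 1) => ρ (i + 1) ^ 2 * ρ (n - i) ^ 2 := by
  ext ⟨i, hi⟩ ⟨k, hk⟩
  rw [Matrix.mul_apply]
  simp only [raiseOp, lowerOp, Matrix.of_apply, ite_mul, zero_mul]
  rw [sum_fin_ite_eq' (i + 1) (fun j => ρ (i + 1) * ρ (n - i) * if j = k + 1 then
    ρ (k + 1) * ρ (n - k) else 0), Matrix.diagonal_apply]
  simp only [Nat.add_right_cancel_iff, Fin.mk.injEq]
  by_cases hik : i = k
  · subst hik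
    rcases (Nat.lt_succ_iff.mp hi).lt_or_eq with h | rfl
    · simp only [if_true, if_pos (show i + 1 < n + 1 by omega)]
      ring
    · simp [h0]
  · simp [hik]

variable (q p : Fˣ) (r : ℕ → F)

/-- The L-operator to which `R⁽¹ᐟ²,ⁿᐟ²⁾(z)` is proportional, as a matrix of operators. -/
def lOp (n : ℕ) (z : A) (α β : Fin 2) : Matrix (Fin (n + 1)) (Fin (n + 1)) A :=
  Matrix.of fun i k => lEntry q p r n z α β i k

theorem lOp_zero_zero (n : ℕ) (z : A) : lOp q p r n z 0 0 = Matrix.diagonal fun i : Fin (n + 1) =>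
    cval (algebraMap F A p ^ n * algebraMap F A p / (algebraMap F A p ^ (i : ℕ)) ^ 2 * z) := by
  have hP : (algebraMap F A p) ≠ 0 := by simp
  ext i k
  rw [lOp, Matrix.of_apply, lEntry, Matrix.diagonal_apply]
  simp only [if_true, Fin.ext_iff]
  split_ifs with h
  · rw [h, zpow_sub₀ hP, mul_comm (2 : ℤ), zpow_mul, zpow_add₀ hP]
    simp only [zpow_natCast, zpow_ofNat, pow_one]
  · rfl

theorem lOp_one_one (n : ℕ) (z : A) : lOp q p r n z 1 1 = Matrix.diagonal fun i : Fin (n + 1) =>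
    cval ((algebraMap F A p ^ (i : ℕ)) ^ 2 * algebraMap F A p / algebraMap F A p ^ n * z) := by
  have hP : (algebraMap F A p) ≠ 0 := by simp
  ext i k
  rw [lOp, Matrix.of_apply, lEntry, Matrix.diagonal_apply]
  simp only [if_true, Fin.ext_iff, one_ne_zero, if_false]
  split_ifs with h
  · rw [h, mul_comm (2 : ℤ), zpow_add₀ hP, zpow_sub₀ hP, zpow_mul]
    simp only [zpow_natCast, zpow_one, zpow_ofNat]
    congr 1
    ring
  · rfl

theorem lOp_zero_one (n : ℕ) (z : A) : lOp q p r n z 0 1 =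
    cval (algebraMap F A q) • raiseOp (fun k => algebraMap F A (r k)) n := by
  ext i k
  simp [lOp, lEntry, raiseOp]

theorem lOp_one_zero (n : ℕ) (z : A) : lOp q p r n z 1 0 =
    cval (algebraMap F A q) • lowerOp (fun k => algebraMap F A (r k)) n := by
  ext i k
  simp [lOp, lEntry, lowerOp]

variable {q p r} (h : IsRootData q p r)
include h

theorem cval_ne_zero : cval (algebraMap F A q) ≠ 0 := by
  have := h.sub_inv_ne_zero
  rw [Units.val_inv_eq_inv_val] at this
  rw [cval, ← map_inv₀, ← map_sub]
  exact (map_ne_zero (algebraMap F A)).mpr this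

theorem cval_sq_mul_left (n i : ℕ) (hi : i < n + 1) :
    cval (algebraMap F A q) * cval (algebraMap F A q) *
      (algebraMap F A (r i) ^ 2 * algebraMap F A (r (n + 1 - i)) ^ 2) =
    ((algebraMap F A p ^ i) ^ 2 - ((algebraMap F A p ^ i)⁻¹) ^ 2) *
      ((algebraMap F A p ^ n * algebraMap F A p / algebraMap F A p ^ i) ^ 2 -
        ((algebraMap F A p ^ n * algebraMap F A p / algebraMap F A p ^ i)⁻¹) ^ 2) := by
  have hP : (algebraMap F A p) ≠ 0 := by simp
  rw [← cval_mul_root h, ← pow_succ, div_eq_mul_inv, ← pow_sub₀ _ hP (by omega), ← cval_mul_root h]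
  ring

theorem cval_sq_mul_right (n i : ℕ) (hi : i < n + 1) :
    cval (algebraMap F A q) * cval (algebraMap F A q) *
      (algebraMap F A (r (i + 1)) ^ 2 * algebraMap F A (r (n - i)) ^ 2) =
    ((algebraMap F A p ^ i * algebraMap F A p) ^ 2 -
      ((algebraMap F A p ^ i * algebraMap F A p)⁻¹) ^ 2) *
      ((algebraMap F A p ^ n / algebraMap F A p ^ i) ^ 2 -
        ((algebraMap F A p ^ n / algebraMap F A p ^ i)⁻¹) ^ 2) := by
  have hP : (algebraMap F A p) ≠ 0 := by simp
  rw [← pow_succ, ← cval_mul_root h, div_eq_mul_inv, ← pow_sub₀ _ hP (by omega),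
    ← cval_mul_root h]
  ring

/-- The recursion for the squares is [n+1] = qⁿ + q⁻¹[n] with q = P². -/
theorem isFusionRoot [CharZero F] :
    IsFusionRoot (algebraMap F A p) (fun n => algebraMap F A (r n)) where
  base_ne_zero := by simp
  zero := by rw [h.root_zero, map_zero]
  ne_zero n := by
    rw [ne_eq, map_eq_zero]
    exact h.root_ne_zero (by omega)
  sq_add_ne_zero a b hab := by
    rw [← map_pow, ← map_pow, h.sq_root, h.sq_root, ← map_add, ne_eq, map_eq_zero]
    exact h.qInt_add_ne_zero hab
  succ n := by
    have hP : (algebraMap F A p) ≠ 0 := by simp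
    have hPn := pow_ne_zero n hP
    have e : (q : F) = (p : F) ^ 2 := by rw [← h.sq_eq]; simp
    have hc := cval_ne_zero h (A := A)
    have h1 := cval_mul_root h (A := A) n
    have h2 := cval_mul_root h (A := A) (n + 1)
    refine mul_left_cancel₀ hc ?_
    rw [sq, h2, mul_add, mul_div_assoc', sq (algebraMap F A (r n)), h1, cval, e, map_pow, pow_succ]
    field_simp
    ring

/-- The diagonal blocks are diagonal matrices and the off-diagonal blocks are c(q) times the raising
and the lowering operator. Hence each relation can be compared on a single matrix diagonal, where it
is a rational identity in z and powers of p. -/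
theorem isLOperator_lOp [CharZero F] (n : ℕ) :
    IsLOperator (algebraMap F A p) (weightOp (algebraMap F A p) n)
      (weightOp (algebraMap F A p)⁻¹ n) (raiseOp (fun k => algebraMap F A (r k)) n)
      (fun z : A => lOp q p r n z) := by
  have hρ := isFusionRoot h (A := A)
  have hcq := cval_ne_zero h (A := A)
  have e : algebraMap F A (q : F) = (algebraMap F A p) ^ 2 := by
    rw [← map_pow, ← h.sq_eq, Units.val_pow_eq_pow_val]
  have hP : (algebraMap F A p) ≠ 0 := by simp
  have hPn := pow_ne_zero n hP
  constructor
  · rw [weightOp, weightOp, Matrix.diagonal_mul_diagonal, ← Matrix.diagonal_one]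
    congr 1
    ext i
    have hPi := pow_ne_zero i hP
    rw [inv_pow, inv_pow]
    field_simp
  · rw [weightOp, weightOp, Matrix.diagonal_mul_diagonal, ← Matrix.diagonal_one]
    congr 1
    ext i
    have hPi := pow_ne_zero i hP
    rw [inv_pow, inv_pow]
    field_simp
  · intro z
    rw [lOp_zero_zero, weightOp, Matrix.diagonal_mul_diagonal, Matrix.diagonal_mul_diagonal]
    simp only [mul_comm]
  · intro z
    rw [lOp_zero_one]
    ext i k
    simp only [weightOp, raiseOp, Matrix.mul_smul, Matrix.smul_mul, Matrix.smul_apply,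
      Matrix.diagonal_mul, Matrix.mul_diagonal, Matrix.of_apply, smul_eq_mul]
    split_ifs with hik
    · rw [hik, pow_succ]
      field_simp
      ring
    · simp
  · intro z
    rw [lOp_one_zero]
    ext i k
    simp only [weightOp, lowerOp, Matrix.mul_smul, Matrix.smul_mul, Matrix.smul_apply,
      Matrix.diagonal_mul, Matrix.mul_diagonal, Matrix.of_apply, smul_eq_mul]
    split_ifs with hik
    · rw [← hik, pow_succ]
      field_simp
      ring
    · simp
  · intro z
    rw [lOp_one_one, weightOp, Matrix.diagonal_mul_diagonal, Matrix.diagonal_mul_diagonal]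
    simp only [mul_comm]
  · intro z hz
    rw [lOp_zero_zero, lOp_zero_zero, lOp_one_zero, lOp_one_zero]
    ext i k
    simp only [lowerOp, Matrix.mul_smul, Matrix.smul_mul, Matrix.smul_apply,
      Matrix.diagonal_mul, Matrix.mul_diagonal, Matrix.of_apply, smul_eq_mul]
    split_ifs with hik
    · have hPi := pow_ne_zero i hP
      generalize cval (algebraMap F A q) = c
      rw [← hik, pow_succ, cval, cval]
      field_simp
      ring
    · simp
  · intro z hz
    rw [lOp_one_one, lOp_one_one, lOp_zero_one, lOp_zero_one]
    ext i k
    simp only [raiseOp, Matrix.mul_smul, Matrix.smul_mul, Matrix.smul_apply,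
      Matrix.diagonal_mul, Matrix.mul_diagonal, Matrix.of_apply, smul_eq_mul]
    split_ifs with hik
    · have hPi := pow_ne_zero k hP
      generalize cval (algebraMap F A q) = c
      rw [hik, pow_succ, cval, cval]
      field_simp
      ring
    · simp
  · intro z hz
    rw [lOp_zero_zero, lOp_zero_zero, lOp_one_one, lOp_one_one, lOp_zero_one, lOp_zero_one,
      lOp_one_zero, lOp_one_zero, smul_mul_smul_comm, smul_mul_smul_comm,
      raiseOp_mul_lowerOp hρ.zero, lowerOp_mul_raiseOp hρ.zero, ← Matrix.diagonal_smul,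
      ← Matrix.diagonal_smul, Matrix.diagonal_mul_diagonal, Matrix.diagonal_mul_diagonal,
      Matrix.diagonal_add, Matrix.diagonal_add]
    congr 1
    ext i
    have hPi := pow_ne_zero i hP
    simp only [Pi.smul_apply, smul_eq_mul, cval_sq_mul_left h n i i.2,
      cval_sq_mul_right h n i i.2]
    rw [cval, cval, cval, cval]
    field_simp
    ring
  · intro z hz
    rw [lOp_zero_zero, lOp_zero_one]
    ext i k
    simp only [raiseOp, weightOp, Matrix.mul_smul, Matrix.smul_mul, Matrix.smul_apply,
      Matrix.add_apply,
      Matrix.diagonal_mul, Matrix.mul_diagonal, Matrix.of_apply, smul_eq_mul]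
    split_ifs with hik
    · have hPi := pow_ne_zero k hP
      rw [hik, pow_succ, cval, cval, cval, e, inv_pow, inv_pow]
      field_simp
      ring
    · simp
  · intro z hz
    rw [lOp_zero_one, Matrix.mul_smul, Matrix.smul_mul]
  · intro z hz
    -- The products of raising and lowering operators carry only one factor c(q) here; a second one
    -- is needed to remove the denominators of both q-integers.
    refine smul_right_injective _ hcq ?_
    rw [lOp_zero_zero, lOp_one_one, lOp_one_zero, Matrix.mul_smul, Matrix.smul_mul,
      raiseOp_mul_lowerOp hρ.zero, lowerOp_mul_raiseOp hρ.zero, weightOp, weightOp,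
      ← Matrix.diagonal_smul, ← Matrix.diagonal_smul, ← Matrix.diagonal_smul,
      ← Matrix.diagonal_smul, Matrix.diagonal_mul_diagonal, Matrix.diagonal_mul_diagonal,
      Matrix.diagonal_add, Matrix.diagonal_add]
    dsimp only
    rw [← Matrix.diagonal_smul, ← Matrix.diagonal_smul]
    congr 1
    ext i
    have hPi := pow_ne_zero i hP
    have h1 := cval_sq_mul_left h (A := A) n i i.2
    have h2 := cval_sq_mul_right h (A := A) n i i.2
    simp only [Pi.smul_apply, smul_eq_mul]
    have h3 : ∀ x y : A, cval (algebraMap F A q) * (x + z * algebraMap F A p *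
        (cval (algebraMap F A q) * y)) = cval (algebraMap F A q) * x + z * algebraMap F A p *
        (cval (algebraMap F A q) * cval (algebraMap F A q) * y) := fun x y => by ring
    rw [h3, h3, h1, h2]
    simp only [cval, e, inv_pow]
    field_simp
    ring
  · intro z hz
    rw [lOp_one_one, lOp_zero_one]
    ext i k
    simp only [raiseOp, weightOp, Matrix.mul_smul, Matrix.smul_mul, Matrix.smul_apply,
      Matrix.add_apply,
      Matrix.diagonal_mul, Matrix.mul_diagonal, Matrix.of_apply, smul_eq_mul]
    split_ifs with hik
    · have hPi := pow_ne_zero k hP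
      rw [hik, pow_succ, cval, cval, cval, e]
      field_simp
      ring
    · simp

end LOperator

/-! ### The fused R-matrix as a fusion of L-operators -/

section FusedRMatrix

variable {A : Type*} [Field A] [Algebra F A] {q p : Fˣ} {r : ℕ → F} (h : IsRootData q p r)

/-- `R⁽¹ᐟ²,ⁿᐟ²⁾(z)` as a matrix of operators. -/
def halfOp (q p : Fˣ) (r : ℕ → F) (n : ℕ) (z : A) (α β : Fin 2) :
    Matrix (Fin (n + 1)) (Fin (n + 1)) A :=
  halfFactor p n z • lOp q p r n z α β

include h

theorem RHalf_eq_halfOp [CharZero F] (n : ℕ) (z : Aˣ) (α β : Fin 2) (i k : Fin (n + 2)) :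
    RHalf q p r (n + 1) z (α, i) (β, k) = halfOp q p r (n + 1) (z : A) α β i k := by
  rw [RHalf_apply h]
  rfl

theorem isLOperator_halfOp [CharZero F] (n : ℕ) :
    IsLOperator (algebraMap F A p) (weightOp (algebraMap F A p) n)
      (weightOp (algebraMap F A p)⁻¹ n) (raiseOp (fun k => algebraMap F A (r k)) n)
      (fun z : A => halfOp q p r n z) :=
  (isLOperator_lOp h n).smul (halfFactor p n)

theorem leg₂₃_mul_split₁₂_apply (m n : ℕ)
    (R : Matrix (Fin (m + 1) × Fin n) (Fin (m + 1) × Fin n) A)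
    (S : ℕ → ℕ → Matrix (Fin n) (Fin n) A) (hR : ∀ a i b k, R (a, i) (b, k) = S a b i k)
    (γ : Fin 2) (a : Fin (m + 1)) (i : Fin n) (b : Fin (m + 2)) (k : Fin n) :
    (leg₂₃ (X := Fin 2) R * split₁₂ (Z := Fin n) ((fusE r m).map (algebraMap F A)))
      (γ, a, i) (b, k) =
    if γ = 0 then S a b i k * algebraMap F A (r (m + 1 - b) / r (m + 1))
    else S a (b - 1) i k * algebraMap F A (r b / r (m + 1)) := by
  have e1 : (leg₂₃ (X := Fin 2) R * split₁₂ (Z := Fin n) ((fusE r m).map (algebraMap F A)))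
      (γ, a, i) (b, k) =
      ∑ a' : Fin (m + 1), S a a' i k * algebraMap F A (fusECoeff r m γ a' b) := by
    rw [Matrix.mul_apply, Fintype.sum_prod_type, Finset.sum_eq_single γ]
    · rw [Fintype.sum_prod_type]
      refine Finset.sum_congr rfl fun a' _ => ?_
      rw [Finset.sum_eq_single k]
      · simp [leg₂₃, split₁₂, hR, fusE_apply]
      · intro k' _ hk
        simp [split₁₂, hk]
      · simp
    · intro γ' _ hγ
      simp [leg₂₃, hγ.symm]
    · simp
  rw [e1]
  obtain ⟨b, hb⟩ := b
  simp only [fusECoeff]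
  split_ifs with hγ
  · simp only [apply_ite (algebraMap F A), map_zero, mul_ite, mul_zero]
    rw [sum_fin_ite_eq' b (fun a' => S a a' i k * algebraMap F A (r (m + 1 - a') / r (m + 1)))]
    split_ifs with hbm
    · rfl
    · simp [show m + 1 - b = 0 by omega, h.root_zero]
  · simp only [apply_ite (algebraMap F A), map_zero, mul_ite, mul_zero]
    rw [sum_fin_ite_succ b (fun a' => S a a' i k * algebraMap F A (r (a' + 1) / r (m + 1)))]
    obtain _ | b := b
    · simp [h.root_zero]
    · rw [if_pos (by omega), Nat.add_sub_cancel]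

/-- The first tensor factor is read as matrix indices and the second as the space of operators. The
factor `r (m + 2)` in the denominator of ℰ cancels the one in the numerator of ℱ, and the recursion
of `RMat` becomes that of `fusedOp`. -/
theorem RMat_eq_fusedOp [CharZero F] (m n : ℕ) (z : Aˣ) (a b : Fin (m + 2)) (i k : Fin (n + 2)) :
    RMat q p r (m + 1) (n + 1) z (a, i) (b, k) =
      fusedOp (algebraMap F A p) (fun j => algebraMap F A (r j))
        (fun z : A => halfOp q p r (n + 1) z) (m + 1) (z : A) a b i k := by
  have hP : (algebraMap F A p) ≠ 0 := by simp
  induction m generalizing z i k with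
  | zero =>
    have e1 : algebraMap F A (r 1) * algebraMap F A (r 1) = 1 := by
      rw [← map_mul, h.root_one_mul_self, map_one]
    have e2 : algebraMap F A (r 1) ^ 2 = 1 := by rw [sq, e1]
    have e3 : algebraMap F A (r 0) = 0 := by rw [h.root_zero, map_zero]
    rw [RMat, RHalf_eq_halfOp h]
    fin_cases a <;> fin_cases b <;>
      simp [fusedOp, fusedUpper, fusedLower, e2, e3, smul_smul, h.root_one_mul_self]
  | succ m ih =>
    have hr := h.root_ne_zero (n := m + 2) (by omega)
    have hR := leg₂₃_mul_split₁₂_apply h (m + 1) (n + 2)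
      (RMat q p r (m + 1) (n + 1) (toUnit A p * z)) _
      (fun a i b k => ih (toUnit A p * z) a b i k)
    have e0 : ((toUnit A p * z : Aˣ) : A) = algebraMap F A p * z := rfl
    have e1 : ((toUnit A (p⁻¹ ^ (m + 1)) * z : Aˣ) : A) = z / algebraMap F A p ^ (m + 1) := by
      simp [toUnit]
      field_simp
    rw [e0] at hR
    set S := fusedOp (algebraMap F A p) (fun j => algebraMap F A (r j))
        (fun z : A => halfOp q p r (n + 1) z) (m + 1) (algebraMap F A p * z) with hS
    have hL : ∀ (α : Fin 2) (a : Fin (m + 2)) (i k : Fin (n + 2)) (b : Fin (m + 3)),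
        (leg₁₃ (Y := Fin (m + 2)) (RHalf q p r (n + 1) (toUnit A (p⁻¹ ^ (m + 1)) * z)) *
        (leg₂₃ (X := Fin 2) (RMat q p r (m + 1) (n + 1) (toUnit A p * z)) *
        split₁₂ (Z := Fin (n + 2)) ((fusE r (m + 1)).map (algebraMap F A)))) (α, a, i) (b, k) =
        (algebraMap F A (r (m + 2)))⁻¹ *
        (if α = 0 then fusedUpper (fun j => algebraMap F A (r j))
            (halfOp q p r (n + 1) (z / algebraMap F A p ^ (m + 1))) S (m + 1) a b i k
          else fusedLower (fun j => algebraMap F A (r j))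
            (halfOp q p r (n + 1) (z / algebraMap F A p ^ (m + 1))) S (m + 1) a b i k) := by
      intro α a i k b
      rw [Matrix.mul_apply, Fintype.sum_prod_type]
      have : ∀ γ : Fin 2, ∑ y : Fin (m + 2) × Fin (n + 2),
          leg₁₃ (Y := Fin (m + 2)) (RHalf q p r (n + 1) (toUnit A (p⁻¹ ^ (m + 1)) * z))
            (α, a, i) (γ, y) * (leg₂₃ (X := Fin 2) (RMat q p r (m + 1) (n + 1) (toUnit A p * z)) *
          split₁₂ (Z := Fin (n + 2)) ((fusE r (m + 1)).map (algebraMap F A))) (γ, y) (b, k) =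
          ∑ i', halfOp q p r (n + 1) ((z : A) / algebraMap F A p ^ (m + 1)) α γ i i' *
            (if γ = 0 then S a b i' k * algebraMap F A (r (m + 1 + 1 - b) / r (m + 1 + 1))
            else S a (b - 1) i' k * algebraMap F A (r b / r (m + 1 + 1))) := by
        intro γ
        rw [Fintype.sum_prod_type, Finset.sum_eq_single a]
        · refine Finset.sum_congr rfl fun i' _ => ?_
          rw [hR]
          simp only [leg₁₃, Matrix.of_apply, if_true]
          rw [RHalf_eq_halfOp h, e1]
        · intro a' _ ha
          simp [leg₁₃, ha.symm]
        · simp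
      simp only [this, Fin.sum_univ_two, if_true, one_ne_zero, if_false, map_div₀]
      simp only [← mul_assoc, mul_div_assoc', ← Finset.sum_div, ← Finset.sum_mul]
      simp only [← Matrix.mul_apply, fusedUpper, fusedLower, Matrix.add_apply, Matrix.smul_apply,
        smul_eq_mul]
      split_ifs with hα
      · subst hα
        field_simp
      · obtain rfl : α = 1 := by omega
        field_simp
    rw [RMat, sandwich, Matrix.mul_assoc, Matrix.mul_assoc, Matrix.mul_apply,
      Fintype.sum_prod_type]
    have hF := sum_fusF_mul h (A := A) (m + 1) a a.2 (fun α a' =>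
      (algebraMap F A (r (m + 2)))⁻¹ *
        (if α = 0 then fusedUpper (fun j => algebraMap F A (r j))
            (halfOp q p r (n + 1) ((z : A) / algebraMap F A p ^ (m + 1))) S (m + 1) a' b i k
          else fusedLower (fun j => algebraMap F A (r j))
            (halfOp q p r (n + 1) ((z : A) / algebraMap F A p ^ (m + 1))) S (m + 1) a' b i k))
    have hsum : ∀ α : Fin 2, ∑ y : Fin (m + 2) × Fin (n + 2),
        fuse₁₂ (Z := Fin (n + 2)) ((fusF q r (m + 1)).map (algebraMap F A)) (a, i) (α, y) *
        (leg₁₃ (Y := Fin (m + 2)) (RHalf q p r (n + 1) (toUnit A (p⁻¹ ^ (m + 1)) * z)) *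
        (leg₂₃ (X := Fin 2) (RMat q p r (m + 1) (n + 1) (toUnit A p * z)) *
        split₁₂ (Z := Fin (n + 2)) ((fusE r (m + 1)).map (algebraMap F A)))) (α, y) (b, k) =
        ∑ a' : Fin (m + 2), algebraMap F A (fusF q r (m + 1) a (α, a')) *
          ((algebraMap F A (r (m + 2)))⁻¹ *
        (if α = 0 then fusedUpper (fun j => algebraMap F A (r j))
            (halfOp q p r (n + 1) ((z : A) / algebraMap F A p ^ (m + 1))) S (m + 1) a' b i k
          else fusedLower (fun j => algebraMap F A (r j))
            (halfOp q p r (n + 1) ((z : A) / algebraMap F A p ^ (m + 1))) S (m + 1) a' b i k)) := by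
      intro α
      rw [Fintype.sum_prod_type]
      refine Finset.sum_congr rfl fun a' _ => ?_
      rw [Finset.sum_eq_single i]
      · rw [hL]
        simp [fuse₁₂]
      · intro i' _ hi
        simp [fuse₁₂, hi.symm]
      · simp
    refine (Finset.sum_congr rfl fun α _ => hsum α).trans ?_
    rw [hF, fusedOp, ← hS]
    have hD : algebraMap F A (r (m + 1 + 1 - a)) ^ 2 + algebraMap F A (r a) ^ 2 =
        algebraMap F A (qInt q ((m + 1 : ℕ) + 1 - (a : ℕ) : ℤ) + qInt q (a : ℕ)) := by
      rw [← map_pow, ← map_pow, h.sq_root, h.sq_root, ← map_add, Nat.cast_sub (by omega)]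
      norm_cast
    simp only [Matrix.smul_apply, Matrix.add_apply, smul_eq_mul, hD, if_true, one_ne_zero,
      if_false, map_div₀]
    have hr' : algebraMap F A (r (m + 2)) ≠ 0 := by simpa using hr
    field_simp

end FusedRMatrix

/-! ### Flip symmetry, weight conservation and intertwining over a field -/

section FieldProperties

variable {A : Type*} [Field A] [Algebra F A] {q p : Fˣ} {r : ℕ → F} (h : IsRootData q p r)

theorem raiseOp_map {A' : Type*} [Field A'] (f : A →+* A') (ρ : ℕ → A) (n : ℕ) :
    (raiseOp ρ n).map f = raiseOp (fun k => f (ρ k)) n := by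
  ext i k
  simp [raiseOp, apply_ite f]

theorem weightOp_map {A' : Type*} [Field A'] (f : A →+* A') (P : A) (n : ℕ) :
    (weightOp P n).map f = weightOp (f P) n := by
  rw [weightOp, Matrix.diagonal_map (map_zero f), weightOp]
  congr 1
  ext i
  simp

theorem raiseOp_rev (ρ : ℕ → A) (n : ℕ) (i k : Fin (n + 1)) :
    raiseOp ρ n i.rev k.rev = lowerOp ρ n i k := by
  obtain ⟨i, hi⟩ := i
  obtain ⟨k, hk⟩ := k
  simp only [raiseOp, lowerOp, Matrix.of_apply, Fin.val_rev]
  by_cases hik : i + 1 = k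
  · rw [if_pos hik, if_pos (by omega)]
    subst hik
    rw [mul_comm, show n - (n + 1 - (i + 1 + 1)) = i + 1 by omega,
      show n + 1 - (i + 1 + 1) + 1 = n - i by omega]
  · rw [if_neg hik, if_neg (by omega)]

theorem lowerOp_rev (ρ : ℕ → A) (n : ℕ) (i k : Fin (n + 1)) :
    lowerOp ρ n i.rev k.rev = raiseOp ρ n i k := by
  rw [← raiseOp_rev, Fin.rev_rev, Fin.rev_rev]

theorem weightOp_rev {P : A} (hP : P ≠ 0) (n : ℕ) (i k : Fin (n + 1)) :
    weightOp P n i.rev k.rev = weightOp P⁻¹ n i k := by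
  simp only [weightOp, Matrix.diagonal_apply, Fin.rev_inj]
  split_ifs with hik
  · obtain ⟨i, hi⟩ := i
    obtain ⟨k, hk⟩ := k
    obtain rfl : i = k := by simpa using hik
    simp only [Fin.val_rev]
    have := pow_ne_zero n hP
    have := pow_ne_zero i hP
    rw [show n + 1 - (i + 1) = n - i by omega, pow_sub₀ _ hP (by omega), inv_pow, inv_pow]
    field_simp
  · rfl

include h

/-- Reversing the basis of the second space exchanges raising and lowering operators and the two
diagonal blocks; that is the same as reversing the basis of the first space. -/
theorem halfOp_rev (n : ℕ) (z : A) (α β : Fin 2) :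
    Matrix.reindexAlgEquiv A A Fin.revPerm (halfOp q p r n z α β) =
      halfOp q p r n z α.rev β.rev := by
  have hP : (algebraMap F A p) ≠ 0 := by simp
  have r0 : (0 : Fin 2).rev = 1 := rfl
  have r1 : (1 : Fin 2).rev = 0 := rfl
  have hd : ∀ i : Fin (n + 1), algebraMap F A p ^ n * algebraMap F A p /
      (algebraMap F A p ^ (i.rev : ℕ)) ^ 2 =
      (algebraMap F A p ^ (i : ℕ)) ^ 2 * algebraMap F A p / algebraMap F A p ^ n := by
    rintro ⟨i, hi⟩
    have := pow_ne_zero n hP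
    have := pow_ne_zero i hP
    simp only [Fin.val_rev]
    rw [show n + 1 - (i + 1) = n - i by omega, pow_sub₀ _ hP (by omega)]
    field_simp
  have h00 : Matrix.reindexAlgEquiv A A Fin.revPerm (lOp q p r n z 0 0) = lOp q p r n z 1 1 := by
    ext i k
    rw [lOp_zero_zero, lOp_one_one]
    simp only [Matrix.coe_reindexAlgEquiv, Matrix.reindex_apply, Matrix.submatrix_apply,
      Matrix.diagonal_apply, Fin.revPerm_symm, Fin.revPerm_apply, Fin.rev_inj, hd]
  have h11 : Matrix.reindexAlgEquiv A A Fin.revPerm (lOp q p r n z 1 1) = lOp q p r n z 0 0 := by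
    rw [← h00]
    ext i k
    simp
  have h01 : Matrix.reindexAlgEquiv A A Fin.revPerm (lOp q p r n z 0 1) = lOp q p r n z 1 0 := by
    ext i k
    rw [lOp_zero_one, lOp_one_zero]
    simp [raiseOp_rev]
  have h10 : Matrix.reindexAlgEquiv A A Fin.revPerm (lOp q p r n z 1 0) = lOp q p r n z 0 1 := by
    ext i k
    rw [lOp_zero_one, lOp_one_zero]
    simp [lowerOp_rev]
  rw [halfOp, map_smul, halfOp]
  congr 1
  fin_cases α <;> fin_cases β <;> assumption

theorem RMat_rev_of_field [CharZero F] (m n : ℕ) (z : Aˣ) (a b : Fin (m + 2)) (i k : Fin (n + 2)) :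
    RMat q p r (m + 1) (n + 1) z (a.rev, i.rev) (b.rev, k.rev) =
      RMat q p r (m + 1) (n + 1) z (a, i) (b, k) := by
  have := fusedOp_flip (isFusionRoot h (A := A))
    (Matrix.reindexAlgEquiv A A Fin.revPerm : Matrix (Fin (n + 2)) (Fin (n + 2)) A ≃ₐ[A] _)
    (L := fun z : A => halfOp q p r (n + 1) z) (fun z α β => halfOp_rev h (n + 1) z α β) (m + 1)
    (z : A) (a := a) (b := b) (by omega) (by omega)
  rw [RMat_eq_fusedOp h, RMat_eq_fusedOp h, Fin.val_rev, Fin.val_rev,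
    show m + 2 - ((a : ℕ) + 1) = m + 1 - a by omega,
    show m + 2 - ((b : ℕ) + 1) = m + 1 - b by omega, ← this]
  simp

/-- An entry x satisfies (q^(b+k) - q^(a+i)) x = 0 by `fusedOp_weight`, and the scalar is nonzero
because q is not a root of unity. -/
theorem RMat_weight_of_field [CharZero F] (m n : ℕ) (z : Aˣ) (a b : Fin (m + 2))
    (i k : Fin (n + 2)) (hne : (a : ℕ) + i ≠ b + k) :
    RMat q p r (m + 1) (n + 1) z (a, i) (b, k) = 0 := by
  have hP : (algebraMap F A p) ≠ 0 := by simp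
  have hq : (p : F) ^ 2 = q := by rw [← h.sq_eq, Units.val_pow_eq_pow_val]
  have hw := congrFun (congrFun (fusedOp_weight (isLOperator_halfOp h (A := A) (n + 1))
    (isFusionRoot h) (m + 1) (z : A) a b) i) k
  rw [RMat_eq_fusedOp h]
  simp only [Matrix.smul_apply, weightOp, Matrix.diagonal_mul, Matrix.mul_diagonal,
    smul_eq_mul] at hw
  generalize fusedOp (algebraMap F A p) (fun j => algebraMap F A (r j))
    (fun z : A => halfOp q p r (n + 1) z) (m + 1) (z : A) a b i k = x at hw ⊢
  have e : ((q : F) ^ ((b : ℕ) + k) - (q : F) ^ ((a : ℕ) + i)) ≠ 0 := by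
    intro e
    refine h.zpow_ne_one (n := ((b : ℕ) + k : ℕ) - ((a : ℕ) + i : ℕ)) (by omega) ?_
    rw [zpow_sub, zpow_natCast, zpow_natCast, ← div_eq_mul_inv, div_eq_one]
    ext
    push_cast
    exact sub_eq_zero.mp e
  have h1 : algebraMap F A (q ^ ((b : ℕ) + k) - (q : F) ^ ((a : ℕ) + i)) * x = 0 := by
    have := pow_ne_zero (n + 1) hP
    have := pow_ne_zero (i : ℕ) hP
    have := pow_ne_zero (k : ℕ) hP
    rw [map_sub, map_pow, map_pow, ← hq, map_pow, pow_add, pow_add, sub_mul, sub_eq_zero]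
    field_simp at hw
    linear_combination (exp := 1) hw
  exact (mul_eq_zero.mp h1).resolve_left ((map_ne_zero _).mpr e)

section Entries

variable {m n : ℕ} (ρ : ℕ → A) (P : A) (Y : Matrix (Fin n) (Fin n) A)
  (R : Matrix (Fin (m + 1) × Fin n) (Fin (m + 1) × Fin n) A)
  (S : ℕ → ℕ → Matrix (Fin n) (Fin n) A) (hR : ∀ a i b k, R (a, i) (b, k) = S a b i k)
omit h
include hR

theorem weightOp_kronecker_mul_apply (a : Fin (m + 1)) (i : Fin n) (b : Fin (m + 1)) (k : Fin n) :
    ((weightOp P m ⊗ₖ Y) * R) (a, i) (b, k) = P ^ m / (P ^ (a : ℕ)) ^ 2 * (Y * S a b) i k := by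
  rw [Matrix.mul_apply, Fintype.sum_prod_type, Finset.sum_eq_single a, Matrix.mul_apply,
    Finset.mul_sum]
  · refine Finset.sum_congr rfl fun i' _ => ?_
    simp [weightOp, hR, mul_assoc]
  · intro a' _ ha
    simp [weightOp, Matrix.diagonal_apply_ne' _ ha]
  · simp

theorem mul_weightOp_kronecker_apply (a : Fin (m + 1)) (i : Fin n) (b : Fin (m + 1)) (k : Fin n) :
    (R * (weightOp P m ⊗ₖ Y)) (a, i) (b, k) = P ^ m / (P ^ (b : ℕ)) ^ 2 * (S a b * Y) i k := by
  rw [Matrix.mul_apply, Fintype.sum_prod_type, Finset.sum_eq_single b, Matrix.mul_apply,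
    Finset.mul_sum]
  · refine Finset.sum_congr rfl fun i' _ => ?_
    simp [weightOp, hR, mul_left_comm]
  · intro a' _ ha
    simp [weightOp, Matrix.diagonal_apply_ne _ ha]
  · simp

theorem raiseOp_kronecker_mul_apply (h0 : ρ 0 = 0) (a : Fin (m + 1)) (i : Fin n) (b : Fin (m + 1))
    (k : Fin n) : ((raiseOp ρ m ⊗ₖ Y) * R) (a, i) (b, k) =
      ρ a * ρ (m + 1 - a) * (Y * S (a - 1) b) i k := by
  have e : ∀ a' : Fin (m + 1), ∑ i', (raiseOp ρ m ⊗ₖ Y) (a, i) (a', i') * R (a', i') (b, k) =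
      if (a : ℕ) = a' + 1 then ρ (a' + 1) * ρ (m - a') * (Y * S a' b) i k else 0 := by
    intro a'
    split_ifs with ha
    · rw [Matrix.mul_apply, Finset.mul_sum]
      refine Finset.sum_congr rfl fun i' _ => ?_
      simp [raiseOp, hR, ha, mul_assoc]
    · simp [raiseOp, ha]
  rw [Matrix.mul_apply, Fintype.sum_prod_type, Finset.sum_congr rfl fun a' _ => e a',
    sum_fin_ite_succ (a : ℕ) fun a' => ρ (a' + 1) * ρ (m - a') * (Y * S a' b) i k]
  obtain ⟨a, ha⟩ := a
  obtain _ | a := a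
  · simp [h0]
  · rw [if_pos (by simpa using by omega)]
    simp

theorem mul_raiseOp_kronecker_apply (h0 : ρ 0 = 0) (a : Fin (m + 1)) (i : Fin n) (b : Fin (m + 1))
    (k : Fin n) : (R * (raiseOp ρ m ⊗ₖ Y)) (a, i) (b, k) =
      ρ (b + 1) * ρ (m - b) * (S a (b + 1) * Y) i k := by
  have e : ∀ b' : Fin (m + 1), ∑ i', R (a, i) (b', i') * (raiseOp ρ m ⊗ₖ Y) (b', i') (b, k) =
      if (b' : ℕ) = b + 1 then ρ (b + 1) * ρ (m - b) * (S a b' * Y) i k else 0 := by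
    intro b'
    split_ifs with hb
    · rw [Matrix.mul_apply, Finset.mul_sum]
      refine Finset.sum_congr rfl fun i' _ => ?_
      simp [raiseOp, hR, hb, mul_left_comm]
    · simp [raiseOp, hb]
  rw [Matrix.mul_apply, Fintype.sum_prod_type, Finset.sum_congr rfl fun b' _ => e b']
  obtain ⟨b, hb⟩ := b
  rw [sum_fin_ite_eq (b + 1) fun b' => ρ (b + 1) * ρ (m - b) * (S a b' * Y) i k]
  split_ifs with hbm
  · rfl
  · simp [show m - b = 0 by omega, h0]

end Entries

/-- The R-matrix intertwines the coproduct of the raising operator with its opposite. -/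
theorem RMat_raise_of_field [CharZero F] (m n : ℕ) (z : Aˣ) :
    ((raiseOp r (m + 1) ⊗ₖ weightOp (p : F) (n + 1)).map (algebraMap F A) +
      (z : A) • (weightOp (p : F)⁻¹ (m + 1) ⊗ₖ raiseOp r (n + 1)).map (algebraMap F A)) *
      RMat q p r (m + 1) (n + 1) z =
    RMat q p r (m + 1) (n + 1) z *
      ((raiseOp r (m + 1) ⊗ₖ weightOp (p : F)⁻¹ (n + 1)).map (algebraMap F A) +
      (z : A) • (weightOp (p : F) (m + 1) ⊗ₖ raiseOp r (n + 1)).map (algebraMap F A)) := by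
  ext ⟨a, i⟩ ⟨b, k⟩
  have hρ := isFusionRoot h (A := A)
  have hP : (algebraMap F A p) ≠ 0 := by simp
  have := congrFun (congrFun (fusedOp_raise (isLOperator_halfOp h (A := A) (n + 1))
    hρ (m + 1) (z : A) z.ne_zero a b) i) k
  have hk : ∀ {l k : ℕ} (X : Matrix (Fin l) (Fin l) F) (Y : Matrix (Fin k) (Fin k) F),
      (X ⊗ₖ Y).map (algebraMap F A) = X.map (algebraMap F A) ⊗ₖ Y.map (algebraMap F A) :=
    fun X Y => by ext; simp
  simp only [hk, raiseOp_map, weightOp_map, Matrix.add_mul, Matrix.mul_add, Matrix.smul_mul,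
    Matrix.mul_smul, Matrix.add_apply, Matrix.smul_apply, smul_eq_mul]
  have hR := RMat_eq_fusedOp h (A := A) m n z
  rw [raiseOp_kronecker_mul_apply _ _ _ _ (fun a i b k => hR a b i k) hρ.zero,
    mul_raiseOp_kronecker_apply _ _ _ _ (fun a i b k => hR a b i k) hρ.zero,
    weightOp_kronecker_mul_apply _ _ _ _ (fun a i b k => hR a b i k),
    mul_weightOp_kronecker_apply _ _ _ _ (fun a i b k => hR a b i k)]
  simp only [Matrix.add_apply, Matrix.smul_apply, smul_eq_mul] at this
  convert this using 2
  · have := pow_ne_zero (a : ℕ) hP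
    have := pow_ne_zero (m + 1) hP
    rw [map_inv₀, inv_pow, inv_pow]
    field_simp
  · rw [map_inv₀]
  · rw [mul_div_assoc, mul_assoc]

end FieldProperties

/-! ### Functoriality of the R-matrix in the coefficient algebra -/

section Functoriality

variable {A A' : Type*} [Ring A] [Algebra F A] [Ring A'] [Algebra F A'] (φ : A →ₐ[F] A')

theorem sandwich_map {M N : Type*} [Fintype N] (f : Matrix M N A) (a b : Matrix N N A)
    (e : Matrix N M A) : (sandwich f a b e).map φ =
      sandwich (f.map φ) (a.map φ) (b.map φ) (e.map φ) := by
  simp only [sandwich, Matrix.map_mul (f := φ)]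

theorem toUnit_map_mul (u : Fˣ) (z : Aˣ) :
    toUnit A' u * Units.map (φ : A →* A') z = Units.map (φ : A →* A') (toUnit A u * z) := by
  ext
  simp [toUnit]

theorem map_cfun (z : Aˣ) : φ (cfun z) = cfun (Units.map (φ : A →* A') z) := by
  simp [cfun]

theorem map_toUnit (u : Fˣ) : Units.map (φ : A →* A') (toUnit A u) = toUnit A' u := by
  ext
  simp [toUnit]

theorem RHalfHalf_map (q : Fˣ) (z : Aˣ) :
    RHalfHalf q (Units.map (φ : A →* A') z) = (RHalfHalf q z).map φ := by
  rw [RHalfHalf, RHalfHalf]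
  simp only [← map_cfun, ← map_toUnit φ q]
  ext i j
  simp only [Matrix.reindex_apply, Matrix.submatrix_apply, Matrix.map_apply, Equiv.symm_symm]
  generalize finProdFinEquiv i = x
  generalize finProdFinEquiv j = y
  revert x y
  change ∀ x y : Fin 4, _
  intro x y
  rw [← map_mul, ← map_cfun]
  fin_cases x <;> fin_cases y <;> simp [map_zero φ]

theorem RHalf_map (q p : Fˣ) (r : ℕ → F) (n : ℕ) (z : Aˣ) :
    RHalf q p r n (Units.map (φ : A →* A') z) = (RHalf q p r n z).map φ := by
  induction n generalizing z with
  | zero => simp [RHalf]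
  | succ n ih =>
    obtain _ | n := n
    · exact RHalfHalf_map φ q z
    · rw [RHalf, RHalf, sandwich_map, toUnit_map_mul, toUnit_map_mul, ih, RHalfHalf_map]
      congr 1
      · ext x y; simp [fuse₂₃, apply_ite φ]
      · ext x y; simp [leg₁₃, apply_ite φ]
      · ext x y; simp [leg₁₂, apply_ite φ]
      · ext x y; simp [split₂₃, apply_ite φ]

theorem RMat_map (q p : Fˣ) (r : ℕ → F) (m n : ℕ) (z : Aˣ) :
    RMat q p r m n (Units.map (φ : A →* A') z) = (RMat q p r m n z).map φ := by
  induction m generalizing z with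
  | zero => simp [RMat]
  | succ m ih =>
    obtain _ | m := m
    · exact RHalf_map φ q p r n z
    · rw [RMat, RMat, sandwich_map, toUnit_map_mul, toUnit_map_mul, ih, RHalf_map]
      congr 1
      · ext x y; simp [fuse₁₂, apply_ite φ]
      · ext x y; simp [leg₁₃, apply_ite φ]
      · ext x y; simp [leg₂₃, apply_ite φ]
      · ext x y; simp [split₁₂, apply_ite φ]

end Functoriality

/-! ### Transfer from the field of rational functions to arbitrary algebras -/

section Universal

variable (F) in
/-- The indeterminate of the ring of Laurent polynomials, as a unit. -/
def tUnit : (LaurentPolynomial F)ˣ where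
  val := LaurentPolynomial.T 1
  inv := LaurentPolynomial.T (-1)
  val_inv := by rw [← LaurentPolynomial.T_add]; exact LaurentPolynomial.T_zero
  inv_val := by rw [← LaurentPolynomial.T_add]; exact LaurentPolynomial.T_zero

/-- Laurent polynomials form the free algebra on one unit. So an identity between entries of R at
any unit z, even of a noncommutative algebra, follows from the one at the indeterminate, which may
be checked in the fraction field. -/
theorem exists_map_tUnit {A : Type*} [Ring A] [Algebra F A] (z : Aˣ) :
    ∃ φ : LaurentPolynomial F →ₐ[F] A, Units.map (φ : LaurentPolynomial F →* A) (tUnit F) = z := by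
  refine ⟨AddMonoidAlgebra.lift F A ℤ ((Units.coeHom A).comp (zpowersHom Aˣ z)), ?_⟩
  ext
  change AddMonoidAlgebra.lift F A ℤ _ (LaurentPolynomial.T 1) = _
  rw [LaurentPolynomial.T, AddMonoidAlgebra.lift_single]
  simp

variable (F) in
/-- The embedding of Laurent polynomials into their field of fractions. -/
def toFraction : LaurentPolynomial F →ₐ[F] FractionRing (LaurentPolynomial F) :=
  IsScalarTower.toAlgHom F _ _

theorem toFraction_injective : Function.Injective (toFraction F) :=
  IsFractionRing.injective (LaurentPolynomial F) (FractionRing (LaurentPolynomial F))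

variable {A : Type*} [Ring A] [Algebra F A] {q p : Fˣ} {r : ℕ → F} [CharZero F]
  (h : IsRootData q p r)
include h

theorem RMat_rev (m n : ℕ) (z : Aˣ) (a b : Fin (m + 2)) (i k : Fin (n + 2)) :
    RMat q p r (m + 1) (n + 1) z (a.rev, i.rev) (b.rev, k.rev) =
      RMat q p r (m + 1) (n + 1) z (a, i) (b, k) := by
  obtain ⟨φ, rfl⟩ := exists_map_tUnit (F := F) z
  rw [RMat_map, Matrix.map_apply, Matrix.map_apply]
  congr 1
  apply toFraction_injective
  have := RMat_rev_of_field h m n (Units.map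
    (toFraction F : LaurentPolynomial F →* FractionRing (LaurentPolynomial F)) (tUnit F)) a b i k
  rwa [RMat_map] at this

theorem RMat_weight (m n : ℕ) (z : Aˣ) (a b : Fin (m + 2)) (i k : Fin (n + 2))
    (hne : (a : ℕ) + i ≠ b + k) : RMat q p r (m + 1) (n + 1) z (a, i) (b, k) = 0 := by
  obtain ⟨φ, rfl⟩ := exists_map_tUnit (F := F) z
  rw [RMat_map, Matrix.map_apply]
  have := RMat_weight_of_field h m n (Units.map
    (toFraction F : LaurentPolynomial F →* FractionRing (LaurentPolynomial F)) (tUnit F)) a b i k hne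
  rw [RMat_map, Matrix.map_apply] at this
  rw [toFraction_injective (this.trans (map_zero _).symm), map_zero]

omit [CharZero F] h in
theorem map_add_smul_map {A' ι : Type*} [Ring A'] [Algebra F A'] (φ : A →ₐ[F] A')
    (X Y : Matrix ι ι F) (z : Aˣ) :
    X.map (algebraMap F A') + ((Units.map (φ : A →* A') z : A'ˣ) : A') • Y.map (algebraMap F A') =
      (X.map (algebraMap F A) + (z : A) • Y.map (algebraMap F A)).map φ := by
  ext
  simp

/-- The R-matrix intertwines the coproduct of the raising operator with its opposite. -/
theorem RMat_raise (m n : ℕ) (z : Aˣ) :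
    ((raiseOp r (m + 1) ⊗ₖ weightOp (p : F) (n + 1)).map (algebraMap F A) +
      (z : A) • (weightOp (p : F)⁻¹ (m + 1) ⊗ₖ raiseOp r (n + 1)).map (algebraMap F A)) *
      RMat q p r (m + 1) (n + 1) z =
    RMat q p r (m + 1) (n + 1) z *
      ((raiseOp r (m + 1) ⊗ₖ weightOp (p : F)⁻¹ (n + 1)).map (algebraMap F A) +
      (z : A) • (weightOp (p : F) (m + 1) ⊗ₖ raiseOp r (n + 1)).map (algebraMap F A)) := by
  obtain ⟨φ, rfl⟩ := exists_map_tUnit (F := F) z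
  have := RMat_raise_of_field h m n (Units.map
    (toFraction F : LaurentPolynomial F →* FractionRing (LaurentPolynomial F)) (tUnit F))
  rw [map_add_smul_map, map_add_smul_map, RMat_map, ← Matrix.map_mul, ← Matrix.map_mul] at this ⊢
  rw [Matrix.map_injective toFraction_injective this]

/-- The R-matrix intertwines the coproduct of the lowering operator with its opposite. -/
theorem RMat_lower (m n : ℕ) (z : Aˣ) :
    ((lowerOp r (m + 1) ⊗ₖ weightOp (p : F)⁻¹ (n + 1)).map (algebraMap F A) +
      (z : A) • (weightOp (p : F) (m + 1) ⊗ₖ lowerOp r (n + 1)).map (algebraMap F A)) *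
      RMat q p r (m + 1) (n + 1) z =
    RMat q p r (m + 1) (n + 1) z *
      ((lowerOp r (m + 1) ⊗ₖ weightOp (p : F) (n + 1)).map (algebraMap F A) +
      (z : A) • (weightOp (p : F)⁻¹ (m + 1) ⊗ₖ lowerOp r (n + 1)).map (algebraMap F A)) := by
  have hp : (p : F) ≠ 0 := p.ne_zero
  -- Reversal of both bases turns raising into lowering operators and inverts the weight operators.
  -- As R is invariant under it, the raising relation becomes the lowering relation.
  have e : ∀ {P P' : F}, P ≠ 0 → P⁻¹ = P' → ∀ Q Q' : F, Q ≠ 0 → Q⁻¹ = Q' →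
      ((raiseOp r (m + 1) ⊗ₖ weightOp P (n + 1)).map (algebraMap F A) +
      (z : A) • (weightOp Q (m + 1) ⊗ₖ raiseOp r (n + 1)).map (algebraMap F A)).submatrix
        (Equiv.prodCongr Fin.revPerm Fin.revPerm) (Equiv.prodCongr Fin.revPerm Fin.revPerm) =
      (lowerOp r (m + 1) ⊗ₖ weightOp P' (n + 1)).map (algebraMap F A) +
      (z : A) • (weightOp Q' (m + 1) ⊗ₖ lowerOp r (n + 1)).map (algebraMap F A) := by
    rintro P _ hP rfl Q _ hQ rfl
    ext ⟨a, i⟩ ⟨b, k⟩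
    simp [raiseOp_rev, weightOp_rev hP, weightOp_rev hQ]
  have hR : (RMat q p r (m + 1) (n + 1) z).submatrix
      (Equiv.prodCongr Fin.revPerm Fin.revPerm) (Equiv.prodCongr Fin.revPerm Fin.revPerm) =
      RMat q p r (m + 1) (n + 1) z := by
    ext ⟨a, i⟩ ⟨b, k⟩
    simp [RMat_rev h]
  have := congrArg (fun M => M.submatrix (Equiv.prodCongr Fin.revPerm Fin.revPerm)
    (Equiv.prodCongr Fin.revPerm Fin.revPerm)) (RMat_raise h m n z)
  simp only [← Matrix.submatrix_mul_equiv _ _ _ (Equiv.prodCongr Fin.revPerm Fin.revPerm) _,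
    hR] at this
  rwa [e hp rfl _ _ (inv_ne_zero hp) (inv_inv _), e (inv_ne_zero hp) (inv_inv _) _ _ hp rfl] at this

end Universal

/-! ### Coefficients and letter deletion in the shuffle algebra -/

namespace QShuffle

variable {q : Fˣ}

/-- The coefficient of a word. -/
def coef (w : List Letter) : QShuffle q →ₗ[F] F := lift fun v => if v = w then 1 else 0

theorem coef_word (v w : List Letter) : coef w (word q v) = if v = w then 1 else 0 :=
  lift_word _ _

theorem eq_zero_of_coef {X : QShuffle q} (hX : ∀ w, coef w X = 0) : X = 0 := by
  refine Finsupp.ext (M := F) fun w => ?_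
  have : (coef w : QShuffle q →ₗ[F] F) = (Finsupp.lapply w : (List Letter →₀ F) →ₗ[F] F) :=
    hom_ext fun v => by
      rw [coef_word]
      exact (Finsupp.single_apply).symm
  exact (LinearMap.congr_fun this X).symm.trans (hX w)

theorem ext_coef {X Y : QShuffle q} (h : ∀ w, coef w X = coef w Y) : X = Y :=
  sub_eq_zero.mp (eq_zero_of_coef fun w => by rw [map_sub, h, sub_self])

theorem delLeft_word_nil (a : Letter) : delLeft a (word q []) = 0 := lift_word _ _

theorem delLeft_word_cons (a b : Letter) (w : List Letter) :
    delLeft a (word q (b :: w)) = if b = a then word q w else 0 := lift_word _ _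

theorem delLeft_consL (a b : Letter) (X : QShuffle q) :
    delLeft a (consL b X) = if b = a then X else 0 := by
  have : (delLeft a) ∘ₗ (consL b) = (if b = a then LinearMap.id else 0 : QShuffle q →ₗ[F] _) :=
    hom_ext fun w => by
      rw [LinearMap.comp_apply, consL_word, delLeft_word_cons]
      split_ifs <;> rfl
  refine (LinearMap.congr_fun this X).trans ?_
  split_ifs <;> rfl

theorem delRight_word (a : Letter) (v : List Letter) : delRight a (word q v) =
    if v.getLast? = some a then word q v.dropLast else 0 := lift_word _ _

theorem coef_delLeft (a : Letter) (w : List Letter) (X : QShuffle q) :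
    coef w (delLeft a X) = coef (a :: w) X := by
  have : (coef w) ∘ₗ (delLeft a) = (coef (a :: w) : QShuffle q →ₗ[F] F) :=
    hom_ext fun v => by
      rw [LinearMap.comp_apply]
      cases v with
      | nil => simp [delLeft_word_nil, coef_word]
      | cons b v =>
        rw [delLeft_word_cons, coef_word]
        by_cases hb : b = a <;> simp [hb, coef_word]
  exact LinearMap.congr_fun this X

theorem coef_delRight (a : Letter) (w : List Letter) (X : QShuffle q) :
    coef w (delRight a X) = coef (w ++ [a]) X := by
  have : (coef w) ∘ₗ (delRight a) = (coef (w ++ [a]) : QShuffle q →ₗ[F] F) :=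
    hom_ext fun v => by
      rw [LinearMap.comp_apply, delRight_word, coef_word]
      rcases v.eq_nil_or_concat with rfl | ⟨v, b, rfl⟩
      · simp
      · by_cases hb : b = a <;> simp [hb, coef_word]
  exact LinearMap.congr_fun this X

theorem coef_delLeft_iterate (a : Letter) (w : List Letter) (n : ℕ) (X : QShuffle q) :
    coef w ((delLeft a)^[n] X) = coef (List.replicate n a ++ w) X := by
  induction n generalizing w with
  | zero => rfl
  | succ n ih =>
    rw [Function.iterate_succ_apply', coef_delLeft, ih, List.replicate_succ', List.append_assoc]
    rfl

theorem coef_delRight_iterate (a : Letter) (w : List Letter) (n : ℕ) (X : QShuffle q) :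
    coef w ((delRight a)^[n] X) = coef (w ++ List.replicate n a) X := by
  induction n generalizing w with
  | zero => simp
  | succ n ih =>
    rw [Function.iterate_succ_apply', coef_delRight, ih, List.replicate_succ, List.append_assoc]
    rfl

theorem one_def : (1 : QShuffle q) = word q [] := rfl

theorem coef_twist (c : Letter) (w : List Letter) (X : QShuffle q) :
    coef w (twist c X) = ((q ^ c.formWord w : Fˣ) : F) * coef w X := by
  have : (coef w) ∘ₗ (twist c) =
      (((q ^ c.formWord w : Fˣ) : F) • coef w : QShuffle q →ₗ[F] F) :=
    hom_ext fun v => by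
      rw [LinearMap.comp_apply, twist_word, map_smul, LinearMap.smul_apply, coef_word]
      by_cases hv : v = w <;> simp [hv]
  exact LinearMap.congr_fun this X

/-- Deletion of the first letter is a twisted derivation of the `q`-shuffle algebra. -/
theorem delLeft_mul (a : Letter) (X Y : QShuffle q) :
    delLeft a (X * Y) = delLeft a X * Y + twist a X * delLeft a Y := by
  have h1 : ∀ u v : List Letter, delLeft a (starWord q u v) =
      star (delLeft a (word q u)) (word q v) +
        star (twist a (word q u)) (delLeft a (word q v)) := by
    intro u v
    cases u with
    | nil =>
      rw [starWord_nil_left, delLeft_word_nil, twist_word]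
      simp [Letter.formWord, one_star]
    | cons b u =>
      cases v with
      | nil =>
        rw [starWord_nil_right, delLeft_word_nil, star_one, map_zero, add_zero]
      | cons c v =>
        -- The exponent in the shuffle recursion pairs the first letter of the right factor with the
        -- whole left word. When that letter is a, this is exactly the twist by a.
        rw [starWord_cons, map_add, map_smul, delLeft_consL, delLeft_consL, delLeft_word_cons,
          delLeft_word_cons, twist_word]
        congr 1
        · split_ifs <;> simp [star_word]
        · split_ifs with hc
          · subst hc
            simp [star_word]
          · simp
  have h2 : ∀ u, (delLeft a) ∘ₗ (star (word q u)) = star (delLeft a (word q u)) +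
      (star (twist a (word q u))) ∘ₗ (delLeft a) := fun u => hom_ext fun v => by
    rw [LinearMap.comp_apply, star_word, h1]
    rfl
  have h3 : (delLeft a) ∘ₗ (star.flip Y) = (star.flip Y) ∘ₗ (delLeft a) +
      (star.flip (delLeft a Y)) ∘ₗ (twist a) := hom_ext fun u => LinearMap.congr_fun (h2 u) Y
  exact LinearMap.congr_fun h3 X

/-- Lengths of words add in a shuffle product, so the empty word arises from two empty words only.
-/
theorem coef_nil_mul (X Y : QShuffle q) : coef [] (X * Y) = coef [] X * coef [] Y := by
  have h1 : ∀ u v : List Letter, coef [] (starWord q u v) =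
      coef [] (word q u) * coef [] (word q v) := by
    have hc : ∀ (a : Letter) (X : QShuffle q), coef [] (consL a X) = 0 := by
      intro a X
      have : (coef []) ∘ₗ (consL a) = (0 : QShuffle q →ₗ[F] F) := hom_ext fun w => by
        simp [consL_word, coef_word]
      exact LinearMap.congr_fun this X
    intro u v
    cases u with
    | nil => simp [starWord_nil_left, coef_word]
    | cons b u =>
      cases v with
      | nil => simp [starWord_nil_right, coef_word]
      | cons c v => simp [starWord_cons, coef_word, hc]
  have h2 : ∀ u, (coef []) ∘ₗ (star (word q u)) = coef [] (word q u) • coef [] :=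
    fun u => hom_ext fun v => by
      rw [LinearMap.comp_apply, star_word, h1]
      rfl
  have h3 : (coef []) ∘ₗ (star.flip Y) = coef [] Y • (coef [] : QShuffle q →ₗ[F] F) :=
    hom_ext fun u => (LinearMap.congr_fun (h2 u) Y).trans (mul_comm _ _)
  exact (LinearMap.congr_fun h3 X).trans (mul_comm _ _)

end QShuffle

/-! ### Coefficients of Δ as weights of lattice paths -/

section Delta

/-- The product of the weights of the steps of the lattice path with steps `w`, starting at
height `h`: an up step at height `k` has weight `[k + m]` and a down step has weight `[k]`. -/
def pathCoeff (q : Fˣ) (m : ℤ) : ℤ → List Letter → F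
  | _, [] => 1
  | h, .x :: w => qInt q (h + m) * pathCoeff q m (h + 1) w
  | h, .y :: w => qInt q h * pathCoeff q m (h - 1) w

variable (q : Fˣ) (m : ℤ)

theorem height_cons (a : Letter) (w : List Letter) : height (a :: w) = a.sgn + height w := by
  simp [height]

theorem pathCoeff_eq_prod (h : ℤ) (w : List Letter) : pathCoeff q m h w =
    ∏ i : Fin w.length, qInt q (h + height (w.take i) + m * ((w.get i).sgn + 1) / 2) := by
  induction w generalizing h with
  | nil => simp [pathCoeff]
  | cons a w ih =>
    refine Eq.trans ?_ (Fin.prod_univ_succ (n := w.length) _).symm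
    cases a
    · rw [pathCoeff, ih]
      congr 1
      · simp [height, Letter.sgn]
      · refine Finset.prod_congr rfl fun i _ => ?_
        simp only [Fin.val_succ, List.take_succ_cons, height_cons,
          show Letter.x.sgn = 1 from rfl]
        rw [add_assoc h]
        rfl
    · rw [pathCoeff, ih]
      congr 1
      · simp [height, Letter.sgn]
      · refine Finset.prod_congr rfl fun i _ => ?_
        simp only [Fin.val_succ, List.take_succ_cons, height_cons,
          show Letter.y.sgn = -1 from rfl]
        rw [sub_eq_add_neg, add_assoc h]
        rfl

theorem deltaCoeff_eq_pathCoeff (w : List Letter) : deltaCoeff q m w = pathCoeff q m 0 w := by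
  rw [pathCoeff_eq_prod, deltaCoeff]
  simp only [zero_add]

/-- A path that becomes negative must take a down step from height 0, whose weight is [0] = 0. The
positivity in the Catalan condition is thus automatic, and in `coef_delta` only length and total
height remain. -/
theorem pathCoeff_eq_zero {h : ℤ} (hh : 0 ≤ h) (w : List Letter) (i : ℕ)
    (hi : h + height (w.take i) < 0) : pathCoeff q m h w = 0 := by
  induction w generalizing h i with
  | nil => simp [height] at hi; omega
  | cons a w ih =>
    obtain _ | i := i
    · simp [height] at hi; omega
    rw [List.take_succ_cons, height_cons] at hi
    cases a
    · rw [pathCoeff, ih (by omega) i (by simp only [Letter.sgn] at hi; omega), mul_zero]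
    · rw [pathCoeff]
      rcases hh.eq_or_lt with rfl | hpos
      · rw [qInt_zero, zero_mul]
      · rw [ih (by omega) i (by simp only [Letter.sgn] at hi; omega), mul_zero]

theorem mem_catalanWords (n : ℕ) (w : List Letter) :
    w ∈ catalanWords n ↔ w.length = 2 * n ∧ IsCatalan w := by
  classical
  rw [catalanWords, Finset.mem_filter, Finset.mem_image]
  refine and_congr_left fun _ => ⟨?_, fun hw => ⟨fun i => w.get (i.cast hw.symm), ?_⟩⟩
  · rintro ⟨f, _, rfl⟩
    simp
  · simp only [Finset.mem_univ, true_and]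
    refine List.ext_get (by simp [hw]) fun i h1 h2 => ?_
    simp

theorem coef_delta (n : ℕ) (w : List Letter) : QShuffle.coef w (delta q m n) =
    if w.length = 2 * n ∧ height w = 0 then pathCoeff q m 0 w else 0 := by
  have e : QShuffle.coef w (delta q m n) =
      if w ∈ catalanWords n then deltaCoeff q m w else 0 := by
    simp only [delta, map_sum, map_smul, QShuffle.coef_word, smul_eq_mul, mul_ite, mul_one,
      mul_zero]
    simp
  have hm := mem_catalanWords n w
  rw [e, deltaCoeff_eq_pathCoeff]
  by_cases hw : w.length = 2 * n ∧ height w = 0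
  · rw [if_pos hw]
    by_cases hc : IsCatalan w
    · rw [if_pos (hm.mpr ⟨hw.1, hc⟩)]
    · rw [if_neg fun h => hc (hm.mp h).2]
      rw [IsCatalan, not_and'] at hc
      have := hc hw.2
      push Not at this
      obtain ⟨i, _, hi⟩ := this
      exact (pathCoeff_eq_zero q m le_rfl w i (by simpa using hi)).symm
  · rw [if_neg hw, if_neg fun h => hw ⟨(hm.mp h).1, (hm.mp h).2.2⟩]

theorem pathCoeff_replicate_x (h : ℤ) (n : ℕ) (w : List Letter) :
    pathCoeff q m h (List.replicate n .x ++ w) =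
      (∏ i ∈ Finset.range n, qInt q (h + i + m)) * pathCoeff q m (h + n) w := by
  induction n generalizing h with
  | zero => simp
  | succ n ih =>
    rw [List.replicate_succ, List.cons_append, pathCoeff, ih, Finset.prod_range_succ', ← mul_assoc,
      mul_comm (qInt q _)]
    push_cast
    congr 1
    · simp only [add_assoc, add_comm (1 : ℤ), add_zero]
    · rw [add_assoc, add_comm (1 : ℤ)]

theorem pathCoeff_replicate_y (n : ℕ) :
    pathCoeff q m n (List.replicate n .y) = qFactorial q n := by
  induction n with
  | zero => simp [pathCoeff, qFactorial]
  | succ n ih =>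
    rw [List.replicate_succ, pathCoeff, qFactorial, Finset.prod_range_succ, ← qFactorial, ← ih]
    push_cast
    rw [add_sub_cancel_right, mul_comm]

end Delta

/-- A map of coefficients, applied to a Laurent series. -/
def coeffMap {B C : Type*} [AddCommGroup B] [AddCommGroup C] (f : B →+ C) :
    HahnSeries ℤ B →+ HahnSeries ℤ C where
  toFun x := x.map f
  map_zero' := by ext; simp
  map_add' x y := by ext; simp

/-! ### Coefficients of the K-matrix -/

section KMatrix

variable (q : Fˣ) (J : ℕ)

/-- The coefficient of the word `w` in the coefficient of `t ^ k` in `Δ⁽⁻ᴶ⁾(-t²)`. -/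
def deltaNegSqCoef (k : ℤ) (w : List Letter) : F :=
  if k = w.length ∧ height w = 0 then (-1) ^ (w.length / 2) * pathCoeff q (-J) 0 w else 0

theorem even_length_sub_height (w : List Letter) : ∃ n : ℤ, (w.length : ℤ) - height w = 2 * n := by
  induction w with
  | nil => exact ⟨0, rfl⟩
  | cons a w ih =>
    obtain ⟨n, hn⟩ := ih
    rw [height_cons, List.length_cons]
    cases a
    · exact ⟨n, by simp only [Letter.sgn]; push_cast; linarith⟩
    · exact ⟨n + 1, by simp only [Letter.sgn]; push_cast; linarith⟩

theorem coef_coeff_deltaNegSq (k : ℕ) (w : List Letter) :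
    QShuffle.coef w (PowerSeries.coeff k (deltaNegSq q (-(J : ℤ)))) = deltaNegSqCoef q J k w := by
  obtain ⟨n, hn⟩ := even_length_sub_height w
  rw [deltaNegSq, PowerSeries.coeff_mk, deltaNegSqCoef]
  split_ifs with h1 h2 h2
  · rw [map_smul, coef_delta, if_pos ⟨by omega, h2.2⟩, smul_eq_mul]
    rw [show k = w.length by omega]
  · rw [map_smul, coef_delta, if_neg (fun h => h2 ⟨by omega, h.2⟩), smul_zero]
  · omega
  · rw [map_zero]

theorem coef_coeff_delXY (b c : ℕ) (k : ℤ) (w : List Letter) :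
    QShuffle.coef w ((HahnSeries.ofPowerSeries ℤ (QShuffle q)
      (delXY b c (deltaNegSq q (-(J : ℤ))))).coeff k) =
      deltaNegSqCoef q J k (List.replicate b .x ++ (w ++ List.replicate c .y)) := by
  rw [PowerSeries.coeff_coe]
  split_ifs with hk
  · rw [map_zero, deltaNegSqCoef, if_neg]
    rintro ⟨h, -⟩
    omega
  · rw [delXY, PowerSeries.coeff_mk, QShuffle.coef_delLeft_iterate,
      QShuffle.coef_delRight_iterate, coef_coeff_deltaNegSq, List.append_assoc,
      Int.natAbs_of_nonneg (by omega)]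

variable (p : Fˣ) (r : ℕ → F)

theorem coef_KMat (a b : Fin (J + 1)) (k : ℤ) (w : List Letter) :
    QShuffle.coef w ((KMat q p r J a b).coeff k) = phi q p r J a b *
      deltaNegSqCoef q J (k - ((a : ℤ) - (b : ℤ) - (J : ℤ)))
        (List.replicate b .x ++ (w ++ List.replicate (J - a) .y)) := by
  rw [KMat, Matrix.of_apply, HahnSeries.coeff_smul, map_smul, HahnSeries.coeff_single_mul, one_mul,
    coef_coeff_delXY, smul_eq_mul]

theorem height_append (v w : List Letter) : height (v ++ w) = height v + height w := by
  simp [height]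

theorem height_replicate_x (n : ℕ) : height (List.replicate n .x) = n := by
  simp [height, Letter.sgn]

theorem height_replicate_y (n : ℕ) : height (List.replicate n .y) = -n := by
  simp [height, Letter.sgn]

theorem deltaNegSqCoef_eq_zero {k : ℤ} {w : List Letter} (hw : height w ≠ 0) :
    deltaNegSqCoef q J k w = 0 :=
  if_neg fun h => hw h.2

/-- The up step from height J has weight [J - J] = 0. This cuts the columns of the K-matrix off
after J + 1 of them. -/
theorem deltaNegSqCoef_replicate_succ (k : ℤ) (w : List Letter) :
    deltaNegSqCoef q J k (List.replicate (J + 1) .x ++ w) = 0 := by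
  rw [deltaNegSqCoef, pathCoeff_replicate_x, Finset.prod_range_succ, zero_add,
    add_neg_cancel, qInt_zero]
  simp

theorem deltaNegSqCoef_y (k : ℤ) (w : List Letter) : deltaNegSqCoef q J k (.y :: w) = 0 := by
  rw [deltaNegSqCoef, pathCoeff, qInt_zero]
  simp

/-- The peak from height b to b + 1 and back contributes [b - J][b + 1]. Removing it shortens the
word by two letters, and the sign from -t² cancels the one in [b - J] = -[J - b]. -/
theorem deltaNegSqCoef_replicate_y (b : ℕ) (k : ℤ) (w : List Letter) :
    deltaNegSqCoef q J k (List.replicate (b + 1) .x ++ .y :: w) =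
      qInt q (b + 1) * qInt q (J - b) *
        deltaNegSqCoef q J (k - 2) (List.replicate b .x ++ w) := by
  rw [deltaNegSqCoef, deltaNegSqCoef, pathCoeff_replicate_x, pathCoeff_replicate_x, pathCoeff,
    Finset.prod_range_succ, mul_ite, mul_zero]
  have e : qInt q (0 + b + -(J : ℤ)) = -qInt q (J - b) := by
    rw [← qInt_neg]
    congr 1
    ring
  refine if_congr ?_ ?_ rfl
  · rw [height_append, height_append, height_cons, height_replicate_x, height_replicate_x]
    simp only [List.length_append, List.length_replicate, List.length_cons, Letter.sgn]
    omega
  · rw [e, show (List.replicate (b + 1) Letter.x ++ Letter.y :: w).length / 2 =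
      (List.replicate b Letter.x ++ w).length / 2 + 1 by
        simp only [List.length_append, List.length_replicate, List.length_cons]; omega, pow_succ]
    push_cast
    rw [show (0 : ℤ) + (b + 1) - 1 = 0 + b by ring, zero_add, zero_add]
    ring

variable {q J p r}

theorem sqrtFactorial_succ (n : ℕ) : sqrtFactorial r (n + 1) = sqrtFactorial r n * r (n + 1) := by
  rw [sqrtFactorial, Finset.prod_range_succ, ← sqrtFactorial]

variable [CharZero F] (h : IsRootData q p r)
include h

omit [CharZero F] in
theorem sqrtFactorial_ne_zero (n : ℕ) : sqrtFactorial r n ≠ 0 :=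
  Finset.prod_ne_zero_iff.mpr fun i _ => h.root_ne_zero (by omega)

omit [CharZero F] in
theorem sqrtFactorial_sq (n : ℕ) : sqrtFactorial r n * sqrtFactorial r n = qFactorial q n := by
  rw [sqrtFactorial, qFactorial, ← Finset.prod_mul_distrib]
  refine Finset.prod_congr rfl fun i _ => ?_
  rw [← sq, h.sq_root]
  push_cast
  rfl

/-- The product of roots is the entry (b + 1, b) of the raising operator. The square roots in φ are
placed so that passing to a neighbouring column produces the symmetric form of the raising and
lowering operators. -/
theorem phi_succ (a b : ℕ) (hb : b < J) : phi q p r J a b =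
    (p : F)⁻¹ * (p : F) ^ (3 * J - 4 * a - 2 * b : ℤ) * (r (b + 1) * r (J - b)) *
      phi q p r J a (b + 1) := by
  obtain ⟨c, rfl⟩ : ∃ c, J = b + 1 + c := ⟨J - (b + 1), by omega⟩
  have h1 := h.root_ne_zero (n := b + 1) (by omega)
  have h2 := sqrtFactorial_ne_zero h b
  have h3 := sqrtFactorial_ne_zero h (b + 1 + c - a)
  have hp : (p : F) ≠ 0 := p.ne_zero
  have e : (p : F) ^ twoRho (a + 1) (b + 1) ↑(b + 1 + c) = (p : F)⁻¹ *
      (p : F) ^ (3 * ↑(b + 1 + c) - 4 * a - 2 * b : ℤ) *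
        (p : F) ^ twoRho (a + 1) (↑(b + 1) + 1) ↑(b + 1 + c) := by
    rw [← zpow_neg_one, ← zpow_add₀ hp, ← zpow_add₀ hp]
    congr 1
    simp only [twoRho]
    push_cast
    ring
  rw [phi, phi, Units.val_zpow_eq_zpow_val, Units.val_zpow_eq_zpow_val, e, sqrtFactorial_succ,
    show b + 1 + c - b = c + 1 by omega, show b + 1 + c - (b + 1) = c by omega,
    sqrtFactorial_succ]
  field_simp

theorem phi_anti (a : ℕ) (ha : a ≤ J) : phi q p r J a (J - a) * (qFactorial q J *
    (qFactorial q (J - a) / qFactorial q a)) = (p : F) ^ twoRho (a + 1) (J - a + 1) J := by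
  rw [phi, Units.val_zpow_eq_zpow_val, Nat.cast_sub ha, show J - (J - a) = a by omega]
  have h1 := sqrtFactorial_ne_zero h a
  have h2 := sqrtFactorial_ne_zero h (J - a)
  have h3 := sqrtFactorial_ne_zero h J
  rw [← sqrtFactorial_sq h, ← sqrtFactorial_sq h, ← sqrtFactorial_sq h]
  field_simp

end KMatrix

/-- A linear map of the `q`-shuffle algebra, applied to the coefficients of a Laurent series. -/
def coeffOp {q : Fˣ} (D : QShuffle q →ₗ[F] QShuffle q) :
    LaurentSeries (QShuffle q) →+ LaurentSeries (QShuffle q) :=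
  coeffMap D.toAddMonoidHom

theorem coeff_coeffOp {q : Fˣ} (D : QShuffle q →ₗ[F] QShuffle q) (x : LaurentSeries (QShuffle q))
    (k : ℤ) : (coeffOp D x).coeff k = D (x.coeff k) := rfl

theorem formWord_x (w : List Letter) : Letter.formWord .x w = 2 * height w := by
  induction w with
  | nil => rfl
  | cons a w ih =>
    rw [height_cons, mul_add, ← ih]
    cases a <;> rfl

theorem formWord_y (w : List Letter) : Letter.formWord .y w = -(2 * height w) := by
  induction w with
  | nil => rfl
  | cons a w ih =>
    rw [height_cons, mul_add, neg_add, ← ih]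
    cases a <;> rfl

/-- The projection to the multiples of the unit which sends a word `w` to the unit, and kills all
other words. -/
def QShuffle.coefOp {q : Fˣ} (w : List Letter) : QShuffle q →ₗ[F] QShuffle q :=
  (Algebra.linearMap F (QShuffle q)) ∘ₗ coef w

theorem coeff_lsVar_mul {B : Type*} [Ring B] (x : LaurentSeries B) (k : ℤ) :
    ((lsVar B : LaurentSeries B) * x).coeff k = x.coeff (k - 1) := by
  change (HahnSeries.single (1 : ℤ) (1 : B) * x).coeff k = _
  rw [HahnSeries.coeff_single_mul, one_mul]

theorem laurent_ext {q : Fˣ} {x y : LaurentSeries (QShuffle q)}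
    (h : ∀ k w, QShuffle.coef w (x.coeff k) = QShuffle.coef w (y.coeff k)) : x = y :=
  HahnSeries.ext (funext fun k => QShuffle.ext_coef (h k))

/-! ### Deletions, twists and constant terms of the K-matrix -/

section KMatrix

theorem neg_one_pow_mul_prod_qInt (q : Fˣ) (J b : ℕ) (hb : b ≤ J) :
    (-1) ^ b * (∏ i ∈ Finset.range b, qInt q (0 + i + -(J : ℤ))) * qFactorial q (J - b) =
      qFactorial q J := by
  induction b with
  | zero => simp
  | succ b ih =>
    rw [← ih (by omega), show J - b = J - (b + 1) + 1 by omega, qFactorial, qFactorial,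
      Finset.prod_range_succ, Finset.prod_range_succ, pow_succ,
      show (0 + b + -(J : ℤ)) = -((J - (b + 1) : ℕ) + 1) by omega, qInt_neg]
    ring

variable {q p : Fˣ} {r : ℕ → F} [CharZero F] (h : IsRootData q p r) {J : ℕ}

omit [CharZero F] in
-- The word w enters through x^b w y^(J-a), which must have height 0. Each entry is therefore
-- homogeneous in height, and the twists act on it by a scalar.
theorem coef_KMat_eq_zero_or (a b : Fin (J + 1)) (k : ℤ) (w : List Letter) :
    QShuffle.coef w ((KMat q p r J a b).coeff k) = 0 ∨ height w = J - a - b := by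
  rw [coef_KMat]
  by_cases hw : height (List.replicate b Letter.x ++ (w ++ List.replicate (J - a) Letter.y)) = 0
  · right
    rw [height_append, height_append, height_replicate_x, height_replicate_y] at hw
    omega
  · left
    rw [deltaNegSqCoef_eq_zero q J hw, mul_zero]

include h

omit [CharZero F] in
theorem twist_KMat_x (a b : Fin (J + 1)) : coeffOp (QShuffle.twist .x) (KMat q p r J a b) =
    (p : F) ^ (4 * (J - a - b) : ℤ) • KMat q p r J a b := by
  refine laurent_ext fun k w => ?_
  rw [coeff_coeffOp, QShuffle.coef_twist, HahnSeries.coeff_smul, map_smul, smul_eq_mul]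
  rcases coef_KMat_eq_zero_or (q := q) (p := p) (r := r) a b k w with h0 | hw
  · rw [h0, mul_zero, mul_zero]
  · rw [formWord_x, hw, ← h.sq_eq, ← zpow_natCast, ← zpow_mul, Units.val_zpow_eq_zpow_val]
    congr 2
    push_cast
    ring

omit [CharZero F] in
theorem twist_KMat_y (a b : Fin (J + 1)) : coeffOp (QShuffle.twist .y) (KMat q p r J a b) =
    (p : F)⁻¹ ^ (4 * (J - a - b) : ℤ) • KMat q p r J a b := by
  refine laurent_ext fun k w => ?_
  rw [coeff_coeffOp, QShuffle.coef_twist, HahnSeries.coeff_smul, map_smul, smul_eq_mul]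
  rcases coef_KMat_eq_zero_or (q := q) (p := p) (r := r) a b k w with h0 | hw
  · rw [h0, mul_zero, mul_zero]
  · rw [formWord_y, hw, ← h.sq_eq, ← zpow_natCast, ← zpow_mul, Units.val_zpow_eq_zpow_val,
      inv_zpow, ← zpow_neg]
    congr 2
    push_cast
    ring

/-- A leading x joins the block x^b, which gives the next column; the power of t in front of that
column is lower by one, whence the factor t. In the last column the coefficient vanishes by
`deltaNegSqCoef_replicate_succ`. -/
theorem delLeft_KMat_x (a b : Fin (J + 1)) : coeffOp (QShuffle.delLeft .x) (KMat q p r J a b) =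
    ∑ b', ((p : F)⁻¹ * (p : F) ^ (3 * J - 4 * a - 2 * b : ℤ) * raiseOp r J b' b) •
      ((lsVar (QShuffle q) : LaurentSeries (QShuffle q)) * KMat q p r J a b') := by
  refine laurent_ext fun k w => ?_
  rw [coeff_coeffOp, QShuffle.coef_delLeft, coef_KMat, HahnSeries.coeff_sum, map_sum]
  simp only [HahnSeries.coeff_smul, map_smul, coeff_lsVar_mul, smul_eq_mul, coef_KMat]
  simp only [raiseOp, Matrix.of_apply, mul_ite, ite_mul, mul_zero, zero_mul]
  obtain ⟨b, hb⟩ := b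
  dsimp only
  rw [sum_fin_ite_eq (b + 1) fun b' => (p : F)⁻¹ * (p : F) ^ (3 * J - 4 * a - 2 * b : ℤ) *
    (r (b + 1) * r (J - b)) * (phi q p r J a b' *
      deltaNegSqCoef q J (k - 1 - ((a : ℤ) - (b' : ℤ) - (J : ℤ)))
        (List.replicate b' Letter.x ++ (w ++ List.replicate (J - a) Letter.y)))]
  have e : List.replicate b Letter.x ++ (.x :: w ++ List.replicate (J - a) .y) =
      List.replicate (b + 1) .x ++ (w ++ List.replicate (J - a) .y) := by
    rw [List.replicate_succ', List.append_assoc]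
    rfl
  simp only [e]
  split_ifs with hbJ
  · rw [phi_succ h a b (by omega), mul_assoc]
    congr 3
    push_cast
    ring
  · obtain rfl : b = J := by omega
    rw [deltaNegSqCoef_replicate_succ, mul_zero]

/-- A leading y forms a peak with the last letter of the block x^b, which leads to the preceding
column with the weight of the peak as a factor. Dividing by the ratio of the φ leaves one copy of
each square root, the entry of the lowering operator. In the first column a leading y has
coefficient 0. -/
theorem delLeft_KMat_y (a b : Fin (J + 1)) : coeffOp (QShuffle.delLeft .y) (KMat q p r J a b) =
    ∑ b', ((p : F)⁻¹ * (p : F)⁻¹ ^ (3 * J - 4 * a - 2 * b : ℤ) * lowerOp r J b' b) •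
      ((lsVar (QShuffle q) : LaurentSeries (QShuffle q)) * KMat q p r J a b') := by
  refine laurent_ext fun k w => ?_
  rw [coeff_coeffOp, QShuffle.coef_delLeft, coef_KMat, HahnSeries.coeff_sum, map_sum]
  simp only [HahnSeries.coeff_smul, map_smul, coeff_lsVar_mul, smul_eq_mul, coef_KMat]
  simp only [lowerOp, Matrix.of_apply, mul_ite, ite_mul, mul_zero, zero_mul, List.cons_append]
  obtain ⟨b, hb⟩ := b
  obtain _ | b := b
  · simp [deltaNegSqCoef_y]
  simp only [Nat.add_right_cancel_iff]
  rw [sum_fin_ite_eq b fun b' => (p : F)⁻¹ * (p : F)⁻¹ ^ (3 * J - 4 * a - 2 * (b + 1 : ℕ) : ℤ) *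
    (r (b' + 1) * r (J - b')) * (phi q p r J a b' *
      deltaNegSqCoef q J (k - 1 - ((a : ℤ) - (b' : ℤ) - (J : ℤ)))
        (List.replicate b' Letter.x ++ (w ++ List.replicate (J - a) Letter.y))), if_pos (by omega),
    phi_succ h a b (by omega), deltaNegSqCoef_replicate_y]
  have hp : (p : F) ≠ 0 := p.ne_zero
  have e1 : (p : F)⁻¹ ^ (3 * J - 4 * a - 2 * (b + 1 : ℕ) : ℤ) =
      (p : F) * (p : F) * ((p : F) ^ (3 * J - 4 * a - 2 * b : ℤ))⁻¹ := by
    rw [inv_zpow, ← zpow_neg, ← zpow_neg, ← sq, ← zpow_natCast, ← zpow_add₀ hp]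
    congr 1
    push_cast
    ring
  have e2 := h.root_mul_self (b + 1)
  have e3 := h.root_mul_self (J - b)
  rw [Nat.cast_sub (by omega)] at e3
  push_cast at e2
  rw [e1, ← e2, ← e3, show k - ((a : ℤ) - (b + 1 : ℕ) - J) - 2 = k - 1 - (a - b - J) by
    push_cast; ring]
  have := zpow_ne_zero (3 * J - 4 * a - 2 * b : ℤ) hp
  field_simp

/-- The empty word corresponds to the path x^b y^(J-a), which closes only on the antidiagonal. Its
exponent of t is a + b - J = 0, and its weight cancels the factorials in φ. -/
theorem coefOp_nil_KMat (a b : Fin (J + 1)) : coeffOp (QShuffle.coefOp []) (KMat q p r J a b) =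
    (if (a : ℕ) + b = J then (p : F) ^ twoRho (a + 1) (J - a + 1) J else 0) • 1 := by
  ext k
  rw [coeff_coeffOp, QShuffle.coefOp, LinearMap.comp_apply, coef_KMat, Algebra.linearMap_apply,
    HahnSeries.coeff_smul, HahnSeries.coeff_one, List.nil_append]
  split_ifs with hab hk hk
  · have hb : (b : ℕ) = J - a := by omega
    have hq : qFactorial q a ≠ 0 := Finset.prod_ne_zero_iff.mpr fun i _ =>
      h.qInt_ne_zero (by omega)
    rw [deltaNegSqCoef, if_pos, pathCoeff_replicate_x, zero_add, hb, pathCoeff_replicate_y,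
      ← phi_anti h a (by omega), Algebra.algebraMap_eq_smul_one,
      ← neg_one_pow_mul_prod_qInt q J (J - a) (by omega), show J - (J - a) = (a : ℕ) by omega]
    · congr 2
      rw [show (List.replicate (J - a) Letter.x ++ List.replicate (J - a) Letter.y).length / 2 =
        J - a by simp only [List.length_append, List.length_replicate]; omega]
      field_simp
    · rw [height_append, height_replicate_x, height_replicate_y]
      simp only [List.length_append, List.length_replicate]
      omega
  · rw [deltaNegSqCoef, if_neg, mul_zero, map_zero, smul_zero]
    rw [not_and']
    intro _ h1
    simp only [List.length_append, List.length_replicate] at h1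
    omega
  · rw [deltaNegSqCoef_eq_zero, mul_zero, map_zero, zero_smul]
    rw [height_append, height_replicate_x, height_replicate_y]
    omega
  · rw [deltaNegSqCoef_eq_zero, mul_zero, map_zero, zero_smul]
    rw [height_append, height_replicate_x, height_replicate_y]
    omega

end KMatrix

/-! ### Coefficientwise operators on Laurent series in two variables -/

section TwoVariableOperators

variable {q : Fˣ}

/-- A linear map of the `q`-shuffle algebra, applied to the coefficients of a Laurent series in two
variables. -/
def coeffOp₂ (D : QShuffle q →ₗ[F] QShuffle q) :
    Laurent₂ (QShuffle q) →+ Laurent₂ (QShuffle q) :=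
  coeffMap (coeffOp D)

theorem coeff_coeffOp₂ (D : QShuffle q →ₗ[F] QShuffle q) (x : Laurent₂ (QShuffle q)) (i j : ℤ) :
    ((coeffOp₂ D x).coeff i).coeff j = D ((x.coeff i).coeff j) := rfl

theorem laurent₂_ext {B : Type*} [Ring B] {x y : Laurent₂ B}
    (h : ∀ i j, (x.coeff i).coeff j = (y.coeff i).coeff j) : x = y :=
  HahnSeries.ext (funext fun i => HahnSeries.ext (funext fun j => h i j))

section Products

variable {B : Type*} [Ring B]

theorem coeff_inS_mul (f : LaurentSeries B) (x : Laurent₂ B) (i : ℤ) :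
    (inS f * x).coeff i = f * x.coeff i :=
  HahnSeries.coeff_single_zero_mul

theorem coeff_mul_inS (f : LaurentSeries B) (x : Laurent₂ B) (i : ℤ) :
    (x * inS f).coeff i = x.coeff i * f :=
  HahnSeries.coeff_mul_single_zero

theorem coeff_inT (f : LaurentSeries B) (i : ℤ) : (inT f).coeff i = HahnSeries.C (f.coeff i) := rfl

/-- The two series involve different variables, so each coefficient is a single product and rules
for products of shuffle elements apply coefficientwise. -/
theorem coeff_inS_mul_inT (f g : LaurentSeries B) (i j : ℤ) :
    ((inS f * inT g).coeff i).coeff j = f.coeff j * g.coeff i := by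
  rw [coeff_inS_mul, coeff_inT]
  exact HahnSeries.coeff_mul_single_zero

theorem coeff_inT_mul_inS (f g : LaurentSeries B) (i j : ℤ) :
    ((inT g * inS f).coeff i).coeff j = g.coeff i * f.coeff j := by
  rw [coeff_mul_inS, coeff_inT]
  exact HahnSeries.coeff_single_zero_mul

theorem coeff_tVar_mul (x : Laurent₂ B) (i : ℤ) :
    ((tVar B : Laurent₂ B) * x).coeff i = x.coeff (i - 1) :=
  coeff_lsVar_mul x i

theorem coeff_mul_tVar (x : Laurent₂ B) (i : ℤ) :
    (x * (tVar B : Laurent₂ B)).coeff i = x.coeff (i - 1) := by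
  change (x * HahnSeries.single (1 : ℤ) (1 : LaurentSeries B)).coeff i = _
  rw [HahnSeries.coeff_mul_single, mul_one]

theorem coeff_sVar_mul (x : Laurent₂ B) (i j : ℤ) :
    (((sVar B : Laurent₂ B) * x).coeff i).coeff j = (x.coeff i).coeff (j - 1) := by
  change ((inS (lsVar B : LaurentSeries B) * x).coeff i).coeff j = _
  rw [coeff_inS_mul, coeff_lsVar_mul]

theorem coeff_mul_sVar (x : Laurent₂ B) (i j : ℤ) :
    ((x * (sVar B : Laurent₂ B)).coeff i).coeff j = (x.coeff i).coeff (j - 1) := by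
  change ((x * inS (lsVar B : LaurentSeries B)).coeff i).coeff j = _
  rw [coeff_mul_inS]
  change (x.coeff i * HahnSeries.single (1 : ℤ) (1 : B)).coeff j = _
  rw [HahnSeries.coeff_mul_single, mul_one]

theorem inS_lsVar_mul (f : LaurentSeries B) :
    inS ((lsVar B : LaurentSeries B) * f) = (sVar B : Laurent₂ B) * inS f :=
  map_mul (HahnSeries.C : LaurentSeries B →+* Laurent₂ B) _ _

theorem inT_lsVar_mul (f : LaurentSeries B) :
    inT ((lsVar B : LaurentSeries B) * f) = (tVar B : Laurent₂ B) * inT f := by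
  refine HahnSeries.ext (funext fun i => ?_)
  rw [coeff_tVar_mul, coeff_inT, coeff_inT, coeff_lsVar_mul]

theorem inS_sum {ι : Type*} (s : Finset ι) (f : ι → LaurentSeries B) :
    inS (∑ i ∈ s, f i) = ∑ i ∈ s, inS (f i) :=
  map_sum (HahnSeries.C : LaurentSeries B →+* Laurent₂ B) _ _

theorem inT_sum {ι : Type*} (s : Finset ι) (f : ι → LaurentSeries B) :
    inT (∑ i ∈ s, f i) = ∑ i ∈ s, inT (f i) :=
  map_sum (coeffMap (HahnSeries.C : B →+* LaurentSeries B).toAddMonoidHom) _ _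

variable [Algebra F B]

theorem inS_smul (c : F) (f : LaurentSeries B) : inS (c • f) = c • inS f := by
  refine HahnSeries.ext (funext fun i => ?_)
  rw [HahnSeries.coeff_smul]
  by_cases hi : i = 0
  · simp [inS, hi]
  · simp [inS, HahnSeries.coeff_single_of_ne hi]

theorem inT_smul (c : F) (f : LaurentSeries B) : inT (c • f) = c • inT f := by
  refine laurent₂_ext fun i j => ?_
  rw [HahnSeries.coeff_smul, HahnSeries.coeff_smul, coeff_inT, coeff_inT, HahnSeries.coeff_smul]
  by_cases hj : j = 0
  · simp [hj]
  · simp [HahnSeries.coeff_single_of_ne hj]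

end Products

theorem coeffOp₂_smul (D : QShuffle q →ₗ[F] QShuffle q) (c : F) (x : Laurent₂ (QShuffle q)) :
    coeffOp₂ D (c • x) = c • coeffOp₂ D x := by
  refine laurent₂_ext fun i j => ?_
  simp only [coeff_coeffOp₂, HahnSeries.coeff_smul, map_smul]

theorem coeffOp₂_delLeft_inS_mul_inT (a : Letter) (f g : LaurentSeries (QShuffle q)) :
    coeffOp₂ (QShuffle.delLeft a) (inS f * inT g) =
      inS (coeffOp (QShuffle.delLeft a) f) * inT g +
        inS (coeffOp (QShuffle.twist a) f) * inT (coeffOp (QShuffle.delLeft a) g) := by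
  refine laurent₂_ext fun i j => ?_
  simp only [coeff_coeffOp₂, HahnSeries.coeff_add, coeff_inS_mul_inT, coeff_coeffOp,
    QShuffle.delLeft_mul]

theorem coeffOp₂_delLeft_inT_mul_inS (a : Letter) (f g : LaurentSeries (QShuffle q)) :
    coeffOp₂ (QShuffle.delLeft a) (inT f * inS g) =
      inT (coeffOp (QShuffle.delLeft a) f) * inS g +
        inT (coeffOp (QShuffle.twist a) f) * inS (coeffOp (QShuffle.delLeft a) g) := by
  refine laurent₂_ext fun i j => ?_
  simp only [coeff_coeffOp₂, HahnSeries.coeff_add, coeff_inT_mul_inS, coeff_coeffOp,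
    QShuffle.delLeft_mul]

theorem QShuffle.coefOp_nil_mul (X Y : QShuffle q) :
    coefOp [] (X * Y) = coefOp [] X * coefOp [] Y := by
  simp only [coefOp, LinearMap.comp_apply, coef_nil_mul, Algebra.linearMap_apply, map_mul]

theorem coeffOp₂_coefOp_inS_mul_inT (f g : LaurentSeries (QShuffle q)) :
    coeffOp₂ (QShuffle.coefOp []) (inS f * inT g) =
      inS (coeffOp (QShuffle.coefOp []) f) * inT (coeffOp (QShuffle.coefOp []) g) := by
  refine laurent₂_ext fun i j => ?_
  simp only [coeff_coeffOp₂, coeff_inS_mul_inT, coeff_coeffOp, QShuffle.coefOp_nil_mul]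

theorem coeffOp₂_coefOp_inT_mul_inS (f g : LaurentSeries (QShuffle q)) :
    coeffOp₂ (QShuffle.coefOp []) (inT f * inS g) =
      inT (coeffOp (QShuffle.coefOp []) f) * inS (coeffOp (QShuffle.coefOp []) g) := by
  refine laurent₂_ext fun i j => ?_
  simp only [coeff_coeffOp₂, coeff_inT_mul_inS, coeff_coeffOp, QShuffle.coefOp_nil_mul]

variable (q) in
/-- The central elements which commute with all coefficientwise linear operators. -/
def scalars : Subalgebra F (Laurent₂ (QShuffle q)) where
  carrier := {c | (∀ x, c * x = x * c) ∧
    ∀ (D : QShuffle q →ₗ[F] QShuffle q) x, coeffOp₂ D (c * x) = c * coeffOp₂ D x}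
  mul_mem' := by
    rintro c d ⟨hc, hc'⟩ ⟨hd, hd'⟩
    refine ⟨fun x => ?_, fun D x => ?_⟩
    · rw [mul_assoc, hd, ← mul_assoc, hc, mul_assoc]
    · rw [mul_assoc, hc', hd', mul_assoc]
  add_mem' := by
    rintro c d ⟨hc, hc'⟩ ⟨hd, hd'⟩
    refine ⟨fun x => ?_, fun D x => ?_⟩
    · rw [add_mul, hc, hd, mul_add]
    · rw [add_mul, map_add, hc', hd', add_mul]
  algebraMap_mem' c := ⟨fun x => Algebra.commutes c x, fun D x => by
    rw [← Algebra.smul_def, ← Algebra.smul_def, coeffOp₂_smul]⟩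

theorem mul_comm_of_mem_scalars {c : Laurent₂ (QShuffle q)} (hc : c ∈ scalars q)
    (x : Laurent₂ (QShuffle q)) : c * x = x * c := hc.1 x

theorem coeffOp₂_mul_of_mem_scalars (D : QShuffle q →ₗ[F] QShuffle q)
    {c : Laurent₂ (QShuffle q)} (hc : c ∈ scalars q) (x : Laurent₂ (QShuffle q)) :
    coeffOp₂ D (c * x) = c * coeffOp₂ D x := hc.2 D x

theorem inv_mem_scalars {u : (Laurent₂ (QShuffle q))ˣ} (hu : (u : Laurent₂ (QShuffle q)) ∈ scalars q) :
    ((u⁻¹ : (Laurent₂ (QShuffle q))ˣ) : Laurent₂ (QShuffle q)) ∈ scalars q := by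
  refine ⟨fun x => ?_, fun D x => ?_⟩
  · rw [Units.inv_mul_eq_iff_eq_mul, ← mul_assoc, mul_comm_of_mem_scalars hu, mul_assoc,
      Units.mul_inv, mul_one]
  · rw [Units.eq_inv_mul_iff_mul_eq, ← coeffOp₂_mul_of_mem_scalars D hu, Units.mul_inv_cancel_left]

theorem tVar_mem_scalars : (tVar (QShuffle q) : Laurent₂ (QShuffle q)) ∈ scalars q := by
  refine ⟨fun x => ?_, fun D x => ?_⟩
  · refine HahnSeries.ext (funext fun i => ?_)
    rw [coeff_tVar_mul, coeff_mul_tVar]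
  · refine laurent₂_ext fun i j => ?_
    simp only [coeff_coeffOp₂, coeff_tVar_mul]

theorem sVar_mem_scalars : (sVar (QShuffle q) : Laurent₂ (QShuffle q)) ∈ scalars q := by
  refine ⟨fun x => ?_, fun D x => ?_⟩
  · refine laurent₂_ext fun i j => ?_
    rw [coeff_sVar_mul, coeff_mul_sVar]
  · refine laurent₂_ext fun i j => ?_
    simp only [coeff_coeffOp₂, coeff_sVar_mul]

/-- A family of series vanishes when its constant terms do, and the left deletions of its members
are combinations of its members with scalar coefficients. -/
theorem eq_zero_of_coeffOp₂ {ι : Type*} [Fintype ι] (X : ι → Laurent₂ (QShuffle q))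
    (h0 : ∀ i, coeffOp₂ (QShuffle.coefOp []) (X i) = 0)
    (hD : ∀ a i, ∃ c : ι → Laurent₂ (QShuffle q), (∀ j, c j ∈ scalars q) ∧
      coeffOp₂ (QShuffle.delLeft a) (X i) = ∑ j, c j * X j) (i : ι) : X i = 0 := by
  -- Induction on w for all members at once: the coefficient of a w in X i is the coefficient of w
  -- in its deletion by a, a combination of members whose coefficients at w vanish.
  have hw : ∀ w i, coeffOp₂ (QShuffle.coefOp w) (X i) = 0 := by
    intro w
    induction w with
    | nil => exact h0
    | cons a w ih =>
      intro i
      obtain ⟨c, hc, e⟩ := hD a i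
      have e2 : coeffOp₂ (QShuffle.coefOp (a :: w)) (X i) =
          coeffOp₂ (QShuffle.coefOp w) (coeffOp₂ (QShuffle.delLeft a) (X i)) := by
        refine laurent₂_ext fun k l => ?_
        simp only [coeff_coeffOp₂, QShuffle.coefOp, LinearMap.comp_apply, QShuffle.coef_delLeft]
      rw [e2, e, map_sum]
      refine Finset.sum_eq_zero fun j _ => ?_
      rw [coeffOp₂_mul_of_mem_scalars _ (hc j), ih, mul_zero]
  refine laurent₂_ext fun k l => QShuffle.eq_zero_of_coef fun w => ?_
  have : QShuffle.coefOp w (((X i).coeff k).coeff l) = 0 := by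
    rw [← coeff_coeffOp₂, hw]
    rfl
  have hinj : Function.Injective (algebraMap F (QShuffle q)) := by
    intro c d hcd
    have := congrArg (QShuffle.coef []) hcd
    simpa [Algebra.algebraMap_eq_smul_one, QShuffle.one_def, QShuffle.coef_word] using this
  exact hinj (this.trans (map_zero _).symm)

end TwoVariableOperators

/-! ### Entries of products with tensor products of scalar matrices -/

section MatrixEntries

variable {q : Fˣ} {m n : ℕ}

theorem smul_def₂ (c : F) (x : Laurent₂ (QShuffle q)) :
    c • x = algebraMap F (Laurent₂ (QShuffle q)) c * x :=
  Algebra.smul_def c x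

theorem smul_mul₂ (c : F) (x y : Laurent₂ (QShuffle q)) : c • x * y = c • (x * y) := by
  rw [smul_def₂, smul_def₂, mul_assoc]

theorem mul_smul₂ (c : F) (x y : Laurent₂ (QShuffle q)) : x * c • y = c • (x * y) := by
  rw [smul_def₂, smul_def₂, ← mul_assoc, ← Algebra.commutes, mul_assoc]

theorem mul_smul_kronecker_diagonal_apply {c : Laurent₂ (QShuffle q)} (hc : ∀ x, c * x = x * c)
    (U : Matrix (Fin m) (Fin m) F) (d : Fin n → F) 
    (M : Matrix (Fin m × Fin n) (Fin m × Fin n) (Laurent₂ (QShuffle q)))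
    (α β : Fin m × Fin n) :
    (M * c • (U ⊗ₖ Matrix.diagonal d).map (algebraMap F (Laurent₂ (QShuffle q)))) α β =
      ∑ b, (U b β.1 * d β.2) • (c * M α (b, β.2)) := by
  rw [Matrix.mul_apply, Fintype.sum_prod_type]
  refine Finset.sum_congr rfl fun b _ => ?_
  rw [Finset.sum_eq_single β.2]
  · rw [Matrix.smul_apply, smul_eq_mul, Matrix.map_apply, Matrix.kroneckerMap_apply,
      Matrix.diagonal_apply_eq, smul_def₂, ← mul_assoc, ← hc, Algebra.commutes]
  · intro k _ hk
    rw [Matrix.smul_apply, Matrix.map_apply, Matrix.kroneckerMap_apply,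
      Matrix.diagonal_apply_ne _ hk, mul_zero, map_zero, smul_eq_mul, mul_zero,
      mul_zero]
  · simp

theorem mul_smul_diagonal_kronecker_apply {c : Laurent₂ (QShuffle q)} (hc : ∀ x, c * x = x * c)
    (U : Matrix (Fin n) (Fin n) F) (d : Fin m → F) 
    (M : Matrix (Fin m × Fin n) (Fin m × Fin n) (Laurent₂ (QShuffle q)))
    (α β : Fin m × Fin n) :
    (M * c • (Matrix.diagonal d ⊗ₖ U).map (algebraMap F (Laurent₂ (QShuffle q)))) α β =
      ∑ b, (d β.1 * U b β.2) • (c * M α (β.1, b)) := by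
  rw [Matrix.mul_apply, Fintype.sum_prod_type_right]
  refine Finset.sum_congr rfl fun b _ => ?_
  rw [Finset.sum_eq_single β.1]
  · rw [Matrix.smul_apply, smul_eq_mul, Matrix.map_apply, Matrix.kroneckerMap_apply,
      Matrix.diagonal_apply_eq, smul_def₂, ← mul_assoc, ← hc, Algebra.commutes]
  · intro k _ hk
    rw [Matrix.smul_apply, Matrix.map_apply, Matrix.kroneckerMap_apply,
      Matrix.diagonal_apply_ne _ hk, zero_mul, map_zero, smul_eq_mul, mul_zero,
      mul_zero]
  · simp

end MatrixEntries

/-! ### Left deletions of the products of K-matrices -/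

section KProducts

variable (q p : Fˣ) (r : ℕ → F) (J₁ J₂ : ℕ)

/-- `K₁(s) R̂ K₂(t)`. -/
def leftProd : Matrix (Fin (J₁ + 1) × Fin (J₂ + 1)) (Fin (J₁ + 1) × Fin (J₂ + 1))
    (Laurent₂ (QShuffle q)) :=
  ((KMat q p r J₁).map inS ⊗ₖ 1) * (RHat p J₁ J₂).map (algebraMap F (Laurent₂ (QShuffle q))) *
    (1 ⊗ₖ (KMat q p r J₂).map inT)

/-- `K₂(t) R̂ K₁(s)`. -/
def rightProd : Matrix (Fin (J₁ + 1) × Fin (J₂ + 1)) (Fin (J₁ + 1) × Fin (J₂ + 1))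
    (Laurent₂ (QShuffle q)) :=
  (1 ⊗ₖ (KMat q p r J₂).map inT) * (RHat p J₁ J₂).map (algebraMap F (Laurent₂ (QShuffle q))) *
    ((KMat q p r J₁).map inS ⊗ₖ 1)

theorem leftProd_apply (α β : Fin (J₁ + 1) × Fin (J₂ + 1)) : leftProd q p r J₁ J₂ α β =
    (p : F) ^ (((J₁ : ℤ) - 2 * (β.1 : ℕ)) * ((J₂ : ℤ) - 2 * (α.2 : ℕ))) •
      (inS (KMat q p r J₁ α.1 β.1) * inT (KMat q p r J₂ α.2 β.2)) := by
  rw [leftProd, RHat, Matrix.diagonal_map (map_zero _), Matrix.mul_apply, Fintype.sum_prod_type,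
    Finset.sum_eq_single β.1, Finset.sum_eq_single α.2]
  · rw [Matrix.mul_diagonal, Matrix.kroneckerMap_apply, Matrix.kroneckerMap_apply,
      Matrix.one_apply_eq, Matrix.one_apply_eq, mul_one, one_mul, ← Algebra.commutes, mul_assoc,
      ← smul_def₂, Units.val_zpow_eq_zpow_val]
    rfl
  · intro k _ hk
    rw [Matrix.mul_diagonal, Matrix.kroneckerMap_apply, Matrix.one_apply_ne hk.symm]
    simp
  · simp
  · intro k _ hk
    refine Finset.sum_eq_zero fun l _ => ?_
    rw [Matrix.kroneckerMap_apply _ _ _ (k, l) β, Matrix.one_apply_ne hk]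
    simp
  · simp

theorem rightProd_apply (α β : Fin (J₁ + 1) × Fin (J₂ + 1)) : rightProd q p r J₁ J₂ α β =
    (p : F) ^ (((J₁ : ℤ) - 2 * (α.1 : ℕ)) * ((J₂ : ℤ) - 2 * (β.2 : ℕ))) •
      (inT (KMat q p r J₂ α.2 β.2) * inS (KMat q p r J₁ α.1 β.1)) := by
  rw [rightProd, RHat, Matrix.diagonal_map (map_zero _), Matrix.mul_apply, Fintype.sum_prod_type,
    Finset.sum_eq_single α.1, Finset.sum_eq_single β.2]
  · rw [Matrix.mul_diagonal, Matrix.kroneckerMap_apply, Matrix.kroneckerMap_apply,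
      Matrix.one_apply_eq, Matrix.one_apply_eq, mul_one, one_mul, ← Algebra.commutes, mul_assoc,
      ← smul_def₂, Units.val_zpow_eq_zpow_val]
    rfl
  · intro k _ hk
    rw [Matrix.kroneckerMap_apply _ _ _ (α.1, k) β, Matrix.one_apply_ne hk]
    simp
  · simp
  · intro k _ hk
    refine Finset.sum_eq_zero fun l _ => ?_
    rw [Matrix.mul_diagonal, Matrix.kroneckerMap_apply, Matrix.one_apply_ne hk.symm]
    simp
  · simp

/-- The left deletion of the letter `l` acts on the columns of the K-matrices by the operators `U`,
which shift the weight by the parameter `P`. -/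
structure IsStep (l : Letter) (P : F) (U : (J : ℕ) → Matrix (Fin (J + 1)) (Fin (J + 1)) F) :
    Prop where
  ne_zero : P ≠ 0
  delLeft : ∀ (J : ℕ) (a b : Fin (J + 1)), coeffOp (QShuffle.delLeft l) (KMat q p r J a b) =
    ∑ b', ((p : F)⁻¹ * P ^ (3 * J - 4 * a - 2 * b : ℤ) * U J b' b) •
      ((lsVar (QShuffle q) : LaurentSeries (QShuffle q)) * KMat q p r J a b')
  twist : ∀ (J : ℕ) (a b : Fin (J + 1)), coeffOp (QShuffle.twist l) (KMat q p r J a b) =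
    P ^ (4 * (J - a - b) : ℤ) • KMat q p r J a b
  shift : ∀ (J : ℕ) (b' b : Fin (J + 1)) (k : ℤ), (p : F) ^ ((J - 2 * b) * k : ℤ) * U J b' b =
    (p : F) ^ ((J - 2 * b') * k : ℤ) * P ^ (2 * k) * U J b' b

/-- The diagonal matrix with entries `c * P ^ (u + v * (a₁ + a₂))`. -/
def weightDiag {J₁ J₂ : ℕ} (A : Type*) [Ring A] [Algebra F A] (c P : F) (u v : ℤ) :
    Matrix (Fin (J₁ + 1) × Fin (J₂ + 1)) (Fin (J₁ + 1) × Fin (J₂ + 1)) A :=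
  Matrix.diagonal fun α => algebraMap F A (c * P ^ (u + v * (α.1 + α.2)))

variable {q p r J₁ J₂} {l : Letter} {P : F} {U : (J : ℕ) → Matrix (Fin (J + 1)) (Fin (J + 1)) F}
  (hU : IsStep q p r l P U)

theorem weightOp_eq_zpow (hP : P ≠ 0) (n : ℕ) : weightOp P n =
    Matrix.diagonal fun i : Fin (n + 1) => P ^ (n - 2 * i : ℤ) := by
  rw [weightOp]
  congr 1
  ext i
  rw [zpow_sub₀ hP, mul_comm (2 : ℤ), zpow_mul]
  simp only [zpow_natCast, zpow_ofNat]

include hU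

/-- In the twisted Leibniz rule, the term that deletes from K₁ moves U past R̂, which costs a power
of P by `shift`; the term that deletes from K₂ carries the twist of K₁. Once the factors depending
on the total row or column weight are split off, the two powers left are the group-like parts of a
coproduct of U. -/
theorem IsStep.delLeft_leftProd :
    (leftProd q p r J₁ J₂).map (coeffOp₂ (QShuffle.delLeft l)) =
      weightDiag _ (p : F)⁻¹ P (3 * J₁ + 3 * J₂) (-4) * (leftProd q p r J₁ J₂ *
        ((sVar (QShuffle q) : Laurent₂ (QShuffle q)) •
          (U J₁ ⊗ₖ weightOp P⁻¹ J₂).map (algebraMap F (Laurent₂ (QShuffle q))) +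
        (tVar (QShuffle q) : Laurent₂ (QShuffle q)) •
          (weightOp P J₁ ⊗ₖ U J₂).map (algebraMap F (Laurent₂ (QShuffle q))))) *
      weightDiag _ 1 P 0 (-2) := by
  have hP := hU.ne_zero
  ext1 α β
  rw [Matrix.map_apply, leftProd_apply, coeffOp₂_smul, coeffOp₂_delLeft_inS_mul_inT, hU.delLeft,
    hU.delLeft, hU.twist, weightDiag, weightDiag, Matrix.mul_diagonal, Matrix.diagonal_mul,
    Matrix.mul_add, Matrix.add_apply, weightOp_eq_zpow hP, weightOp_eq_zpow (inv_ne_zero hP),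
    mul_smul_kronecker_diagonal_apply (mul_comm_of_mem_scalars sVar_mem_scalars),
    mul_smul_diagonal_kronecker_apply (mul_comm_of_mem_scalars tVar_mem_scalars),
    ← Algebra.commutes, ← smul_def₂, ← smul_def₂, smul_smul, smul_add, smul_add,
    inS_sum, inT_sum, inS_smul, Finset.sum_mul, Finset.mul_sum]
  simp only [Finset.smul_sum]
  congr 1
  · refine Finset.sum_congr rfl fun b' _ => ?_
    rw [leftProd_apply, inS_smul, inS_lsVar_mul, smul_mul₂, smul_smul, smul_smul,
      mul_smul₂, smul_smul, mul_assoc (sVar (QShuffle q) : Laurent₂ (QShuffle q))]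
    congr 1
    have := hU.shift J₁ b' β.1 ((J₂ : ℤ) - 2 * (α.2 : ℕ))
    have e : P ^ (2 * ((J₂ : ℤ) - 2 * (α.2 : ℕ))) * P ^ (3 * J₁ - 4 * α.1 - 2 * β.1 : ℤ) =
        P ^ (0 + -2 * (β.1 + β.2) : ℤ) * P ^ (3 * J₁ + 3 * J₂ + -4 * (α.1 + α.2) : ℤ) *
          P⁻¹ ^ (J₂ - 2 * β.2 : ℤ) := by
      rw [inv_zpow, ← zpow_neg, ← zpow_add₀ hP, ← zpow_add₀ hP, ← zpow_add₀ hP]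
      congr 1
      ring
    linear_combination ((p : F)⁻¹ * P ^ (3 * J₁ - 4 * α.1 - 2 * β.1 : ℤ)) * this +
      ((p : F)⁻¹ * U J₁ b' β.1 * (p : F) ^ ((J₁ - 2 * b') * (J₂ - 2 * α.2) : ℤ)) * e
  · refine Finset.sum_congr rfl fun b' _ => ?_
    rw [leftProd_apply, inT_smul, inT_lsVar_mul, smul_mul₂, mul_smul₂, smul_smul, smul_smul,
      mul_smul₂, smul_smul, smul_smul, ← mul_assoc (inS _),
      ← mul_comm_of_mem_scalars tVar_mem_scalars, mul_assoc (tVar (QShuffle q) : Laurent₂ (QShuffle q))]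
    congr 1
    have e : P ^ (4 * (J₁ - α.1 - β.1) : ℤ) * P ^ (3 * J₂ - 4 * α.2 - 2 * β.2 : ℤ) =
        P ^ (0 + -2 * (β.1 + β.2) : ℤ) * P ^ (3 * J₁ + 3 * J₂ + -4 * (α.1 + α.2) : ℤ) *
          P ^ (J₁ - 2 * β.1 : ℤ) := by
      rw [← zpow_add₀ hP, ← zpow_add₀ hP, ← zpow_add₀ hP]
      congr 1
      ring
    linear_combination
      ((p : F)⁻¹ * U J₂ b' β.2 * (p : F) ^ ((J₁ - 2 * β.1) * (J₂ - 2 * α.2) : ℤ)) * e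

/-- With K₂ in front the roles are exchanged: K₂ is twisted and R̂ is crossed by the operator on the
second space. The outer diagonal factors are unchanged, but the inner coproduct is the opposite one.
-/
theorem IsStep.delLeft_rightProd :
    (rightProd q p r J₁ J₂).map (coeffOp₂ (QShuffle.delLeft l)) =
      weightDiag _ (p : F)⁻¹ P (3 * J₁ + 3 * J₂) (-4) * (rightProd q p r J₁ J₂ *
        ((sVar (QShuffle q) : Laurent₂ (QShuffle q)) •
          (U J₁ ⊗ₖ weightOp P J₂).map (algebraMap F (Laurent₂ (QShuffle q))) +
        (tVar (QShuffle q) : Laurent₂ (QShuffle q)) •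
          (weightOp P⁻¹ J₁ ⊗ₖ U J₂).map (algebraMap F (Laurent₂ (QShuffle q))))) *
      weightDiag _ 1 P 0 (-2) := by
  have hP := hU.ne_zero
  ext1 α β
  rw [Matrix.map_apply, rightProd_apply, coeffOp₂_smul, coeffOp₂_delLeft_inT_mul_inS, hU.delLeft,
    hU.delLeft, hU.twist, weightDiag, weightDiag, Matrix.mul_diagonal, Matrix.diagonal_mul,
    Matrix.mul_add, Matrix.add_apply, weightOp_eq_zpow hP, weightOp_eq_zpow (inv_ne_zero hP),
    mul_smul_kronecker_diagonal_apply (mul_comm_of_mem_scalars sVar_mem_scalars),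
    mul_smul_diagonal_kronecker_apply (mul_comm_of_mem_scalars tVar_mem_scalars),
    ← Algebra.commutes, ← smul_def₂, ← smul_def₂, smul_smul, smul_add, smul_add,
    inS_sum, inT_sum, inT_smul, Finset.sum_mul, Finset.mul_sum, add_comm]
  simp only [Finset.smul_sum]
  congr 1
  · refine Finset.sum_congr rfl fun b' _ => ?_
    rw [rightProd_apply, inS_smul, inS_lsVar_mul, smul_mul₂, mul_smul₂, smul_smul, smul_smul,
      mul_smul₂, smul_smul, smul_smul, ← mul_assoc (inT _),
      ← mul_comm_of_mem_scalars sVar_mem_scalars, mul_assoc (sVar (QShuffle q) : Laurent₂ (QShuffle q))]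
    congr 1
    have e : P ^ (4 * (J₂ - α.2 - β.2) : ℤ) * P ^ (3 * J₁ - 4 * α.1 - 2 * β.1 : ℤ) =
        P ^ (0 + -2 * (β.1 + β.2) : ℤ) * P ^ (3 * J₁ + 3 * J₂ + -4 * (α.1 + α.2) : ℤ) *
          P ^ (J₂ - 2 * β.2 : ℤ) := by
      rw [← zpow_add₀ hP, ← zpow_add₀ hP, ← zpow_add₀ hP]
      congr 1
      ring
    linear_combination
      ((p : F)⁻¹ * U J₁ b' β.1 * (p : F) ^ ((J₁ - 2 * α.1) * (J₂ - 2 * β.2) : ℤ)) * e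
  · refine Finset.sum_congr rfl fun b' _ => ?_
    rw [rightProd_apply, inT_smul, inT_lsVar_mul, smul_mul₂, smul_smul, smul_smul,
      mul_smul₂, smul_smul, mul_assoc (tVar (QShuffle q) : Laurent₂ (QShuffle q))]
    congr 1
    have := hU.shift J₂ b' β.2 ((J₁ : ℤ) - 2 * (α.1 : ℕ))
    rw [mul_comm ((J₂ : ℤ) - _), mul_comm ((J₂ : ℤ) - _)] at this
    have e : P ^ (2 * ((J₁ : ℤ) - 2 * (α.1 : ℕ))) * P ^ (3 * J₂ - 4 * α.2 - 2 * β.2 : ℤ) =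
        P ^ (0 + -2 * (β.1 + β.2) : ℤ) * P ^ (3 * J₁ + 3 * J₂ + -4 * (α.1 + α.2) : ℤ) *
          P⁻¹ ^ (J₁ - 2 * β.1 : ℤ) := by
      rw [inv_zpow, ← zpow_neg, ← zpow_add₀ hP, ← zpow_add₀ hP, ← zpow_add₀ hP]
      congr 1
      ring
    linear_combination ((p : F)⁻¹ * P ^ (3 * J₂ - 4 * α.2 - 2 * β.2 : ℤ)) * this +
      ((p : F)⁻¹ * U J₂ b' β.2 * (p : F) ^ ((J₁ - 2 * α.1) * (J₂ - 2 * b') : ℤ)) * e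

end KProducts

/-- The matrix of the reflection `(a, b) ↦ (J₁ - a, J₂ - b)`. -/
def reflectionMat (A : Type*) [Ring A] (J₁ J₂ : ℕ) :
    Matrix (Fin (J₁ + 1) × Fin (J₂ + 1)) (Fin (J₁ + 1) × Fin (J₂ + 1)) A :=
  (1 : Matrix _ _ A).submatrix (Equiv.refl _) (Equiv.prodCongr Fin.revPerm Fin.revPerm)

/-! ### The recursion for the defect of the reflection equation -/

section Intertwining

variable {q p : Fˣ} {r : ℕ → F} [CharZero F] (h : IsRootData q p r)
include h

theorem isStep_raiseOp : IsStep q p r .x (p : F) (raiseOp r) where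
  ne_zero := p.ne_zero
  delLeft _ a b := delLeft_KMat_x h a b
  twist _ a b := twist_KMat_x h a b
  shift J b' b k := by
    simp only [raiseOp, Matrix.of_apply, mul_ite, mul_zero]
    split_ifs with hb
    · rw [← zpow_add₀ p.ne_zero, hb]
      congr 2
      push_cast
      ring
    · rfl

theorem isStep_lowerOp : IsStep q p r .y (p : F)⁻¹ (lowerOp r) where
  ne_zero := inv_ne_zero p.ne_zero
  delLeft _ a b := delLeft_KMat_y h a b
  twist _ a b := twist_KMat_y h a b
  shift J b' b k := by
    simp only [lowerOp, Matrix.of_apply, mul_ite, mul_zero]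
    split_ifs with hb
    · rw [inv_zpow, ← zpow_neg, ← zpow_add₀ p.ne_zero, ← hb]
      congr 2
      push_cast
      ring
    · rfl

theorem RMat_comm_diagonal {A : Type*} [Ring A] [Algebra F A] (m n : ℕ) (z : Aˣ) (f : ℕ → F) :
    RMat q p r (m + 1) (n + 1) z * Matrix.diagonal (fun α => algebraMap F A (f (α.1 + α.2))) =
      Matrix.diagonal (fun α => algebraMap F A (f (α.1 + α.2))) *
        RMat q p r (m + 1) (n + 1) z := by
  ext ⟨a, i⟩ ⟨b, k⟩
  rw [Matrix.mul_diagonal, Matrix.diagonal_mul, ← Algebra.commutes]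
  by_cases hw : (a : ℕ) + i = b + k
  · rw [hw]
  · rw [RMat_weight h m n z a b i k hw, mul_zero, mul_zero]

theorem RMat_comm_weightDiag {A : Type*} [Ring A] [Algebra F A] (m n : ℕ) (z : Aˣ) (c P : F)
    (u v : ℤ) : RMat q p r (m + 1) (n + 1) z * weightDiag A c P u v =
      weightDiag A c P u v * RMat q p r (m + 1) (n + 1) z := by
  have := RMat_comm_diagonal h (A := A) m n z fun k => c * P ^ (u + v * k)
  simp only [Nat.cast_add] at this
  exact this

theorem RMat_comm_rev {A : Type*} [Ring A] [Algebra F A] (m n : ℕ) (z : Aˣ) :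
    RMat q p r (m + 1) (n + 1) z *
        reflectionMat A (m + 1) (n + 1) =
      reflectionMat A (m + 1) (n + 1) *
        RMat q p r (m + 1) (n + 1) z := by
  rw [reflectionMat, Matrix.mul_submatrix_one, Matrix.one_submatrix_mul]
  ext ⟨a, i⟩ ⟨b, k⟩
  have := RMat_rev h m n z a b.rev i k.rev
  simpa using this.symm

omit h [CharZero F] in
-- The unit t/s already lives in the subalgebra of scalars, and R over the full ring is the image of
-- R over that subalgebra.
theorem RMat_mem_scalars (m n : ℕ) (α β : Fin (m + 1) × Fin (n + 1)) :
    RMat q p r m n (tVar (QShuffle q) / sVar (QShuffle q)) α β ∈ scalars q := by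
  have h1 : ((tVar (QShuffle q) / sVar (QShuffle q) : (Laurent₂ (QShuffle q))ˣ) :
      Laurent₂ (QShuffle q)) ∈ scalars q := by
    rw [div_eq_mul_inv, Units.val_mul]
    exact mul_mem tVar_mem_scalars (inv_mem_scalars sVar_mem_scalars)
  have h2 := inv_mem_scalars h1
  set z := tVar (QShuffle q) / sVar (QShuffle q)
  let z' : (scalars q)ˣ := ⟨⟨z, h1⟩, ⟨_, h2⟩, Subtype.ext z.mul_inv, Subtype.ext z.inv_mul⟩
  have e := congrFun (congrFun (RMat_map (A := scalars q)
    (A' := Laurent₂ (QShuffle q)) (scalars q).val q p r m n z') α) β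
  rw [show Units.map _ z' = z from Units.ext rfl] at e
  rw [e]
  exact Subtype.property _

omit h [CharZero F] in
theorem smul_mul_of_mem_scalars {ι : Type*} [Fintype ι] {c : Laurent₂ (QShuffle q)}
    (hc : c ∈ scalars q) (X Y : Matrix ι ι (Laurent₂ (QShuffle q))) :
    X * c • Y = c • (X * Y) := by
  ext1 i j
  rw [Matrix.smul_apply, Matrix.mul_apply, Matrix.mul_apply, smul_eq_mul, Finset.mul_sum]
  refine Finset.sum_congr rfl fun k _ => ?_
  rw [Matrix.smul_apply, smul_eq_mul, ← mul_assoc, ← mul_comm_of_mem_scalars hc, mul_assoc]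

omit h [CharZero F] in
-- The intertwining relation at z = t/s is multiplied by the central unit s, which gives the
-- coproducts the parameters s and t found in the deletions.
theorem homogenize {ι : Type*} [Fintype ι] (X Y X' Y' R : Matrix ι ι (Laurent₂ (QShuffle q)))
    (e : (X + ((tVar (QShuffle q) / sVar (QShuffle q) : (Laurent₂ (QShuffle q))ˣ) :
      Laurent₂ (QShuffle q)) • Y) * R = R * (X' + ((tVar (QShuffle q) / sVar (QShuffle q) :
      (Laurent₂ (QShuffle q))ˣ) : Laurent₂ (QShuffle q)) • Y')) :
    ((sVar (QShuffle q) : Laurent₂ (QShuffle q)) • X +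
      (tVar (QShuffle q) : Laurent₂ (QShuffle q)) • Y) * R =
    R * ((sVar (QShuffle q) : Laurent₂ (QShuffle q)) • X' +
      (tVar (QShuffle q) : Laurent₂ (QShuffle q)) • Y') := by
  have hst : (tVar (QShuffle q) : Laurent₂ (QShuffle q)) = (sVar (QShuffle q) : Laurent₂ _) *
      ((tVar (QShuffle q) / sVar (QShuffle q) : (Laurent₂ (QShuffle q))ˣ) :
        Laurent₂ (QShuffle q)) := by
    rw [mul_comm_of_mem_scalars sVar_mem_scalars, ← Units.val_mul, div_mul_cancel]
  have hs : ∀ Z W : Matrix ι ι (Laurent₂ (QShuffle q)),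
      (sVar (QShuffle q) : Laurent₂ (QShuffle q)) • Z +
        (tVar (QShuffle q) : Laurent₂ (QShuffle q)) • W =
      (sVar (QShuffle q) : Laurent₂ (QShuffle q)) •
        (Z + ((tVar (QShuffle q) / sVar (QShuffle q) : (Laurent₂ (QShuffle q))ˣ) :
          Laurent₂ (QShuffle q)) • W) := fun Z W => by
    ext1 i j
    simp only [Matrix.add_apply, Matrix.smul_apply, smul_eq_mul]
    rw [hst, mul_add, mul_assoc]
  rw [hs, hs, smul_mul_of_mem_scalars sVar_mem_scalars, ← e]
  ext1 i j
  simp only [Matrix.mul_apply, Matrix.smul_apply, smul_eq_mul, Finset.mul_sum, mul_assoc]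

omit h [CharZero F] in
theorem mul_map_coeffOp₂ {ι : Type*} [Fintype ι] (D : QShuffle q →ₗ[F] QShuffle q)
    {R : Matrix ι ι (Laurent₂ (QShuffle q))} (hR : ∀ i j, R i j ∈ scalars q)
    (M : Matrix ι ι (Laurent₂ (QShuffle q))) :
    (R * M).map (coeffOp₂ D) = R * M.map (coeffOp₂ D) := by
  ext1 i j
  simp only [Matrix.map_apply, Matrix.mul_apply, map_sum, coeffOp₂_mul_of_mem_scalars D (hR _ _)]

omit h [CharZero F] in
theorem map_coeffOp₂_mul {ι : Type*} [Fintype ι] (D : QShuffle q →ₗ[F] QShuffle q)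
    {R : Matrix ι ι (Laurent₂ (QShuffle q))} (hR : ∀ i j, R i j ∈ scalars q)
    (M : Matrix ι ι (Laurent₂ (QShuffle q))) :
    (M * R).map (coeffOp₂ D) = M.map (coeffOp₂ D) * R := by
  ext1 i j
  simp only [Matrix.map_apply, Matrix.mul_apply, map_sum,
    ← mul_comm_of_mem_scalars (hR _ _), coeffOp₂_mul_of_mem_scalars D (hR _ _)]

variable {l : Letter} {P : F} {U : (J : ℕ) → Matrix (Fin (J + 1)) (Fin (J + 1)) F}

/-- The defect of the reflection equation satisfies a first order linear recursion. -/
theorem IsStep.exists_coeffOp₂_delLeft (hU : IsStep q p r l P U) (m n : ℕ)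
    (e : ((sVar (QShuffle q) : Laurent₂ (QShuffle q)) •
          (U (m + 1) ⊗ₖ weightOp P (n + 1)).map (algebraMap F (Laurent₂ (QShuffle q))) +
        (tVar (QShuffle q) : Laurent₂ (QShuffle q)) •
          (weightOp P⁻¹ (m + 1) ⊗ₖ U (n + 1)).map (algebraMap F (Laurent₂ (QShuffle q)))) *
        RMat q p r (m + 1) (n + 1) (tVar (QShuffle q) / sVar (QShuffle q)) =
      RMat q p r (m + 1) (n + 1) (tVar (QShuffle q) / sVar (QShuffle q)) *
        ((sVar (QShuffle q) : Laurent₂ (QShuffle q)) •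
          (U (m + 1) ⊗ₖ weightOp P⁻¹ (n + 1)).map (algebraMap F (Laurent₂ (QShuffle q))) +
        (tVar (QShuffle q) : Laurent₂ (QShuffle q)) •
          (weightOp P (m + 1) ⊗ₖ U (n + 1)).map (algebraMap F (Laurent₂ (QShuffle q)))))
    (X : Matrix (Fin (m + 2) × Fin (n + 2)) (Fin (m + 2) × Fin (n + 2)) (Laurent₂ (QShuffle q)))
    (hX : X = RMat q p r (m + 1) (n + 1) (tVar (QShuffle q) / sVar (QShuffle q)) *
        leftProd q p r (m + 1) (n + 1) - rightProd q p r (m + 1) (n + 1) *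
        RMat q p r (m + 1) (n + 1) (tVar (QShuffle q) / sVar (QShuffle q))) (α β) :
    ∃ c : Fin (m + 2) × Fin (n + 2) → Laurent₂ (QShuffle q), (∀ γ, c γ ∈ scalars q) ∧
      coeffOp₂ (QShuffle.delLeft l) (X α β) = ∑ γ, c γ * X α γ := by
  have hmem := RMat_mem_scalars (q := q) (p := p) (r := r) (m + 1) (n + 1)
  have hc1 := RMat_comm_weightDiag h (A := Laurent₂ (QShuffle q)) m n
    (tVar (QShuffle q) / sVar (QShuffle q)) (p : F)⁻¹ P (3 * (m + 1 : ℕ) + 3 * (n + 1 : ℕ)) (-4)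
  have hc2 := RMat_comm_weightDiag h (A := Laurent₂ (QShuffle q)) m n
    (tVar (QShuffle q) / sVar (QShuffle q)) 1 P 0 (-2)
  have hL := hU.delLeft_leftProd (J₁ := m + 1) (J₂ := n + 1)
  have hN := hU.delLeft_rightProd (J₁ := m + 1) (J₂ := n + 1)
  have hA : ∀ γ β, ((sVar (QShuffle q) : Laurent₂ (QShuffle q)) •
          (U (m + 1) ⊗ₖ weightOp P⁻¹ (n + 1)).map (algebraMap F (Laurent₂ (QShuffle q))) +
        (tVar (QShuffle q) : Laurent₂ (QShuffle q)) •
          (weightOp P (m + 1) ⊗ₖ U (n + 1)).map (algebraMap F (Laurent₂ (QShuffle q)))) γ β ∈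
        scalars q := fun γ β => by
    rw [Matrix.add_apply, Matrix.smul_apply, Matrix.smul_apply, Matrix.map_apply, Matrix.map_apply,
      smul_eq_mul, smul_eq_mul]
    exact add_mem (mul_mem sVar_mem_scalars (algebraMap_mem _ _))
      (mul_mem tVar_mem_scalars (algebraMap_mem _ _))
  generalize RMat q p r (m + 1) (n + 1) (tVar (QShuffle q) / sVar (QShuffle q)) = R at *
  generalize leftProd q p r (m + 1) (n + 1) = L at *
  generalize rightProd q p r (m + 1) (n + 1) = N at *
  generalize hA' : ((sVar (QShuffle q) : Laurent₂ (QShuffle q)) •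
          (U (m + 1) ⊗ₖ weightOp P⁻¹ (n + 1)).map (algebraMap F (Laurent₂ (QShuffle q))) +
        (tVar (QShuffle q) : Laurent₂ (QShuffle q)) •
          (weightOp P (m + 1) ⊗ₖ U (n + 1)).map (algebraMap F (Laurent₂ (QShuffle q)))) = A at *
  generalize ((sVar (QShuffle q) : Laurent₂ (QShuffle q)) •
          (U (m + 1) ⊗ₖ weightOp P (n + 1)).map (algebraMap F (Laurent₂ (QShuffle q))) +
        (tVar (QShuffle q) : Laurent₂ (QShuffle q)) •
          (weightOp P⁻¹ (m + 1) ⊗ₖ U (n + 1)).map (algebraMap F (Laurent₂ (QShuffle q)))) = B at *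
  set Θ := weightDiag (J₁ := m + 1) (J₂ := n + 1) (Laurent₂ (QShuffle q)) (p : F)⁻¹ P
    (3 * (m + 1 : ℕ) + 3 * (n + 1 : ℕ)) (-4) with hΘ
  set Λ := weightDiag (J₁ := m + 1) (J₂ := n + 1) (Laurent₂ (QShuffle q)) (1 : F) P 0 (-2) with hΛ
  -- R consists of scalars, so the deletion passes through it. It commutes with Θ and Λ by weight
  -- conservation, and B R = R A converts the coproduct on the right summand.
  have key : X.map (coeffOp₂ (QShuffle.delLeft l)) = Θ * (X * A) * Λ := by
    have : X.map (coeffOp₂ (QShuffle.delLeft l)) = R * L.map (coeffOp₂ (QShuffle.delLeft l)) -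
        N.map (coeffOp₂ (QShuffle.delLeft l)) * R := by
      rw [hX, ← mul_map_coeffOp₂ _ hmem, ← map_coeffOp₂_mul _ hmem]
      exact Matrix.map_sub _ (map_sub _) _ _
    rw [this, hL, hN, hX]
    have e1 : R * (Θ * (L * A) * Λ) = Θ * (R * L * A) * Λ := by
      simp only [← Matrix.mul_assoc, hc1]
    have e2 : Θ * (N * B) * Λ * R = Θ * (N * R * A) * Λ := by
      rw [Matrix.mul_assoc _ Λ R, ← hc2]
      simp only [Matrix.mul_assoc]
      rw [← Matrix.mul_assoc B, e, Matrix.mul_assoc]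
    rw [e1, e2, Matrix.sub_mul, Matrix.mul_sub, Matrix.sub_mul]
  -- Θ and Λ are diagonal and A acts on columns, so only row α of X enters; the coefficients are
  -- those of column β of A with the two diagonal entries.
  refine ⟨fun γ => algebraMap F _ ((p : F)⁻¹ * P ^ ((3 * (m + 1 : ℕ) + 3 * (n + 1 : ℕ) : ℤ) +
    -4 * (α.1 + α.2))) * A γ β * algebraMap F _ (1 * P ^ (0 + -2 * (β.1 + β.2) : ℤ)),
    fun γ => mul_mem (mul_mem (algebraMap_mem _ _) (hA γ β)) (algebraMap_mem _ _), ?_⟩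
  have := congrFun (congrFun key α) β
  rw [Matrix.map_apply, hΘ, hΛ, weightDiag, weightDiag, Matrix.mul_diagonal, Matrix.diagonal_mul,
    Matrix.mul_apply, Finset.mul_sum, Finset.sum_mul] at this
  rw [this]
  refine Finset.sum_congr rfl fun γ _ => ?_
  rw [← mul_comm_of_mem_scalars (hA γ β), ← mul_assoc, mul_assoc _ (X α γ), ← Algebra.commutes,
    ← mul_assoc]

end Intertwining

/-! ### Constant terms of the products of K-matrices -/

section ConstantTerm

variable {q p : Fˣ} {r : ℕ → F} [CharZero F] (h : IsRootData q p r)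

/-- The constant term of the products of K-matrices is this function of the total weight, times the
reflection. -/
def constWeight (p : Fˣ) (J₁ J₂ : ℕ) (k : ℕ) : F :=
  (p : F) ^ (2 * k * (J₁ + J₂) - 2 * k ^ 2 - J₁ * J₂ + twoRho 1 (J₁ + 1) J₁ +
    twoRho 1 (J₂ + 1) J₂ : ℤ)

omit [CharZero F] in
-- On the antidiagonals the exponents of R̂ and of both φ combine to a function of a + i alone. The
-- mixed terms cancel, which is what makes the constant term commute with R.
theorem zpow_mul_twoRho {J₁ J₂ a b i k : ℕ} (h1 : a + b = J₁) (h2 : i + k = J₂) :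
    (p : F) ^ ((J₁ - 2 * b) * (J₂ - 2 * i) : ℤ) *
      ((p : F) ^ twoRho (a + 1) (J₁ - a + 1) J₁ * (p : F) ^ twoRho (i + 1) (J₂ - i + 1) J₂) =
      constWeight p J₁ J₂ (a + i) := by
  rw [constWeight, ← zpow_add₀ p.ne_zero, ← zpow_add₀ p.ne_zero]
  congr 1
  simp only [twoRho]
  generalize (J₁ * (3 * J₁ + 13) / 2 : ℤ) = x
  generalize (J₂ * (3 * J₂ + 13) / 2 : ℤ) = y
  subst h1 h2
  push_cast
  ring

theorem inS_one {B : Type*} [Ring B] : inS (1 : LaurentSeries B) = 1 :=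
  map_one (HahnSeries.C : LaurentSeries B →+* Laurent₂ B)

theorem inT_one {B : Type*} [Ring B] : inT (1 : LaurentSeries B) = 1 := by
  refine HahnSeries.ext (funext fun i => ?_)
  rw [coeff_inT, HahnSeries.coeff_one, HahnSeries.coeff_one]
  split_ifs
  · exact map_one _
  · exact map_zero _

omit [CharZero F] in
theorem diagonal_mul_rev_apply {A : Type*} [Ring A] [Algebra F A] {J₁ J₂ : ℕ} (f : ℕ → F)
    (α β : Fin (J₁ + 1) × Fin (J₂ + 1)) :
    (Matrix.diagonal (fun α : Fin (J₁ + 1) × Fin (J₂ + 1) => algebraMap F A (f (α.1 + α.2))) *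
        reflectionMat A J₁ J₂) α β =
      if (α.1 : ℕ) + β.1 = J₁ ∧ (α.2 : ℕ) + β.2 = J₂ then algebraMap F A (f (α.1 + α.2)) else 0 := by
  have e : α = (Equiv.prodCongr Fin.revPerm Fin.revPerm) β ↔
      (α.1 : ℕ) + β.1 = J₁ ∧ (α.2 : ℕ) + β.2 = J₂ := by
    rw [Prod.ext_iff, Fin.ext_iff, Fin.ext_iff]
    simp only [Equiv.prodCongr_apply, Prod.map, Fin.revPerm_apply, Fin.val_rev]
    omega
  rw [reflectionMat, Matrix.diagonal_mul, Matrix.submatrix_apply, Equiv.refl_apply, Matrix.one_apply, mul_ite,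
    mul_one, mul_zero]
  exact if_congr e rfl rfl

include h

theorem leftProd_constantTerm (J₁ J₂ : ℕ) :
    (leftProd q p r J₁ J₂).map (coeffOp₂ (QShuffle.coefOp [])) =
      Matrix.diagonal (fun α => algebraMap F _ (constWeight p J₁ J₂ (α.1 + α.2))) *
        reflectionMat _ J₁ J₂ := by
  ext1 ⟨a, i⟩ ⟨b, k⟩
  rw [Matrix.map_apply, leftProd_apply, coeffOp₂_smul, coeffOp₂_coefOp_inS_mul_inT,
    coefOp_nil_KMat h, coefOp_nil_KMat h, diagonal_mul_rev_apply, inS_smul, inT_smul, inS_one,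
    inT_one, smul_mul₂, mul_smul₂, smul_smul, smul_smul, mul_one, smul_def₂, mul_one,
    ← map_zero (algebraMap F (Laurent₂ (QShuffle q))), ← apply_ite]
  congr 1
  dsimp only
  by_cases h1 : (a : ℕ) + b = J₁ <;> by_cases h2 : (i : ℕ) + k = J₂
  · rw [if_pos h1, if_pos h2, if_pos ⟨h1, h2⟩, ← zpow_mul_twoRho h1 h2, mul_assoc]
  all_goals simp [h1, h2]

theorem rightProd_constantTerm (J₁ J₂ : ℕ) :
    (rightProd q p r J₁ J₂).map (coeffOp₂ (QShuffle.coefOp [])) =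
      Matrix.diagonal (fun α => algebraMap F _ (constWeight p J₁ J₂ (α.1 + α.2))) *
        reflectionMat _ J₁ J₂ := by
  ext1 ⟨a, i⟩ ⟨b, k⟩
  rw [Matrix.map_apply, rightProd_apply, coeffOp₂_smul, coeffOp₂_coefOp_inT_mul_inS,
    coefOp_nil_KMat h, coefOp_nil_KMat h, diagonal_mul_rev_apply, inS_smul, inT_smul, inS_one,
    inT_one, smul_mul₂, mul_smul₂, smul_smul, smul_smul, mul_one, smul_def₂, mul_one,
    ← map_zero (algebraMap F (Laurent₂ (QShuffle q))), ← apply_ite]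
  congr 1
  dsimp only
  by_cases h1 : (a : ℕ) + b = J₁ <;> by_cases h2 : (i : ℕ) + k = J₂
  -- On the antidiagonals both factors change sign, so R̂ contributes the same power in either order
  -- of the K-matrices.
  · have e : ((J₁ - 2 * a) * (J₂ - 2 * k) : ℤ) = (J₁ - 2 * b) * (J₂ - 2 * i) := by
      rw [show (J₁ : ℤ) = a + b by omega, show (J₂ : ℤ) = i + k by omega]
      ring
    rw [if_pos h1, if_pos h2, if_pos ⟨h1, h2⟩, ← zpow_mul_twoRho h1 h2, e]
    ring
  all_goals simp [h1, h2]

end ConstantTerm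

/-! ### The reflection equation -/

section ReflectionEquation

variable {q p : Fˣ} {r : ℕ → F} [CharZero F] (h : IsRootData q p r)
include h

theorem RMat_mul_leftProd (m n : ℕ) :
    RMat q p r (m + 1) (n + 1) (tVar (QShuffle q) / sVar (QShuffle q)) *
        leftProd q p r (m + 1) (n + 1) = rightProd q p r (m + 1) (n + 1) *
      RMat q p r (m + 1) (n + 1) (tVar (QShuffle q) / sVar (QShuffle q)) := by
  have hmem := RMat_mem_scalars (q := q) (p := p) (r := r) (m + 1) (n + 1)
  have hx := homogenize _ _ _ _ _
    (RMat_raise h m n (tVar (QShuffle q) / sVar (QShuffle q)))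
  have hy := homogenize _ _ _ _ _
    (RMat_lower h m n (tVar (QShuffle q) / sVar (QShuffle q)))
  rw [← sub_eq_zero]
  generalize hX : RMat q p r (m + 1) (n + 1) (tVar (QShuffle q) / sVar (QShuffle q)) *
        leftProd q p r (m + 1) (n + 1) - rightProd q p r (m + 1) (n + 1) *
      RMat q p r (m + 1) (n + 1) (tVar (QShuffle q) / sVar (QShuffle q)) = X
  -- Both products have the same constant term, a diagonal function of the total weight times the
  -- reflection; R commutes with the first by weight conservation and with the second by flip
  -- symmetry.
  have h0 : X.map (coeffOp₂ (QShuffle.coefOp [])) = 0 := by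
    rw [← hX, Matrix.map_sub _ (map_sub _), mul_map_coeffOp₂ _ hmem, map_coeffOp₂_mul _ hmem,
      leftProd_constantTerm h, rightProd_constantTerm h, Matrix.mul_assoc, ← RMat_comm_rev h,
      ← Matrix.mul_assoc, RMat_comm_diagonal h, Matrix.mul_assoc, sub_self]
  ext1 α β
  refine eq_zero_of_coeffOp₂ (X α) (fun β => congrFun (congrFun h0 α) β) (fun l β => ?_) β
  cases l
  · exact (isStep_raiseOp h).exists_coeffOp₂_delLeft h m n hx X hX.symm α β
  · refine (isStep_lowerOp h).exists_coeffOp₂_delLeft h m n ?_ X hX.symm α β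
    rwa [inv_inv]

end ReflectionEquation

end FreidelMaillet

end

theorem theorem3p1 {F : Type*} [Field F] [CharZero F] (hF : ∀ a : F, IsSquare a)
    (q : Fˣ) (hq : ∀ n : ℕ, 0 < n → q ^ n ≠ 1)
    (p : Fˣ) (hp : p ^ 2 = q)
    (r : ℕ → F) (hr : ∀ n : ℕ, r n ^ 2 = qInt q n)
    (J₁ J₂ : ℕ) (hJ₁ : 0 < J₁) (hJ₂ : 0 < J₂) :
    let S : Type _ := Laurent₂ (QShuffle q)
    let R : Matrix (Fin (J₁ + 1) × Fin (J₂ + 1)) (Fin (J₁ + 1) × Fin (J₂ + 1)) S :=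
      RMat q p r J₁ J₂
        (tVar (QShuffle q) / sVar (QShuffle q))
    let Rhat : Matrix (Fin (J₁ + 1) × Fin (J₂ + 1)) (Fin (J₁ + 1) × Fin (J₂ + 1)) S :=
      (RHat p J₁ J₂).map (algebraMap F S)
    let K₁ : Matrix (Fin (J₁ + 1) × Fin (J₂ + 1)) (Fin (J₁ + 1) × Fin (J₂ + 1)) S :=
      (KMat q p r J₁).map inS ⊗ₖ 1
    let K₂ : Matrix (Fin (J₁ + 1) × Fin (J₂ + 1)) (Fin (J₁ + 1) × Fin (J₂ + 1)) S :=
      1 ⊗ₖ (KMat q p r J₂).map inT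
    R * K₁ * Rhat * K₂ = K₂ * Rhat * K₁ * R := by
  have h : IsRootData q p r := ⟨hq, hp, hr⟩
  obtain ⟨m, rfl⟩ := Nat.exists_eq_succ_of_ne_zero hJ₁.ne'
  obtain ⟨n, rfl⟩ := Nat.exists_eq_succ_of_ne_zero hJ₂.ne'
  intro S R Rhat K₁ K₂
  rw [Matrix.mul_assoc, Matrix.mul_assoc, ← Matrix.mul_assoc K₁]
  exact RMat_mul_leftProd h m n
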